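/- Let $\Lambda$ be a lattice (a free abelian group) of finite rank $s$, $V=\Lambda\otimes_{\mathbb Z}\mathbb C$, $U=V^*$, and let $X$ be a finite list of non-zero elements of $\Lambda$ (repetitions allowed) which spans $V$. A sublist $Y\subset X$ is a cocircuit if $X\setminus Y$ does not span $V$. Toric side. Let $J_X\subset\mathbb C[\Lambda]$ be the ideal generated by the elements $\prod_{a\in Y}(1-e^{-a})$, $Y$ running over the cocircuits of $X$. Let $S_X=\mathbb C[\Lambda]\big[\prod_{a\in X}(1-e^{-a})^{-1}\big]$, let $S_{X,k}\subset S_X$ be the span of the fractions $f/\prod_{a\in X}(1-e^{-a})^{h_a}$, $f\in\mathbb C[\Lambda]$, $h_a\ge 0$, for which the vectors $a$ with $h_a>0$ span a space of dimension $\le k$, and put $\Pi_X=S_X/S_{X,s-1}$. Let $v_X\in\Pi_X$ be the class of $\prod_{a\in X}(1-e^{-a})^{-1}$ and $\mathcal Q_X=\mathbb C[\Lambda]v_X$. Linear side. For a finite list $Z$ of non-zero vectors spanning $V$ let $I_Z\subset S[V]$ be the ideal generated by the products $\prod_{a\in Y}a$, $Y$ running over the cocircuits of $Z$, and $A_Z=S[V]/I_Z$.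 Let $R_Z=S[V]\big[\prod_{a\in Z}a^{-1}\big]$ with the analogous filtration $R_{Z,k}$, $P_Z=R_Z/R_{Z,s-1}$, $u_Z\in P_Z$ the class of $\prod_{a\in Z}a^{-1}$, and $Q_Z=S[V]u_Z$. Points. Let $P(X)$ be the set of the characters $\varphi:\Lambda\to\mathbb C^*$ that are trivial on some basis of $V$ extracted from $X$; for $\varphi\in P(X)$ let $X_\varphi=\{a\in X\mid\varphi(a)=1\}$. Theorem. The set $P(X)$ is finite, and the annihilator of $v_X$ in $\mathbb C[\Lambda]$ is $J_X$, so that $f\mapsto f v_X$ induces an isomorphism of $\mathbb C[\Lambda]$-modules $\mathbb C[\Lambda]/J_X\cong\mathcal Q_X$. Moreover there is a commutative diagram of isomorphisms $$\begin{array}{ccc}\mathbb C[\Lambda]/J_X&\xrightarrow{\ \cong\ }&\bigoplus_{\varphi\in P(X)}A_{X_\varphi}\\ {\scriptstyle\cong}\downarrow&&\downarrow{\scriptstyle\cong}\\ \mathcal Q_X&\xrightarrow{\ \cong\ }&\bigoplus_{\varphi\in P(X)}Q_{X_\varphi}\end{array}$$ in which: (i) the left map is $f\mapsto f v_X$; (ii)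 the top map is the isomorphism of $\mathbb C$-algebras with $e^a\mapsto(\varphi(a)\exp(a))_\varphi$ for $a\in\Lambda$ (the elements of $V$ are nilpotent in $A_{X_\varphi}$); (iii) the bottom map is the restriction of a linear isomorphism $j:\Pi_X\to\bigoplus_{\varphi\in P(X)}P_{X_\varphi}$ with the following properties: each $a\in\Lambda$ acts locally nilpotently on $P_{X_\varphi}$, and under $j$ the multiplication by $e^a$ becomes the operator $\varphi(a)\exp(a)$ on $P_{X_\varphi}$; for $u\in U$ the derivation $e^a\mapsto\langle u|a\rangle e^a$ corresponds to the derivation $D_u$, $v\mapsto\langle u|v\rangle$ ($v\in V$); and, for each basis $b$ of $V$ extracted from $X_\varphi$, with $\Lambda_b$ the lattice that it generates, the class of $|\Lambda/\Lambda_b|^{-1}\sum_{\lambda}\varphi(\lambda)^{-1}e^\lambda\prod_{a\in b}(1-e^{-a})^{-1}$, $\lambda$ running over representatives of $\Lambda/\Lambda_b$, is mapped to the class of $\prod_{a\in b}a^{-1}$ in the summand $P_{X_\varphi}$; (iv) the right map is, for each $\varphi$, the multiplication in $A_{X_\varphi}$ by the unit $$\prod_{a\in X\setminus X_\varphi}\frac1{1-\varphi(a)^{-1}\exp(-a)}\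 \prod_{a\in X_\varphi}\frac{a}{1-\exp(-a)},$$ followed by the isomorphism of $S[V]$-modules $A_{X_\varphi}\cong Q_{X_\varphi}$ that sends $1$ to $u_{X_\varphi}$. -/

import Mathlib

open scoped TensorProduct

noncomputable section

namespace ToricPolar

/-! ### Lists of vectors and polar parts over a general base ring

A list is a finite family `v : ι → V` (repetitions allowed).  `d : ι → A` is the family of equations
to be inverted, `d i` being attached to the vector `v i`. -/

section General

variable {V : Type*} [AddCommGroup V] [Module ℂ V]
variable {A : Type*} [CommRing A]
variable {ι : Type*} [Fintype ι]

/-- A sublist `Y` is a cocircuit of the list `v` if the remaining vectors do not span. -/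
def IsCocircuit (v : ι → V) (Y : Finset ι) : Prop :=
  Submodule.span ℂ (v '' {i | i ∉ Y}) ≠ ⊤

/-- The ideal generated by the products `∏_{i ∈ Y} d i`, `Y` running over the cocircuits of `v`. -/
def cocircuitIdeal (d : ι → A) (v : ι → V) : Ideal A :=
  Ideal.span {x | ∃ Y : Finset ι, IsCocircuit v Y ∧ x = ∏ i ∈ Y, d i}

/-- `A[∏ (d i)⁻¹]`. -/
abbrev Loc (d : ι → A) : Type _ := Localization.Away (∏ i, d i)

theorem isUnit_denominator (d : ι → A) (h : ι → ℕ) :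
    IsUnit (algebraMap A (Loc d) (∏ i, d i ^ h i)) := by
  have hu : IsUnit (algebraMap A (Loc d) (∏ i, d i)) :=
    IsLocalization.Away.algebraMap_isUnit _
  rw [map_prod] at hu ⊢
  rw [IsUnit.prod_univ_iff] at hu ⊢
  intro i
  rw [map_pow]
  exact (hu i).pow _

/-- The fraction `f / ∏ (d i) ^ (h i)` (the denominator is a unit). -/
def frac (d : ι → A) (f : A) (h : ι → ℕ) : Loc d :=
  algebraMap A (Loc d) f * Ring.inverse (algebraMap A (Loc d) (∏ i, d i ^ h i))

theorem frac_mul (d : ι → A) (f : A) (h : ι → ℕ) :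
    frac d f h * algebraMap A (Loc d) (∏ i, d i ^ h i) = algebraMap A (Loc d) f := by
  rw [frac, mul_assoc, Ring.inverse_mul_cancel _ (isUnit_denominator d h), mul_one]

/-- The filtration by polar order: the part of degree `≤ k` is spanned by the fractions
`f / ∏ (d i) ^ (h i)` for which the `v i` with `h i > 0` span a space of dimension `≤ k`. -/
def polarFiltration (d : ι → A) (v : ι → V) (k : ℤ) : Submodule A (Loc d) :=
  Submodule.span A {x | ∃ (f : A) (h : ι → ℕ),
    (Module.finrank ℂ (Submodule.span ℂ (v '' {i | 0 < h i})) : ℤ) ≤ k ∧ x = frac d f h}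

/-- The module of polar parts: the top quotient of the filtration by polar order. -/
abbrev PolarParts (d : ι → A) (v : ι → V) : Type _ :=
  Loc d ⧸ polarFiltration d v ((Module.finrank ℂ V : ℤ) - 1)

/-- The class of a function in the module of polar parts. -/
def polarClass (d : ι → A) (v : ι → V) (x : Loc d) : PolarParts d v :=
  Submodule.Quotient.mk x

/-- The class of `∏ (d i)⁻¹`. -/
def polarGen (d : ι → A) (v : ι → V) : PolarParts d v :=
  polarClass d v (frac d 1 fun _ => 1)

/-- The `A`-submodule generated by the class of `∏ (d i)⁻¹`. -/
abbrev polarCyclic (d : ι → A) (v : ι → V) : Submodule A (PolarParts d v) :=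
  Submodule.span A {polarGen d v}

/-- `b` indexes a basis of `V` extracted from the list `v`. -/
def IsExtractedBasis (v : ι → V) (b : Set ι) : Prop :=
  LinearIndepOn ℂ v b ∧ Submodule.span ℂ (v '' b) = ⊤

/-- Extension of a derivation of `A` to the localization `A[∏ (d i)⁻¹]`. -/
def locDerivation [Algebra ℂ A] (d : ι → A) (D : Derivation ℂ A A) :
    Derivation ℂ (Loc d) (Loc d) :=
  haveI : Algebra.FormallyEtale A (Loc d) :=
    Algebra.FormallyEtale.of_isLocalization (Submonoid.powers (∏ i, d i))
  (((Algebra.linearMap A (Loc d) ∘ₗ D.liftKaehlerDifferential).liftBaseChange (Loc d)) ∘ₗ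
    (KaehlerDifferential.tensorKaehlerEquivOfFormallyEtale ℂ A (Loc d)).symm.toLinearMap).compDer
      (KaehlerDifferential.D ℂ (Loc d))

theorem locDerivation_algebraMap [Algebra ℂ A] (d : ι → A) (D : Derivation ℂ A A) (x : A) :
    locDerivation d D (algebraMap A (Loc d) x) = algebraMap A (Loc d) (D x) := by
  have : Algebra.FormallyEtale A (Loc d) :=
    Algebra.FormallyEtale.of_isLocalization (Submonoid.powers (∏ i, d i))
  simp [locDerivation,
    KaehlerDifferential.tensorKaehlerEquivOfFormallyEtale_symm_D_algebraMap]

/-- The action of a power series `∑ c k t ^ k` on `y`, with `t` acting as `x`; the sum is finite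
when `x` acts nilpotently on `y`. -/
def seriesAct {M : Type*} [AddCommGroup M] [Module A M] [Module ℂ M]
    (c : ℕ → ℂ) (x : A) (y : M) : M :=
  ∑ᶠ k : ℕ, c k • (x ^ k • y)

/-- `exp t`. -/
def expCoeff (k : ℕ) : ℂ := ((k.factorial : ℂ))⁻¹

/-- `(1 - exp (-t)) / t`. -/
def toddInvCoeff (k : ℕ) : ℂ := (-1) ^ k * (((k + 1).factorial : ℂ))⁻¹

end General

section Lattice

variable {Λ : Type*} [AddCommGroup Λ]

variable (Λ) in
/-- The complexified vector space `V = ℂ ⊗ Λ` spanned by the lattice. -/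
abbrev Vec : Type _ := ℂ ⊗[ℤ] Λ

/-- A lattice element as a vector. -/
def toVec (a : Λ) : Vec Λ := (1 : ℂ) ⊗ₜ[ℤ] a

variable (Λ) in
/-- The symmetric algebra `S[V]`. -/
abbrev SymV : Type _ := SymmetricAlgebra ℂ (Vec Λ)

/-- A lattice element as an element of `V ⊂ S[V]`. -/
def symVec (a : Λ) : SymV Λ := SymmetricAlgebra.ι ℂ (Vec Λ) (toVec a)

variable (Λ) in
/-- The group algebra `ℂ[Λ]`. -/
abbrev GrpAlg : Type _ := AddMonoidAlgebra ℂ Λ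

/-- The basis element `e^a` of `ℂ[Λ]`. -/
def eexp (a : Λ) : GrpAlg Λ := AddMonoidAlgebra.single a 1

/-- A first-order deformation of the identity, `x ↦ x + ε D x`, gives the derivation `D`. -/
def derivationOfDual {A : Type*} [CommRing A] [Algebra ℂ A] (F : A →ₐ[ℂ] TrivSqZeroExt A A)
    (hF : ∀ x, (F x).fst = x) : Derivation ℂ A A :=
  Derivation.mk'
    ((TrivSqZeroExt.sndHom A A).restrictScalars ℂ ∘ₗ F.toLinearMap)
    (by
      intro x y
      simp [hF, mul_comm])

/-- `e^a ↦ e^a + ε ⟨u | a⟩ e^a`. -/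
def torusDual (u : Vec Λ →ₗ[ℂ] ℂ) : GrpAlg Λ →ₐ[ℂ] TrivSqZeroExt (GrpAlg Λ) (GrpAlg Λ) :=
  AddMonoidAlgebra.lift ℂ _ Λ
    { toFun := fun a => TrivSqZeroExt.inl (eexp a.toAdd) +
        TrivSqZeroExt.inr (u (toVec a.toAdd) • eexp a.toAdd)
      map_one' := by
        ext <;> simp [toVec, eexp, AddMonoidAlgebra.one_def]
      map_mul' := by
        intro a b
        ext1
        · simp [eexp, AddMonoidAlgebra.single_mul_single]
        · simp [eexp, toVec, TensorProduct.tmul_add, AddMonoidAlgebra.single_mul_single, mul_comm,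
            add_comm] }

theorem torusDual_eexp (u : Vec Λ →ₗ[ℂ] ℂ) (a : Λ) :
    torusDual u (eexp a) =
      TrivSqZeroExt.inl (eexp a) + TrivSqZeroExt.inr (u (toVec a) • eexp a) := by
  simp [torusDual, eexp]

theorem torusDual_fst (u : Vec Λ →ₗ[ℂ] ℂ) (x : GrpAlg Λ) : (torusDual u x).fst = x := by
  have h : (TrivSqZeroExt.fstHom ℂ (GrpAlg Λ) (GrpAlg Λ)).comp (torusDual u) =
      AlgHom.id ℂ (GrpAlg Λ) := by
    apply (AddMonoidAlgebra.lift ℂ _ Λ).symm.injective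
    apply MonoidHom.ext
    intro a
    have := torusDual_eexp u a.toAdd
    simp only [eexp] at this
    simp [this]
  exact DFunLike.congr_fun h x

/-- For `u` in the dual `U` of `V`, the derivation of `ℂ[Λ]` with `e^a ↦ ⟨u | a⟩ e^a`. -/
def torusDerivation (u : Vec Λ →ₗ[ℂ] ℂ) : Derivation ℂ (GrpAlg Λ) (GrpAlg Λ) :=
  derivationOfDual (torusDual u) (torusDual_fst u)

theorem torusDerivation_eexp (u : Vec Λ →ₗ[ℂ] ℂ) (a : Λ) :
    torusDerivation u (eexp a) = u (toVec a) • eexp a := by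
  simp [torusDerivation, derivationOfDual, torusDual_eexp]

/-- `v ↦ v + ε ⟨u | v⟩` for `v ∈ V`. -/
def symDual (u : Vec Λ →ₗ[ℂ] ℂ) : SymV Λ →ₐ[ℂ] TrivSqZeroExt (SymV Λ) (SymV Λ) :=
  SymmetricAlgebra.lift
    ((TrivSqZeroExt.inlAlgHom ℂ (SymV Λ) (SymV Λ)).toLinearMap ∘ₗ SymmetricAlgebra.ι ℂ (Vec Λ) +
      (TrivSqZeroExt.inrHom (SymV Λ) (SymV Λ)).restrictScalars ℂ ∘ₗ
        Algebra.linearMap ℂ (SymV Λ) ∘ₗ u)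

theorem symDual_fst (u : Vec Λ →ₗ[ℂ] ℂ) (x : SymV Λ) : (symDual u x).fst = x := by
  have h : (TrivSqZeroExt.fstHom ℂ (SymV Λ) (SymV Λ)).comp (symDual u) = AlgHom.id ℂ (SymV Λ) := by
    apply SymmetricAlgebra.algHom_ext
    apply LinearMap.ext
    intro v
    simp [symDual]
  exact DFunLike.congr_fun h x

/-- For `u` in the dual `U` of `V`, the derivation of `S[V]` with `v ↦ ⟨u | v⟩` for `v ∈ V`. -/
def symDerivation (u : Vec Λ →ₗ[ℂ] ℂ) : Derivation ℂ (SymV Λ) (SymV Λ) :=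
  derivationOfDual (symDual u) (symDual_fst u)

theorem symDerivation_ι (u : Vec Λ →ₗ[ℂ] ℂ) (v : Vec Λ) :
    symDerivation u (SymmetricAlgebra.ι ℂ (Vec Λ) v) = algebraMap ℂ (SymV Λ) (u v) := by
  simp [symDerivation, derivationOfDual, symDual, Algebra.algebraMap_eq_smul_one]

/-! ### The toric and the linear objects attached to a list in the lattice -/

variable {ι : Type*} [Fintype ι]

/-- The list `X` as a list of vectors of `V`. -/
def vecs (X : ι → Λ) (i : ι) : Vec Λ := toVec (X i)

/-- The toric equations `1 - e^{-a}`, `a ∈ X`. -/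
def torEq (X : ι → Λ) (i : ι) : GrpAlg Λ := 1 - eexp (-X i)

/-- The linear equations `a ∈ V ⊂ S[V]`, `a ∈ X`. -/
def linEq (X : ι → Λ) (i : ι) : SymV Λ := symVec (X i)

/-- The ideal `J_X ⊂ ℂ[Λ]`. -/
abbrev JIdeal (X : ι → Λ) : Ideal (GrpAlg Λ) := cocircuitIdeal (torEq X) (vecs X)

/-- The ideal `I_X ⊂ S[V]`. -/
abbrev IIdeal (X : ι → Λ) : Ideal (SymV Λ) := cocircuitIdeal (linEq X) (vecs X)

/-- The algebra `A_X = S[V] / I_X`. -/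
abbrev AAlg (X : ι → Λ) : Type _ := SymV Λ ⧸ IIdeal X

/-- The toric polar parts `Π_X = S_X / S_{X,s-1}`. -/
abbrev TorPolar (X : ι → Λ) : Type _ := PolarParts (torEq X) (vecs X)

/-- The class `v_X` of `∏ (1 - e^{-a})⁻¹`. -/
abbrev vGen (X : ι → Λ) : TorPolar X := polarGen (torEq X) (vecs X)

/-- The `ℂ[Λ]`-submodule of `Π_X` generated by `v_X`. -/
abbrev TorQ (X : ι → Λ) : Submodule (GrpAlg Λ) (TorPolar X) := polarCyclic (torEq X) (vecs X)

/-- The linear polar parts `P_X = R_X / R_{X,s-1}`. -/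
abbrev LinPolar (X : ι → Λ) : Type _ := PolarParts (linEq X) (vecs X)

/-- The class `u_X` of `∏ a⁻¹`. -/
abbrev uGen (X : ι → Λ) : LinPolar X := polarGen (linEq X) (vecs X)

/-- The `S[V]`-submodule `Q_X` of `P_X` generated by `u_X`. -/
abbrev LinQ (X : ι → Λ) : Submodule (SymV Λ) (LinPolar X) := polarCyclic (linEq X) (vecs X)

/-- The points of the toric arrangement: the characters of `Λ` which are trivial on some basis
extracted from `X`. -/
def arrPoints (X : ι → Λ) : Set (AddChar Λ ℂ) :=
  {φ | ∃ b : Set ι, IsExtractedBasis (vecs X) b ∧ ∀ i ∈ b, φ (X i) = 1}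

/-- The indices of the sublist `X_φ`. -/
abbrev LocIdx (X : ι → Λ) (φ : AddChar Λ ℂ) : Type _ := {i : ι // φ (X i) = 1}

instance instFintypeLocIdx (X : ι → Λ) (φ : AddChar Λ ℂ) : Fintype (LocIdx X φ) :=
  Fintype.ofFinite _

/-- The sublist `X_φ` of the `a ∈ X` on which the character `φ` is trivial. -/
def locList (X : ι → Λ) (φ : AddChar Λ ℂ) (i : LocIdx X φ) : Λ := X i.1

/-- `R` is a set of representatives of `Λ / Λ_b`, `Λ_b` the lattice generated by the `X i`,
`i ∈ b`. -/
def IsRepresentatives (X : ι → Λ) (b : Set ι) (R : Finset Λ) : Prop :=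
  Function.Bijective
    (fun r : R => (QuotientAddGroup.mk r.1 : Λ ⧸ AddSubgroup.closure (X '' b)))

/-- `e(φ) = |Λ / Λ_b|⁻¹ ∑_{λ ∈ R} φ(-λ) e^λ`. -/
def charIdem (φ : AddChar Λ ℂ) (R : Finset Λ) : GrpAlg Λ :=
  ((R.card : ℂ))⁻¹ • ∑ l ∈ R, φ (-l) • eexp l

/-- The class `ω_{b,φ}` of `e(φ) / ∏_{i ∈ b} (1 - e^{-X i})` in `Π_X`. -/
def omegaClass (X : ι → Λ) (b : Set ι) (φ : AddChar Λ ℂ) (R : Finset Λ) : TorPolar X :=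
  polarClass (torEq X) (vecs X) (frac (torEq X) (charIdem φ R) (b.indicator 1))

/-- The class `u_b` of `1 / ∏_{i ∈ b} X i` in `P_{X_φ}`, for `b` contained in `X_φ`. -/
def uClass (X : ι → Λ) (b : Set ι) (φ : AddChar Λ ℂ) : LinPolar (locList X φ) :=
  polarClass (linEq (locList X φ)) (vecs (locList X φ))
    (frac (linEq (locList X φ)) 1 (fun i => b.indicator 1 i.1))

/-- The canonical identification of `Π_X` with the sum of the local modules `P_{X_φ}`, each centred
at the origin by the translation by `φ`: `e^a` acts on `P_{X_φ}` as `φ(a) exp(a)`, the derivatives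
`D_u`, `u ∈ U`, correspond to each other, and `ω_{b,φ}` corresponds to `u_b` at `φ` (and to `0`
at the other points) for each basis `b` extracted from `X_φ`. -/
structure IsLocalIdentification (X : ι → Λ)
    (j : TorPolar X ≃ₗ[ℂ] (∀ φ : arrPoints X, LinPolar (locList X φ))) : Prop where
  nilpotent : ∀ (a : Λ) (φ : arrPoints X) (y : LinPolar (locList X φ)),
    ∃ n : ℕ, symVec a ^ n • y = 0
  map_eexp : ∀ (a : Λ) (x : TorPolar X) (φ : arrPoints X),
    j (eexp a • x) φ = φ.1 a • seriesAct expCoeff (symVec a) (j x φ)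
  map_deriv : ∀ (u : Vec Λ →ₗ[ℂ] ℂ) (φ : arrPoints X) (x : Loc (torEq X))
    (y : Loc (linEq (locList X φ))),
    j (polarClass _ _ x) φ = polarClass _ _ y →
      j (polarClass _ _ (locDerivation (torEq X) (torusDerivation u) x)) φ =
        polarClass _ _ (locDerivation (linEq (locList X φ)) (symDerivation u) y)
  map_omega : ∀ (φ : arrPoints X) (b : Set ι) (R : Finset Λ),
    IsExtractedBasis (vecs X) b → (∀ i ∈ b, φ.1 (X i) = 1) → IsRepresentatives X b R →
      j (omegaClass X b φ.1 R) φ = uClass X b φ.1 ∧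
      ∀ ψ : arrPoints X, ψ ≠ φ → j (omegaClass X b φ.1 R) ψ = 0

/-- `φ(a) exp(a)` in `A_{X_φ}`: the image of `e^a` under the logarithm isomorphism at `φ`. -/
def locExp (X : ι → Λ) (φ : AddChar Λ ℂ) (a : Λ) : AAlg (locList X φ) :=
  φ a • seriesAct expCoeff (symVec a) (1 : AAlg (locList X φ))

open scoped Classical in
/-- `∏_{a ∉ X_φ} (1 - φ(-a) exp(-a)) · ∏_{a ∈ X_φ} (1 - exp(-a)) / a` in `A_{X_φ}`. -/
def toddInv (X : ι → Λ) (φ : AddChar Λ ℂ) : AAlg (locList X φ) :=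
  ∏ i : ι, if φ (X i) = 1
    then seriesAct toddInvCoeff (symVec (X i)) (1 : AAlg (locList X φ))
    else 1 - locExp X φ (-X i)

end Lattice

end ToricPolar

end

open ToricPolar

open scoped TensorProduct

noncomputable section

namespace ToricPolar

/-! ### Symmetric algebras of quotients -/

section SymQuot

variable {V W : Type*} [AddCommGroup V] [Module ℂ V] [AddCommGroup W] [Module ℂ W]

/-! The theorem rests on a linear fact and a local-to-global fact. Both are needed for the cocircuit
ideals of every order `n`, in which the equations are replaced by their `n`-th powers, because a
polar part is the class of some `f / ∏ dⁿ` with `n` arbitrary.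

Linear fact: the annihilator of the class of `∏ a⁻ⁿ` in `LinPolar Z` is exactly `linIdeal Z n`. A
product over a cocircuit visibly lowers the polar order. Conversely, if `g` kills the class,
clearing denominators gives `(∏ a)ᵐ g ∈ linIdeal Z (n + m)`, and the extra equations must be
cancelled one at a time (`mem_relIdeal_of_mul_mem`), powers being treated as repeated vectors. To
cancel, the list is lifted to `V × ℂ` with generic last coordinates; with `t = (0, 1)` as
homogenizing variable this moves the hyperplanes into general position. The lifted ideal is the
ideal of a finite union of lines, one for each extracted basis, and an equation vanishes only on the
lines of the bases containing it (`mem_relIdeal_of_forall_basis`, `exists_generic_lift`). Vanishing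
arguments on these lines, followed by `t ↦ 0`, give the cancellation without any dimension count.

Local-to-global fact: `ℂ[Λ] / torIdeal X n` is the product over `φ ∈ P(X)` of the algebras `S[V] /
linIdeal X_φ n`. Modulo a prime over `torIdeal X n`, a spanning set of the `e^a` becomes `1`, so
every `e^a` is a root of unity and the prime is a point of `P(X)` (`exists_eq_ker_evChar`). Locally
at `φ` the elements `φ(a)⁻¹ e^a` are unipotent and have logarithms, and `1 - e^{-a}` is a unit times
`a` if `φ(a) = 1`, and a unit otherwise; so the two cocircuit ideals correspond
(`exists_comp_topHom_eq`, `mem_torIdeal_of_topHom_eq_zero`). The Chinese remainder theorem gives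
surjectivity (`exists_topHom_eq`).

The same factorization defines `j`: the class of `f / ∏ (1 - e^{-a})ⁿ` goes at `φ` to `Tdⁿ · f · ∏
a⁻ⁿ`, where `Td` inverts the product of the units and `f` acts through `e^a ↦ φ(a) exp(a)`
(`locMap`). The two facts make it bijective. On `f v_X` it is the case `n = 1`, which is the
commutativity of the square and also yields the annihilator of `v_X`. Derivations are matched by the
quotient rule. The class of a basis is killed by `V`, so functions act on it by their value at the
point, and orthogonality of characters isolates the right component. -/

/-- The functoriality of the symmetric algebra. -/
def symMap (p : V →ₗ[ℂ] W) : SymmetricAlgebra ℂ V →ₐ[ℂ] SymmetricAlgebra ℂ W :=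
  SymmetricAlgebra.lift (SymmetricAlgebra.ι ℂ W ∘ₗ p)

@[simp]
theorem symMap_ι (p : V →ₗ[ℂ] W) (v : V) :
    symMap p (SymmetricAlgebra.ι ℂ V v) = SymmetricAlgebra.ι ℂ W (p v) := by
  simp [symMap]

theorem symMap_comp_apply {V' : Type*} [AddCommGroup V'] [Module ℂ V'] (p : V →ₗ[ℂ] W)
    (q : W →ₗ[ℂ] V') (x : SymmetricAlgebra ℂ V) : symMap q (symMap p x) = symMap (q ∘ₗ p) x := by
  have h : (symMap q).comp (symMap p) = symMap (q ∘ₗ p) := by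
    apply SymmetricAlgebra.algHom_ext
    ext v
    simp
  exact DFunLike.congr_fun h x

theorem symMap_id_apply (x : SymmetricAlgebra ℂ V) : symMap LinearMap.id x = x := by
  have h : symMap LinearMap.id = AlgHom.id ℂ (SymmetricAlgebra ℂ V) := by
    apply SymmetricAlgebra.algHom_ext
    ext v
    simp
  exact DFunLike.congr_fun h x

theorem symMap_surjective {p : V →ₗ[ℂ] W} (hp : Function.Surjective p) :
    Function.Surjective (symMap p) := by
  obtain ⟨s, hs⟩ := p.exists_rightInverse_of_surjective (LinearMap.range_eq_top.2 hp)
  intro y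
  exact ⟨symMap s y, by rw [symMap_comp_apply, hs, symMap_id_apply]⟩

theorem ι_eq_zero_iff (v : V) : SymmetricAlgebra.ι ℂ V v = 0 ↔ v = 0 := by
  refine ⟨fun h => ?_, fun h => by simp [h]⟩
  refine (Module.forall_dual_apply_eq_zero_iff ℂ v).1 fun f => ?_
  have := congrArg (SymmetricAlgebra.lift f) h
  rwa [SymmetricAlgebra.lift_ι_apply, map_zero] at this

/-- A linear section `s` of `p` moves each `v` by an element of `ker p`. Hence the endomorphism
induced by `s ∘ p` is the identity modulo the ideal of `ker p`, while it sends `x` to `0`. -/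
theorem mem_span_of_symMap_eq_zero {p : V →ₗ[ℂ] W} (hp : Function.Surjective p)
    {x : SymmetricAlgebra ℂ V} (hx : symMap p x = 0) :
    x ∈ Ideal.span (SymmetricAlgebra.ι ℂ V '' (LinearMap.ker p : Set V)) := by
  obtain ⟨s, hs⟩ := p.exists_rightInverse_of_surjective (LinearMap.range_eq_top.2 hp)
  set K := Ideal.span (SymmetricAlgebra.ι ℂ V '' (LinearMap.ker p : Set V)) with hK
  have h : (Ideal.Quotient.mkₐ ℂ K).comp (symMap (s ∘ₗ p)) = Ideal.Quotient.mkₐ ℂ K := by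
    apply SymmetricAlgebra.algHom_ext
    ext v
    change Ideal.Quotient.mk K (symMap (s ∘ₗ p) (SymmetricAlgebra.ι ℂ V v)) =
      Ideal.Quotient.mk K (SymmetricAlgebra.ι ℂ V v)
    rw [symMap_ι]
    rw [Ideal.Quotient.eq, ← map_sub]
    refine Ideal.subset_span ⟨_, ?_, rfl⟩
    have := LinearMap.congr_fun hs (p v)
    simp only [LinearMap.coe_comp, Function.comp_apply, LinearMap.id_coe, id_eq] at this
    simp [this]
  have h2 := DFunLike.congr_fun h x
  rw [AlgHom.comp_apply, ← symMap_comp_apply, hx, map_zero, map_zero,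
    Ideal.Quotient.mkₐ_eq_mk] at h2
  exact Ideal.Quotient.eq_zero_iff_mem.1 h2.symm

/-- The prime ideal of the subspace of the dual on which `W` vanishes. -/
def symVanishing (W : Submodule ℂ V) : Ideal (SymmetricAlgebra ℂ V) :=
  RingHom.ker (symMap W.mkQ)

instance symVanishing_isPrime (W : Submodule ℂ V) : (symVanishing W).IsPrime :=
  RingHom.ker_isPrime _

theorem ι_mem_symVanishing {W : Submodule ℂ V} {v : V} :
    SymmetricAlgebra.ι ℂ V v ∈ symVanishing W ↔ v ∈ W := by
  rw [symVanishing, RingHom.mem_ker]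
  simp [ι_eq_zero_iff]

theorem symVanishing_span_le (s : Set V) :
    symVanishing (Submodule.span ℂ s) ≤ Ideal.span (SymmetricAlgebra.ι ℂ V '' s) := by
  intro x hx
  have := mem_span_of_symMap_eq_zero (Submodule.mkQ_surjective _) hx
  refine Ideal.span_le.2 ?_ this
  rintro _ ⟨v, hv, rfl⟩
  rw [Submodule.ker_mkQ] at hv
  have h : Submodule.span ℂ s ≤ ((Ideal.span (SymmetricAlgebra.ι ℂ V '' s)).restrictScalars ℂ).comap
      (SymmetricAlgebra.ι ℂ V) :=
    Submodule.span_le.2 fun w hw => Ideal.subset_span ⟨w, hw, rfl⟩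
  exact h hv

end SymQuot

/-! ### The annihilator of the class of `∏ a⁻¹` -/

section Generic

variable {V : Type*} [AddCommGroup V] [Module ℂ V] {κ : Type*}

/-- Adding `(0, 1)` to the lifted vectors absorbs their last coordinates, so the lifted list has the
same cocircuits as the original one, whatever the heights `c`. -/
theorem span_insert_lift_eq_top_iff (a : κ → V) (c : κ → ℂ) (E : Set κ) :
    Submodule.span ℂ (insert ((0, 1) : V × ℂ) ((fun i => (a i, c i)) '' E)) = ⊤ ↔
      Submodule.span ℂ (a '' E) = ⊤ := by
  set W := Submodule.span ℂ (insert ((0, 1) : V × ℂ) ((fun i => (a i, c i)) '' E)) with hW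
  have hmap : W.map (LinearMap.fst ℂ V ℂ) = Submodule.span ℂ (a '' E) := by
    rw [hW, Submodule.map_span, Set.image_insert_eq, Set.image_image]
    simp
  constructor
  · intro h
    rw [← hmap, h, Submodule.map_top, LinearMap.range_eq_top]
    exact Prod.fst_surjective
  · intro h
    rw [h] at hmap
    rw [eq_top_iff]
    rintro ⟨v, r⟩ -
    obtain ⟨⟨w, q⟩, hw, hwv⟩ : v ∈ W.map (LinearMap.fst ℂ V ℂ) := by simp [hmap]
    obtain rfl : w = v := hwv
    have ht : ((0, 1) : V × ℂ) ∈ W := Submodule.subset_span (Set.mem_insert _ _)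
    have := W.add_mem hw (W.smul_mem (r - q) ht)
    simpa using this

/-! ### Deletion and contraction for cocircuit ideals, and generic lifts. -/

variable [DecidableEq κ]

/-- The ideal generated by the products of the equations in `Y ⊆ D` for which the remaining vectors
of `D`, together with `w`, do not span. -/
def relIdeal (w : Set V) (z : κ → V) (D : Finset κ) : Ideal (SymmetricAlgebra ℂ V) :=
  Ideal.span {x | ∃ Y ⊆ D, Submodule.span ℂ (w ∪ z '' (D \ Y : Finset κ)) ≠ ⊤ ∧
    x = ∏ i ∈ Y, SymmetricAlgebra.ι ℂ V (z i)}

/-- Deletion: putting `j` in both `Y` and `D` leaves the complement `D \ Y` unchanged. -/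
theorem mul_relIdeal_le {w : Set V} {z : κ → V} {D : Finset κ} {j : κ} (hj : j ∉ D)
    {x : SymmetricAlgebra ℂ V} (hx : x ∈ relIdeal w z D) :
    SymmetricAlgebra.ι ℂ V (z j) * x ∈ relIdeal w z (insert j D) := by
  refine Submodule.span_induction ?_ ?_ ?_ ?_ hx
  · rintro _ ⟨Y, hY, hs, rfl⟩
    refine Ideal.subset_span ⟨insert j Y, Finset.insert_subset_insert _ hY, ?_, ?_⟩
    · rwa [Finset.insert_sdiff_insert, Finset.sdiff_insert_of_notMem hj]
    · rw [Finset.prod_insert (fun h => hj (hY h))]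
  · simp
  · intro x y _ _ hx hy
    rw [mul_add]
    exact add_mem hx hy
  · intro a x _ hx
    rw [smul_eq_mul, mul_left_comm]
    exact Ideal.mul_mem_left _ _ hx

/-- Contraction: for `Y` avoiding `j`, the vector `z j` is among the remaining ones, so it may be
counted in `w` or in the complement of `Y`. -/
theorem relIdeal_insert_le {w : Set V} {z : κ → V} {D : Finset κ} {j : κ} (hj : j ∉ D) :
    relIdeal (insert (z j) w) z D ≤ relIdeal w z (insert j D) := by
  refine Ideal.span_le.2 ?_
  rintro _ ⟨Y, hY, hs, rfl⟩
  refine Ideal.subset_span ⟨Y, hY.trans (Finset.subset_insert _ _), ?_, rfl⟩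
  rw [Finset.insert_sdiff_of_notMem _ (fun h => hj (hY h)), Finset.coe_insert, Set.image_insert_eq,
    Set.union_insert, ← Set.insert_union]
  exact hs

/-- `b` completes `t` to a basis. -/
def IsBasisAt (t : V) (z : κ → V) (b : Finset κ) : Prop :=
  LinearIndepOn ℂ z b ∧ t ∉ Submodule.span ℂ (z '' b) ∧
    Submodule.span ℂ (insert t (z '' b)) = ⊤

/-- Every `Y` in a generator meets `b`, since otherwise the remaining vectors would contain a basis.
This is the easy half of the description by lines. -/
theorem sup_relIdeal_le_symVanishing {t : V} {z : κ → V} {b C D : Finset κ}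
    (hb : IsBasisAt t z b) (hCb : C ⊆ b) (hbD : b ⊆ C ∪ D) :
    Ideal.span (SymmetricAlgebra.ι ℂ V '' (z '' C)) ⊔ relIdeal (insert t (z '' C)) z D ≤
      symVanishing (Submodule.span ℂ (z '' b)) := by
  refine sup_le (Ideal.span_le.2 ?_) (Ideal.span_le.2 ?_)
  · rintro _ ⟨_, ⟨i, hi, rfl⟩, rfl⟩
    exact ι_mem_symVanishing.2 (Submodule.subset_span ⟨i, hCb hi, rfl⟩)
  · rintro _ ⟨Y, hY, hs, rfl⟩
    obtain ⟨i, hiY, hib⟩ : ∃ i ∈ Y, i ∈ b := by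
      by_contra! h
      refine hs (top_le_iff.1 (hb.2.2.symm.le.trans (Submodule.span_mono ?_)))
      rw [Set.insert_union, ← Set.image_union]
      refine Set.insert_subset_insert (Set.image_mono fun i hi => ?_)
      rcases Finset.mem_union.1 (hbD hi) with h' | h'
      · exact Or.inl h'
      · exact Or.inr (by simpa [h'] using fun h'' => h i h'' hi)
    exact Ideal.mem_of_dvd _ (Finset.dvd_prod_of_mem _ hiY)
      (ι_mem_symVanishing.2 (Submodule.subset_span ⟨i, hib, rfl⟩))

/-- In general position the ideal is the intersection of the primes of the lines attached to the
bases. The set `C` records the contracted vectors: only bases between `C` and `C ∪ D` are tested.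
The induction on `D` contracts or deletes one index `j`. -/
theorem mem_relIdeal_of_forall_basis {t : V} {z : κ → V}
    (hgen : ∀ b : Finset κ, IsBasisAt t z b → ∀ i ∉ b, z i ∉ Submodule.span ℂ (z '' b))
    (D : Finset κ) : ∀ (C : Finset κ), Disjoint C D → LinearIndepOn ℂ z C →
    t ∉ Submodule.span ℂ (z '' C) → ∀ F : SymmetricAlgebra ℂ V,
    (∀ b : Finset κ, C ⊆ b → b ⊆ C ∪ D → IsBasisAt t z b →
      F ∈ symVanishing (Submodule.span ℂ (z '' b))) →
    F ∈ Ideal.span (SymmetricAlgebra.ι ℂ V '' (z '' C)) ⊔ relIdeal (insert t (z '' C)) z D := by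
  induction D using Finset.induction_on with
  | empty =>
    intro C _ hC htC F hF
    by_cases hs : Submodule.span ℂ (insert t (z '' C)) = ⊤
    · exact Ideal.mem_sup_left (symVanishing_span_le _ (hF C subset_rfl (by simp) ⟨hC, htC, hs⟩))
    · refine Ideal.mem_sup_right ?_
      have : (1 : SymmetricAlgebra ℂ V) ∈ relIdeal (insert t (z '' C)) z ∅ :=
        Ideal.subset_span ⟨∅, by simp, by simpa using hs, by simp⟩
      rw [(Ideal.eq_top_iff_one _).2 this]
      trivial
  | insert j D hj ih =>
    intro C hCD hC htC F hF
    rw [Finset.disjoint_insert_right] at hCD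
    -- If `z j` depends on `t` and the contracted vectors, it does not affect any span and deletion
    -- alone suffices.
    by_cases hjC : z j ∈ Submodule.span ℂ (insert t (z '' C))
    · have h1 := ih C hCD.2 hC htC F fun b hCb hb hB =>
        hF b hCb (hb.trans (Finset.union_subset_union_right (Finset.subset_insert _ _))) hB
      have hle : relIdeal (insert t (z '' C)) z D ≤
          relIdeal (insert t (z '' C)) z (insert j D) := ?_
      · exact sup_le_sup_left hle _ h1
      refine Ideal.span_le.2 ?_
      rintro _ ⟨Y, hY, hs, rfl⟩
      refine Ideal.subset_span ⟨Y, hY.trans (Finset.subset_insert _ _), ?_, rfl⟩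
      rw [Finset.insert_sdiff_of_notMem _ (fun h => hj (hY h)), Finset.coe_insert,
        Set.image_insert_eq, Set.union_insert, Submodule.span_insert_eq_span]
      · exact hs
      · exact Submodule.span_mono Set.subset_union_left hjC
    · have hjC' : z j ∉ Submodule.span ℂ (z '' C) := fun h =>
        hjC (Submodule.span_mono (Set.subset_insert _ _) h)
      have hC' : LinearIndepOn ℂ z (insert j C : Finset κ) := by
        rw [Finset.coe_insert]
        exact hC.insert hjC'
      have htC' : t ∉ Submodule.span ℂ (z '' (insert j C : Finset κ)) := by
        rw [Finset.coe_insert, Set.image_insert_eq]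
        intro h
        exact hjC (mem_span_insert_exchange h htC)
      have hCb' : ∀ E : Finset κ, insert j C ∪ E = C ∪ insert j E := by
        intro E
        rw [Finset.insert_union, Finset.union_insert]
      -- Contraction of `j` gives `F = f * z j + G` with `G` already in the required ideal.
      have h1 := ih (insert j C) (Finset.disjoint_insert_left.2 ⟨hj, hCD.2⟩) hC' htC' F
        (fun b hb hb' hB => hF b ((Finset.subset_insert _ _).trans hb) (by rwa [← hCb']) hB)
      have h1' : F ∈ Ideal.span {SymmetricAlgebra.ι ℂ V (z j)} ⊔
          (Ideal.span (SymmetricAlgebra.ι ℂ V '' (z '' C)) ⊔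
            relIdeal (insert t (z '' C)) z (insert j D)) := by
        rw [Finset.coe_insert, Set.image_insert_eq, Set.image_insert_eq, Ideal.span_insert,
          sup_assoc, Set.insert_comm] at h1
        exact sup_le_sup_left (sup_le_sup_left (relIdeal_insert_le hj) (Ideal.span _))
          (Ideal.span _) h1
      obtain ⟨y, hy, G, hG, hyG⟩ := Submodule.mem_sup.1 h1'
      obtain ⟨f, rfl⟩ := Ideal.mem_span_singleton'.1 hy
      -- On the lines whose basis omits `j`, genericity says that `z j` does not vanish. So `f`
      -- vanishes there, and deletion applies to `f`.
      have hf : ∀ b : Finset κ, C ⊆ b → b ⊆ C ∪ D → IsBasisAt t z b →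
          f ∈ symVanishing (Submodule.span ℂ (z '' b)) := by
        intro b hCb hbD hB
        have hbD' := hbD.trans (Finset.union_subset_union_right (Finset.subset_insert j D))
        have hG' := sup_relIdeal_le_symVanishing hB hCb hbD' hG
        have hF' := hF b hCb hbD' hB
        rw [← hyG, add_comm] at hF'
        have := (Ideal.add_mem_iff_right _ hG').1 hF'
        refine (Ideal.IsPrime.mem_or_mem inferInstance this).resolve_right fun h => ?_
        refine hgen b hB j (fun hjb => ?_) (ι_mem_symVanishing.1 h)
        rcases Finset.mem_union.1 (hbD hjb) with h' | h'
        · exact hCD.1 h'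
        · exact hj h'
      obtain ⟨y', hy', g, hg, rfl⟩ := Submodule.mem_sup.1 (ih C hCD.2 hC htC f hf)
      rw [← hyG, add_mul]
      refine add_mem (add_mem (Ideal.mem_sup_left (Ideal.mul_mem_right _ _ hy'))
        (Ideal.mem_sup_right ?_)) hG
      rw [mul_comm]
      exact mul_relIdeal_le hj hg

/-- For a fixed basis `b` and `i ∉ b`, the heights that put the lift of `i` in the span of the lifts
of `b` lie in a proper subspace of `κ → ℂ`. Finitely many proper subspaces do not cover it. -/
theorem exists_generic_lift [Finite κ] (a : κ → V) : ∃ c : κ → ℂ,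
    ∀ b : Finset κ, IsBasisAt ((0, 1) : V × ℂ) (fun i => (a i, c i)) b →
      ∀ i ∉ b, ((a i, c i) : V × ℂ) ∉ Submodule.span ℂ ((fun i => (a i, c i)) '' b) := by
  -- Intersecting over all `l` makes this a subspace for every pair, basis or not. It is everything
  -- when `a p.2` is no combination of the `a k`, `k ∈ p.1`; such pairs are filtered out below.
  let bad : Finset κ × κ → Submodule ℂ (κ → ℂ) := fun p =>
    ⨅ (l : κ → ℂ) (_ : ∑ k ∈ p.1, l k • a k = a p.2),
      LinearMap.ker (LinearMap.proj p.2 - ∑ k ∈ p.1, l k • LinearMap.proj (R := ℂ)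
        (φ := fun _ : κ => ℂ) k)
  have hbad : ∀ p c, c ∈ bad p ↔
      ∀ l : κ → ℂ, ∑ k ∈ p.1, l k • a k = a p.2 → c p.2 = ∑ k ∈ p.1, l k * c k := by
    intro p c
    simp [bad, Submodule.mem_iInf, sub_eq_zero]
  have hfin : (Set.range bad).Finite := Set.finite_range bad
  have hne := Subspace.biUnion_ne_univ_of_top_notMem (k := ℂ) (E := κ → ℂ)
    (s := hfin.toFinset.filter (· ≠ ⊤)) (by simp)
  obtain ⟨c, hc⟩ := (Set.ne_univ_iff_exists_notMem _).1 hne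
  refine ⟨c, fun b hb i hib hmem => ?_⟩
  obtain ⟨l, hl⟩ := Submodule.mem_span_image_finset_iff_exists_fun' ℂ |>.1 hmem
  have h1 : ∑ k ∈ b, l k • a k = a i := by
    simpa [Prod.fst_sum] using congrArg Prod.fst hl
  have h2 : ∑ k ∈ b, l k * c k = c i := by
    simpa [Prod.snd_sum] using congrArg Prod.snd hl
  -- A relation among the `a k` lifts to a multiple of `(0, 1)`, which must be zero because `(0, 1)`
  -- is not in the span of the lifted vectors.
  have hind : ∀ m : κ → ℂ, ∑ k ∈ b, m k • a k = 0 → ∀ k ∈ b, m k = 0 := by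
    intro m hm
    have h3 : ∑ k ∈ b, m k • ((a k, c k) : V × ℂ) = (∑ k ∈ b, m k * c k) • ((0, 1) : V × ℂ) := by
      ext
      · simp [Prod.fst_sum, hm]
      · simp [Prod.snd_sum]
    have h4 : ∑ k ∈ b, m k * c k = 0 := by
      by_contra h
      apply hb.2.1
      rw [← inv_smul_smul₀ h ((0, 1) : V × ℂ), ← h3]
      exact Submodule.smul_mem _ _ (Submodule.sum_mem _ fun k hk =>
        Submodule.smul_mem _ _ (Submodule.subset_span ⟨k, hk, rfl⟩))
    rw [h4, zero_smul] at h3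
    exact linearIndepOn_finset_iff.1 hb.1 m h3
  have hcbad : c ∈ bad (b, i) := by
    rw [hbad]
    intro m hm
    rw [← h2]
    refine Finset.sum_congr rfl fun k hk => ?_
    have := hind (l - m) (by simp [sub_smul, Finset.sum_sub_distrib, h1, hm]) k hk
    rw [sub_eq_zero.1 this]
  -- Changing the height of `i` alone breaks the relation.
  have hproper : bad (b, i) ≠ ⊤ := by
    intro htop
    have : Pi.single i 1 ∈ bad (b, i) := by simp [htop]
    rw [hbad] at this
    have h5 := this l h1
    rw [Finset.sum_eq_zero] at h5
    · simp at h5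
    · intro k hk
      rw [Pi.single_eq_of_ne (ne_of_mem_of_not_mem hk hib), mul_zero]
  exact hc (Set.mem_biUnion (x := bad (b, i)) (by simpa using hproper) hcbad)

theorem map_relIdeal (a : κ → V) (c : κ → ℂ) (D : Finset κ) :
    (relIdeal {((0, 1) : V × ℂ)} (fun i => (a i, c i)) D).map (symMap (LinearMap.fst ℂ V ℂ)) =
      relIdeal ∅ a D := by
  rw [relIdeal, Ideal.map_span]
  congr 1
  ext x
  simp only [Set.mem_image, Set.mem_ofPred_eq, Set.singleton_union, Set.empty_union]
  constructor
  · rintro ⟨_, ⟨Y, hY, hs, rfl⟩, rfl⟩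
    refine ⟨Y, hY, ?_, by simp [map_prod]⟩
    rwa [Ne, span_insert_lift_eq_top_iff] at hs
  · rintro ⟨Y, hY, hs, rfl⟩
    refine ⟨_, ⟨Y, hY, ?_, rfl⟩, by simp [map_prod]⟩
    rwa [Ne, span_insert_lift_eq_top_iff]

/-- Cancellation of one equation in the cocircuit ideals. -/
theorem mem_relIdeal_of_mul_mem [Finite κ] {a : κ → V} {T : Finset κ} {j : κ} (hj : j ∉ T)
    (haj : a j ≠ 0) {f : SymmetricAlgebra ℂ V}
    (hf : SymmetricAlgebra.ι ℂ V (a j) * f ∈ relIdeal ∅ a (insert j T)) :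
    f ∈ relIdeal ∅ a T := by
  obtain ⟨c, hc⟩ := exists_generic_lift a
  set t : V × ℂ := (0, 1) with ht
  set z : κ → V × ℂ := fun i => (a i, c i) with hz
  set π := symMap (LinearMap.fst ℂ V ℂ) with hπ
  have hπs : Function.Surjective π := symMap_surjective Prod.fst_surjective
  have htne : t ≠ 0 := by simp [ht]
  rw [← map_relIdeal a c] at hf
  -- Lift the hypothesis: `F` lies in the generic ideal and differs from `z j * f'` by a multiple `g
  -- * t`.
  obtain ⟨F, hF, hFf⟩ := (Ideal.mem_map_iff_of_surjective π hπs).1 hf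
  obtain ⟨f', rfl⟩ := hπs f
  have hker : F - SymmetricAlgebra.ι ℂ _ (z j) * f' ∈ Ideal.span {SymmetricAlgebra.ι ℂ _ t} := by
    have h0 : π (F - SymmetricAlgebra.ι ℂ _ (z j) * f') = 0 := by
      rw [map_sub, hFf, map_mul, hπ, symMap_ι]
      simp [hz]
    refine Ideal.span_le.2 ?_ (mem_span_of_symMap_eq_zero Prod.fst_surjective h0)
    rintro _ ⟨⟨v, r⟩, hv, rfl⟩
    obtain rfl : v = 0 := hv
    have : ((0, r) : V × ℂ) = r • t := by simp [ht]
    rw [this, map_smul]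
    exact Submodule.smul_of_tower_mem _ _ (Ideal.subset_span rfl)
  obtain ⟨g, hg⟩ := Ideal.mem_span_singleton'.1 hker
  have hFb : ∀ b : Finset κ, b ⊆ insert j T → IsBasisAt t z b →
      F ∈ symVanishing (Submodule.span ℂ (z '' b)) := by
    intro b hb hB
    refine sup_relIdeal_le_symVanishing (C := ∅) hB (by simp) (by simpa using hb)
      (Ideal.mem_sup_right ?_)
    simpa using hF
  have hj0 : LinearIndepOn ℂ z ({j} : Finset κ) := by
    rw [Finset.coe_singleton, linearIndepOn_singleton_iff]
    intro h
    exact haj (congrArg Prod.fst h)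
  have htj : t ∉ Submodule.span ℂ (z '' ({j} : Finset κ)) := by
    rw [Finset.coe_singleton, Set.image_singleton, Submodule.mem_span_singleton]
    rintro ⟨r, hr⟩
    have h1 : r • a j = 0 := congrArg Prod.fst hr
    have h2 : r * c j = 1 := congrArg Prod.snd hr
    rcases smul_eq_zero.1 h1 with h | h
    · simp [h] at h2
    · exact haj h
  -- On a line through a basis containing `j`, both `F` and `z j` vanish and `t` does not; hence `g`
  -- vanishes.
  have hgb : ∀ b : Finset κ, {j} ⊆ b → b ⊆ {j} ∪ T → IsBasisAt t z b →
      g ∈ symVanishing (Submodule.span ℂ (z '' b)) := by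
    intro b hjb hb hB
    have h1 := hFb b (by rwa [Finset.insert_eq]) hB
    have h2 : SymmetricAlgebra.ι ℂ _ (z j) * f' ∈ symVanishing (Submodule.span ℂ (z '' b)) :=
      Ideal.mul_mem_right _ _ (ι_mem_symVanishing.2
        (Submodule.subset_span ⟨j, hjb (Finset.mem_singleton_self j), rfl⟩))
    have h3 := sub_mem h1 h2
    rw [← hg] at h3
    exact (Ideal.IsPrime.mem_or_mem inferInstance h3).resolve_right
      fun h => hB.2.1 (ι_mem_symVanishing.1 h)
  have hg' := mem_relIdeal_of_forall_basis hc T {j} (by simpa using hj) hj0 htj g hgb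
  rw [Finset.coe_singleton, Set.image_singleton, Set.image_singleton, Set.pair_comm] at hg'
  obtain ⟨y, hy, G, hG, rfl⟩ := Submodule.mem_sup.1 hg'
  obtain ⟨h, rfl⟩ := Ideal.mem_span_singleton'.1 hy
  have hG' := relIdeal_insert_le hj hG
  -- With `g = h * z j + G`, the product of `z j` with this element is `F - G * t`, which vanishes
  -- on all lines. On those with basis in `T` the factor `z j` can be dropped. Setting `t = 0`
  -- leaves `f`.
  have hfT : f' + SymmetricAlgebra.ι ℂ _ t * h ∈ relIdeal {t} z T := by
    have := mem_relIdeal_of_forall_basis hc T ∅ (by simp) (by simp) (by simpa using htne)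
      (f' + SymmetricAlgebra.ι ℂ _ t * h) ?_
    · simpa using this
    intro b _ hb hB
    rw [Finset.empty_union] at hb
    have hb' := hb.trans (Finset.subset_insert j T)
    have h1 := hFb b hb' hB
    have h2 : G ∈ symVanishing (Submodule.span ℂ (z '' b)) := by
      refine sup_relIdeal_le_symVanishing (C := ∅) (D := insert j T) hB (by simp)
        (by simpa using hb') (Ideal.mem_sup_right ?_)
      simpa using hG'
    have h3 : SymmetricAlgebra.ι ℂ _ (z j) * (f' + SymmetricAlgebra.ι ℂ _ t * h) ∈
        symVanishing (Submodule.span ℂ (z '' b)) := by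
      have h4 := sub_mem h1 (Ideal.mul_mem_right (SymmetricAlgebra.ι ℂ _ t) _ h2)
      convert h4 using 1
      linear_combination hg
    exact (Ideal.IsPrime.mem_or_mem inferInstance h3).resolve_left
      fun h => hc b hB j (fun hjb => hj (hb hjb)) (ι_mem_symVanishing.1 h)
  have := Ideal.mem_map_of_mem π hfT
  rw [map_relIdeal a c, map_add, map_mul, hπ, symMap_ι] at this
  simpa [ht] using this

theorem mem_relIdeal_of_prod_mul_mem [Finite κ] {a : κ → V} (ha : ∀ i, a i ≠ 0) (T : Finset κ)
    (E : Finset κ) : Disjoint T E → ∀ {f : SymmetricAlgebra ℂ V},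
    (∏ i ∈ E, SymmetricAlgebra.ι ℂ V (a i)) * f ∈ relIdeal ∅ a (T ∪ E) → f ∈ relIdeal ∅ a T := by
  induction E using Finset.induction_on with
  | empty => simp
  | insert j E hj ih =>
    intro hTE f hf
    rw [Finset.disjoint_insert_right] at hTE
    rw [Finset.prod_insert hj, mul_assoc, Finset.union_insert] at hf
    exact ih hTE.2 (mem_relIdeal_of_mul_mem (by simp [hj, hTE.1]) (ha j) hf)

/-! ### Powers of the equations as repeated vectors. -/

variable {ι : Type*} [Fintype ι]

/-- A vector disappears from the remaining span only when all its `n` copies are in `Y`. Keeping in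
`Y` only the vectors with all copies present gives a divisor that is a product of `n`-th powers over
a cocircuit. -/
theorem relIdeal_le_cocircuitIdeal [DecidableEq ι] (a : ι → V) {n N : ℕ} (hn : n ≤ N) :
    relIdeal ∅ (fun p : ι × Fin N => a p.1) {p | p.2.1 < n} ≤
      cocircuitIdeal (fun i => SymmetricAlgebra.ι ℂ V (a i) ^ n) a := by
  refine Ideal.span_le.2 ?_
  rintro _ ⟨Y, hY, hs, rfl⟩
  let Y₀ : Finset ι := {i | ∀ k : Fin N, k.1 < n → (i, k) ∈ Y}
  have hprod : ∏ i ∈ Y₀, SymmetricAlgebra.ι ℂ V (a i) ^ n ∣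
      ∏ p ∈ Y, SymmetricAlgebra.ι ℂ V (a p.1) := by
    have h1 : ∏ p ∈ Y₀ ×ˢ ({k | k.1 < n} : Finset (Fin N)), SymmetricAlgebra.ι ℂ V (a p.1) =
        ∏ i ∈ Y₀, SymmetricAlgebra.ι ℂ V (a i) ^ n := by
      rw [Finset.prod_product]
      refine Finset.prod_congr rfl fun i _ => ?_
      dsimp only
      rw [Finset.prod_const, Fin.card_filter_val_lt, min_eq_right hn]
    rw [← h1]
    refine Finset.prod_dvd_prod_of_subset _ _ _ fun p hp => ?_
    simp only [Y₀, Finset.mem_product, Finset.mem_filter_univ] at hp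
    exact hp.1 p.2 hp.2
  refine Ideal.mem_of_dvd _ hprod (Ideal.subset_span ⟨Y₀, ?_, rfl⟩)
  refine fun h => hs (top_le_iff.1 (h.symm.le.trans (Submodule.span_mono ?_)))
  rintro _ ⟨i, hi, rfl⟩
  simp only [Y₀, Finset.mem_filter_univ, Set.mem_ofPred_eq] at hi
  push Not at hi
  obtain ⟨k, hk, hik⟩ := hi
  exact Or.inr ⟨(i, k), by simp [hk, hik], rfl⟩

theorem cocircuitIdeal_le_relIdeal [DecidableEq ι] (a : ι → V) {N : ℕ} :
    cocircuitIdeal (fun i => SymmetricAlgebra.ι ℂ V (a i) ^ N) a ≤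
    relIdeal ∅ (fun p : ι × Fin N => a p.1) Finset.univ := by
  refine Ideal.span_le.2 ?_
  rintro _ ⟨Y, hY, rfl⟩
  refine Ideal.subset_span ⟨Y ×ˢ Finset.univ, Finset.subset_univ _, ?_, ?_⟩
  · refine fun h => hY (top_le_iff.1 (h.symm.le.trans (Submodule.span_mono ?_)))
    rw [Set.empty_union]
    rintro _ ⟨p, hp, rfl⟩
    exact ⟨p.1, by simpa using hp, rfl⟩
  · rw [Finset.prod_product]
    simp

/-- The equations of the list are not zero divisors for the cocircuit ideals. -/
theorem mem_cocircuitIdeal_of_pow_mul_mem {a : ι → V} (ha : ∀ i, a i ≠ 0) {n m : ℕ}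
    {f : SymmetricAlgebra ℂ V}
    (hf : (∏ i, SymmetricAlgebra.ι ℂ V (a i)) ^ m * f ∈
      cocircuitIdeal (fun i => SymmetricAlgebra.ι ℂ V (a i) ^ (n + m)) a) :
    f ∈ cocircuitIdeal (fun i => SymmetricAlgebra.ι ℂ V (a i) ^ n) a := by
  classical
  -- The factor to be cancelled consists of the last `m` of the `n + m` copies of each vector.
  have h1 : ∏ p : ι × Fin (n + m) with ¬ p.2.1 < n, SymmetricAlgebra.ι ℂ V (a p.1) =
      (∏ i, SymmetricAlgebra.ι ℂ V (a i)) ^ m := by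
    have h2 : (({p | ¬ p.2.1 < n} : Finset (ι × Fin (n + m)))) =
        Finset.univ ×ˢ ({k | ¬ k.1 < n} : Finset (Fin (n + m))) := by
      ext p
      simp
    rw [h2, Finset.prod_product, ← Finset.prod_pow]
    refine Finset.prod_congr rfl fun i _ => ?_
    dsimp only
    rw [Finset.prod_const]
    congr 1
    have := Finset.card_filter_add_card_filter_not (s := (Finset.univ : Finset (Fin (n + m))))
      (fun k => k.1 < n)
    rw [Fin.card_filter_val_lt, min_eq_right (Nat.le_add_right n m), Finset.card_fin] at this
    omega
  have h3 := cocircuitIdeal_le_relIdeal a hf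
  rw [← Finset.filter_union_filter_not_eq (fun p : ι × Fin (n + m) => p.2.1 < n) Finset.univ,
    ← h1] at h3
  exact relIdeal_le_cocircuitIdeal a (Nat.le_add_right n m)
    (mem_relIdeal_of_prod_mul_mem (a := fun p : ι × Fin (n + m) => a p.1) (fun p => ha p.1) _ _
      (Finset.disjoint_filter_filter_not _ _ _) h3)

end Generic

/-! ### Fractions and polar parts -/

section Polar

variable {V : Type*} [AddCommGroup V] [Module ℂ V]
variable {A : Type*} [CommRing A]
variable {ι : Type*} [Fintype ι]

theorem eq_frac_iff {d : ι → A} {f : A} {h : ι → ℕ} {x : Loc d} :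
    x = frac d f h ↔ x * algebraMap A (Loc d) (∏ i, d i ^ h i) = algebraMap A (Loc d) f := by
  rw [← frac_mul d f h]
  exact ((isUnit_denominator d h).mul_left_inj).symm

theorem frac_eq_frac_add (d : ι → A) (f : A) (h k : ι → ℕ) :
    frac d f h = frac d (f * ∏ i, d i ^ k i) (h + k) := by
  rw [eq_frac_iff]
  simp only [Pi.add_apply, pow_add, Finset.prod_mul_distrib]
  rw [map_mul, ← mul_assoc, frac_mul, map_mul]

theorem frac_eq_frac_const_add (d : ι → A) (f : A) (n m : ℕ) :
    frac d f (fun _ => n) = frac d (f * (∏ i, d i) ^ m) (fun _ => n + m) := by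
  rw [frac_eq_frac_add d f _ (fun _ => m), ← Finset.prod_pow]
  rfl

theorem smul_frac (d : ι → A) (a f : A) (h : ι → ℕ) :
    a • frac d f h = frac d (a * f) h := by
  rw [eq_frac_iff, smul_mul_assoc, frac_mul, map_mul, Algebra.smul_def]

theorem frac_add_frac (d : ι → A) (f g : A) (h : ι → ℕ) :
    frac d f h + frac d g h = frac d (f + g) h := by
  rw [eq_frac_iff, add_mul, frac_mul, frac_mul, map_add]

theorem exists_eq_frac (d : ι → A) (x : Loc d) :
    ∃ (f : A) (n : ℕ), x = frac d f (fun _ => n) := by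
  obtain ⟨n, f, hf⟩ := IsLocalization.Away.surj (∏ i, d i) x
  exact ⟨f, n, by rw [eq_frac_iff, ← hf, Finset.prod_pow, map_pow]⟩

theorem frac_eq_frac_const_one (d : ι → A) (f : A) (b : Set ι) [DecidablePred (· ∈ b)] :
    frac d f (b.indicator 1) = frac d (f * ∏ i with i ∉ b, d i) (fun _ => 1) := by
  rw [frac_eq_frac_add d f _ (fun i => if i ∈ b then 0 else 1)]
  congr 2
  · rw [Finset.prod_filter]
    refine Finset.prod_congr rfl fun i _ => ?_
    by_cases hi : i ∈ b <;> simp [hi]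
  · ext i
    by_cases hi : i ∈ b <;> simp [hi]

theorem pow_mul_mem_cocircuitIdeal {d : ι → A} {v : ι → V} {n : ℕ} (m : ℕ) {f : A}
    (hf : f ∈ cocircuitIdeal (fun i => d i ^ n) v) :
    (∏ i, d i) ^ m * f ∈ cocircuitIdeal (fun i => d i ^ (n + m)) v := by
  refine Submodule.span_induction ?_ (by simp) ?_ ?_ hf
  · rintro _ ⟨Y, hY, rfl⟩
    refine Ideal.mem_of_dvd _ ?_ (Ideal.subset_span ⟨Y, hY, rfl⟩)
    simp only [pow_add, Finset.prod_mul_distrib, Finset.prod_pow]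
    rw [mul_comm]
    exact mul_dvd_mul (pow_dvd_pow_of_dvd
      (Finset.prod_dvd_prod_of_subset _ _ _ (Finset.subset_univ _)) _) dvd_rfl
  · intro x y _ _ hx hy
    rw [mul_add]
    exact add_mem hx hy
  · intro a x _ hx
    rw [smul_eq_mul, mul_left_comm]
    exact Ideal.mul_mem_left _ _ hx

theorem polarClass_eq_zero_iff {d : ι → A} {v : ι → V} {x : Loc d} :
    polarClass d v x = 0 ↔ x ∈ polarFiltration d v ((Module.finrank ℂ V : ℤ) - 1) :=
  Submodule.Quotient.mk_eq_zero _

/-! ### Derivations -/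

section Derivations

variable [Algebra ℂ A]

theorem locDerivation_frac (d : ι → A) (D : Derivation ℂ A A) (f : A) (h : ι → ℕ) :
    locDerivation d D (frac d f h) =
      frac d (D f * ∏ i, d i ^ h i - f * D (∏ i, d i ^ h i)) (h + h) := by
  have h1 := congrArg (locDerivation d D) (frac_mul d f h)
  rw [Derivation.leibniz, locDerivation_algebraMap, locDerivation_algebraMap] at h1
  rw [eq_frac_iff]
  simp only [Pi.add_apply, pow_add, Finset.prod_mul_distrib]
  simp only [smul_eq_mul] at h1
  rw [map_mul, map_sub, map_mul, map_mul, ← frac_mul d f h]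
  linear_combination algebraMap A (Loc d) (∏ i, d i ^ h i) * h1

/-- The denominator has exponent `n + 1` rather than `2 n`, to match the quotient rule for the
operators on the local modules. -/
theorem locDerivation_frac_const (d : ι → A) (D : Derivation ℂ A A) (f : A) (n : ℕ) :
    locDerivation d D (frac d f fun _ => n) =
      frac d (D f * (∏ i, d i) - n • (f * D (∏ i, d i))) (fun _ => n + 1) := by
  have h0 := frac_mul d f (fun _ => n)
  rw [Finset.prod_pow] at h0
  have h1 := congrArg (locDerivation d D) h0
  rw [Derivation.leibniz, locDerivation_algebraMap, locDerivation_algebraMap,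
    Derivation.leibniz_pow] at h1
  rw [eq_frac_iff, Finset.prod_pow]
  simp only [smul_eq_mul, nsmul_eq_mul, map_mul, map_natCast, map_sub, map_pow] at h0 h1 ⊢
  rw [← h0]
  cases n with
  | zero =>
    simp only [Nat.cast_zero, pow_zero] at h1 ⊢
    linear_combination algebraMap A (Loc d) (∏ i, d i) * h1
  | succ n =>
    rw [Nat.add_sub_cancel] at h1
    linear_combination algebraMap A (Loc d) (∏ i, d i) * h1

/-- Deriving a fraction raises the exponents of its denominator without enlarging their support, so
the polar order does not grow. -/
theorem locDerivation_mem_polarFiltration (d : ι → A) (v : ι → V) (D : Derivation ℂ A A) {k : ℤ}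
    {x : Loc d} (hx : x ∈ polarFiltration d v k) :
    locDerivation d D x ∈ polarFiltration d v k := by
  refine Submodule.span_induction ?_ (by simp) ?_ ?_ hx
  · rintro _ ⟨f, h, hh, rfl⟩
    rw [locDerivation_frac]
    refine Submodule.subset_span ⟨_, _, ?_, rfl⟩
    have : {i | 0 < (h + h) i} = {i | 0 < h i} := by
      ext i
      simp
    rwa [this]
  · intro x y _ _ hx hy
    rw [map_add]
    exact add_mem hx hy
  · intro a x hx' hx
    rw [Algebra.smul_def, Derivation.leibniz, locDerivation_algebraMap, smul_eq_mul, smul_eq_mul,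
      mul_comm x, ← Algebra.smul_def, ← Algebra.smul_def]
    exact add_mem (Submodule.smul_mem _ _ hx) (Submodule.smul_mem _ _ hx')

/-- The action of a derivation on the polar parts. -/
def polarDerivation (d : ι → A) (v : ι → V) (D : Derivation ℂ A A) :
    PolarParts d v →ₗ[ℂ] PolarParts d v where
  toFun := Quotient.map' (locDerivation d D) (by
    intro x y hxy
    rw [Submodule.quotientRel_def] at hxy ⊢
    rw [← map_sub]
    exact locDerivation_mem_polarFiltration d v D hxy)
  map_add' := by
    rintro ⟨x⟩ ⟨y⟩
    exact congrArg (polarClass d v) (map_add (locDerivation d D) x y)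
  map_smul' := by
    rintro c ⟨x⟩
    exact congrArg (polarClass d v) ((locDerivation d D).map_smul c x)

theorem polarDerivation_polarClass (d : ι → A) (v : ι → V) (D : Derivation ℂ A A) (x : Loc d) :
    polarDerivation d v D (polarClass d v x) = polarClass d v (locDerivation d D x) := rfl

theorem polarDerivation_smul (d : ι → A) (v : ι → V) (D : Derivation ℂ A A) (a : A)
    (y : PolarParts d v) :
    polarDerivation d v D (a • y) = a • polarDerivation d v D y + D a • y := by
  obtain ⟨x, rfl⟩ := Submodule.Quotient.mk_surjective _ y
  have : locDerivation d D (a • x) = a • locDerivation d D x + D a • x := by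
    rw [Algebra.smul_def, Derivation.leibniz, locDerivation_algebraMap, smul_eq_mul, smul_eq_mul,
      mul_comm x, ← Algebra.smul_def, ← Algebra.smul_def]
  exact congrArg (polarClass d v) this

end Derivations

/-! ### The top degree of the filtration -/

variable [FiniteDimensional ℂ V]

theorem finrank_span_le_iff (s : Set V) :
    (Module.finrank ℂ (Submodule.span ℂ s) : ℤ) ≤ (Module.finrank ℂ V : ℤ) - 1 ↔
      Submodule.span ℂ s ≠ ⊤ := by
  constructor
  · intro h hs
    rw [hs, finrank_top] at h
    omega
  · intro h
    have := Submodule.finrank_lt h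
    omega

theorem frac_mem_polarFiltration {d : ι → A} {v : ι → V} {h : ι → ℕ}
    (hh : Submodule.span ℂ (v '' {i | 0 < h i}) ≠ ⊤) (f : A) :
    frac d f h ∈ polarFiltration d v ((Module.finrank ℂ V : ℤ) - 1) :=
  Submodule.subset_span ⟨f, h, (finrank_span_le_iff _).2 hh, rfl⟩

theorem frac_mem_of_mem_cocircuitIdeal {d : ι → A} {v : ι → V} {n : ℕ} {f : A}
    (hf : f ∈ cocircuitIdeal (fun i => d i ^ n) v) :
    frac d f (fun _ => n) ∈ polarFiltration d v ((Module.finrank ℂ V : ℤ) - 1) := by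
  classical
  refine Submodule.span_induction ?_ ?_ ?_ ?_ hf
  · rintro _ ⟨Y, hY, rfl⟩
    have : frac d (∏ i ∈ Y, d i ^ n) (fun _ => n) = frac d 1 (fun i => if i ∈ Y then 0 else n) := by
      rw [frac_eq_frac_add d 1 _ (fun i => if i ∈ Y then n else 0)]
      congr 1
      · simp [Finset.prod_ite_mem, pow_ite]
      · ext i
        by_cases hi : i ∈ Y <;> simp [hi]
    rw [this]
    refine frac_mem_polarFiltration (fun h => hY (top_le_iff.1 ?_)) _
    rw [← h]
    refine Submodule.span_mono (Set.image_mono fun i hi => ?_)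
    by_contra h'
    simp only [Set.mem_ofPred_eq, not_not] at h' hi
    simp [h'] at hi
  · rw [← smul_zero (0 : A), smul_eq_mul, ← smul_frac, zero_smul]
    exact Submodule.zero_mem _
  · intro x y _ _ hx hy
    rw [← frac_add_frac]
    exact add_mem hx hy
  · intro a x _ hx
    rw [smul_eq_mul, ← smul_frac]
    exact Submodule.smul_mem _ _ hx

/-- Raising all exponents to a common `N` puts `d i ^ N` in the numerator for each `i` absent from
the denominator. These `i` form a cocircuit. -/
theorem exists_eq_frac_of_mem_polarFiltration {d : ι → A} {v : ι → V} {x : Loc d}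
    (hx : x ∈ polarFiltration d v ((Module.finrank ℂ V : ℤ) - 1)) :
    ∃ (f : A) (n : ℕ), f ∈ cocircuitIdeal (fun i => d i ^ n) v ∧ x = frac d f (fun _ => n) := by
  classical
  refine Submodule.span_induction ?_ ?_ ?_ ?_ hx
  · rintro _ ⟨f, h, hh, rfl⟩
    obtain ⟨N, hN⟩ : ∃ N, ∀ i, h i ≤ N :=
      ⟨∑ i, h i, fun i => Finset.single_le_sum (fun _ _ => Nat.zero_le _) (Finset.mem_univ i)⟩
    refine ⟨f * ∏ i, d i ^ (N - h i), N, ?_, ?_⟩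
    · refine Ideal.mem_of_dvd _ (a := ∏ i ∈ ({i | h i = 0} : Finset ι), d i ^ N) ?_
        (Ideal.subset_span ⟨Finset.univ.filter fun i => h i = 0, ?_, rfl⟩)
      · refine Dvd.dvd.mul_left ?_ f
        rw [Finset.prod_congr rfl (g := fun i => d i ^ (N - h i))]
        · exact Finset.prod_dvd_prod_of_subset _ _ _ (Finset.subset_univ _)
        · intro i hi
          rw [Finset.mem_filter_univ] at hi
          rw [hi, Nat.sub_zero]
      · rw [finrank_span_le_iff] at hh
        have : {i | i ∉ ({i | h i = 0} : Finset ι)} = {i | 0 < h i} := by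
          ext i
          simp [Nat.pos_iff_ne_zero]
        rwa [IsCocircuit, this]
    · rw [frac_eq_frac_add d f h (fun i => N - h i)]
      congr 1
      ext i
      simp [hN i]
  · exact ⟨0, 0, Ideal.zero_mem _, by rw [eq_frac_iff]; simp⟩
  · rintro _ _ _ _ ⟨f, n, hf, rfl⟩ ⟨g, m, hg, rfl⟩
    refine ⟨(∏ i, d i) ^ m * f + (∏ i, d i) ^ n * g, n + m,
      add_mem (pow_mul_mem_cocircuitIdeal m hf) ?_, ?_⟩
    · rw [add_comm n m]
      exact pow_mul_mem_cocircuitIdeal n hg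
    · rw [← frac_add_frac, frac_eq_frac_const_add d f n m, frac_eq_frac_const_add d g m n,
        add_comm m n, mul_comm f, mul_comm g]
  · rintro a _ _ ⟨f, n, hf, rfl⟩
    exact ⟨a * f, n, Ideal.mul_mem_left _ _ hf, smul_frac d a f _⟩

/-- The power `m` absorbs the change of denominator and the equality in the localization. On the
linear side it is removed by `mem_cocircuitIdeal_of_pow_mul_mem`; on the toric side the local
components are insensitive to it. -/
theorem exists_pow_mul_mem_cocircuitIdeal {d : ι → A} {v : ι → V} {n : ℕ} {f : A}
    (hf : frac d f (fun _ => n) ∈ polarFiltration d v ((Module.finrank ℂ V : ℤ) - 1)) :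
    ∃ m, (∏ i, d i) ^ m * f ∈ cocircuitIdeal (fun i => d i ^ (n + m)) v := by
  obtain ⟨g, m, hg, h⟩ := exists_eq_frac_of_mem_polarFiltration hf
  have h1 : algebraMap A (Loc d) (f * (∏ i, d i) ^ m) =
      algebraMap A (Loc d) (g * (∏ i, d i) ^ n) := by
    rw [← frac_mul d (f * (∏ i, d i) ^ m) (fun _ => n + m), ← frac_eq_frac_const_add, h,
      frac_eq_frac_const_add d g m n, add_comm m n, frac_mul]
  obtain ⟨⟨_, k, rfl⟩, hk⟩ := (IsLocalization.eq_iff_exists (Submonoid.powers (∏ i, d i)) _).1 h1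
  refine ⟨m + k, ?_⟩
  have h2 := pow_mul_mem_cocircuitIdeal (n + k) hg
  have h3 : (∏ i, d i) ^ (m + k) * f = (∏ i, d i) ^ (n + k) * g := by
    simp only [pow_add]
    simp only at hk
    linear_combination hk
  rw [h3]
  rwa [show m + (n + k) = n + (m + k) by omega] at h2

/-- The cocircuit ideal of order `n` kills the class of `∏ (d i)⁻ⁿ`. -/
theorem smul_polarClass_frac_eq_zero {d : ι → A} {v : ι → V} {n : ℕ} {f : A}
    (hf : f ∈ cocircuitIdeal (fun i => d i ^ n) v) (g : A) :
    f • polarClass d v (frac d g (fun _ => n)) = 0 := by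
  have : f • polarClass d v (frac d g (fun _ => n)) =
      polarClass d v (f • frac d g (fun _ => n)) := rfl
  rw [this, polarClass_eq_zero_iff, smul_frac]
  exact frac_mem_of_mem_cocircuitIdeal (Ideal.mul_mem_right _ _ hf)

end Polar

/-! ### Power series in a locally nilpotent element -/

section Series

variable {S : Type*} [CommRing S] [Algebra ℂ S]
variable {M : Type*} [AddCommGroup M] [Module S M] [Module ℂ M] [IsScalarTower ℂ S M]

variable (M) in
/-- `x` acts locally nilpotently on `M`. -/
def LocNil (x : S) : Prop := ∀ y : M, ∃ n : ℕ, x ^ n • y = 0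

omit [Algebra ℂ S] [IsScalarTower ℂ S M] [Module ℂ M] in
theorem pow_smul_eq_zero_of_le {x : S} {y : M} {n m : ℕ} (h : x ^ n • y = 0) (hnm : n ≤ m) :
    x ^ m • y = 0 := by
  rw [← Nat.sub_add_cancel hnm, pow_add, mul_smul, h, smul_zero]

omit [Algebra ℂ S] [IsScalarTower ℂ S M] in
theorem seriesAct_eq_sum (c : ℕ → ℂ) {x : S} {y : M} {n : ℕ} (h : x ^ n • y = 0) :
    seriesAct c x y = ∑ k ∈ Finset.range n, c k • x ^ k • y := by
  refine finsum_eq_sum_of_support_subset _ fun k hk => ?_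
  rw [Finset.coe_range, Set.mem_Iio]
  by_contra! h'
  exact hk (by simp only [pow_smul_eq_zero_of_le h h', smul_zero])

theorem map_seriesAct {M' : Type*} [AddCommGroup M'] [Module S M'] [Module ℂ M']
    [IsScalarTower ℂ S M'] (F : M →ₗ[S] M') (c : ℕ → ℂ) {x : S} (hx : LocNil M x) (y : M) :
    F (seriesAct c x y) = seriesAct c x (F y) := by
  obtain ⟨n, hn⟩ := hx y
  have hn' : x ^ n • F y = 0 := by rw [← map_smul, hn, map_zero]
  rw [seriesAct_eq_sum c hn, seriesAct_eq_sum c hn', map_sum]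
  refine Finset.sum_congr rfl fun k _ => ?_
  rw [LinearMap.map_smul_of_tower, map_smul]

/-- A power series in `x`, as an operator. -/
def seriesOp (x : S) (hx : LocNil M x) (c : PowerSeries ℂ) : Module.End S M where
  toFun y := seriesAct (fun k => PowerSeries.coeff k c) x y
  map_add' y z := by
    obtain ⟨n, hn⟩ := hx y
    obtain ⟨m, hm⟩ := hx z
    have h1 := pow_smul_eq_zero_of_le hn (le_max_left n m)
    have h2 := pow_smul_eq_zero_of_le hm (le_max_right n m)
    have h3 : x ^ max n m • (y + z) = 0 := by rw [smul_add, h1, h2, add_zero]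
    rw [seriesAct_eq_sum _ h1, seriesAct_eq_sum _ h2, seriesAct_eq_sum _ h3,
      ← Finset.sum_add_distrib]
    simp only [smul_add]
  map_smul' s y := (map_seriesAct (LinearMap.lsmul S M s) _ hx y).symm

theorem seriesOp_apply (x : S) (hx : LocNil M x) (c : PowerSeries ℂ) (y : M) :
    seriesOp x hx c y = seriesAct (fun k => PowerSeries.coeff k c) x y := rfl

theorem seriesOp_comm (x : S) (hx : LocNil M x) (c : PowerSeries ℂ) (T : Module.End S M) :
    seriesOp x hx c * T = T * seriesOp x hx c := by
  ext y
  exact (map_seriesAct T _ hx y).symm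

theorem seriesOp_add (x : S) (hx : LocNil M x) (c c' : PowerSeries ℂ) :
    seriesOp x hx (c + c') = seriesOp x hx c + seriesOp x hx c' := by
  ext y
  obtain ⟨n, hn⟩ := hx y
  simp only [seriesOp_apply, LinearMap.add_apply, seriesAct_eq_sum _ hn, map_add, add_smul,
    Finset.sum_add_distrib]

theorem seriesOp_C_mul (x : S) (hx : LocNil M x) (r : ℂ) (c : PowerSeries ℂ) :
    seriesOp x hx (PowerSeries.C r * c) = r • seriesOp x hx c := by
  ext y
  obtain ⟨n, hn⟩ := hx y
  simp only [seriesOp_apply, LinearMap.smul_apply, seriesAct_eq_sum _ hn,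
    PowerSeries.coeff_C_mul, Finset.smul_sum, mul_smul]

theorem seriesOp_one (x : S) (hx : LocNil M x) : seriesOp x hx 1 = 1 := by
  ext y
  obtain ⟨n, hn⟩ := hx y
  rw [seriesOp_apply, seriesAct_eq_sum _ (pow_smul_eq_zero_of_le hn (Nat.le_succ n)),
    Finset.sum_range_succ']
  simp [PowerSeries.coeff_one]

theorem seriesOp_X_mul (x : S) (hx : LocNil M x) (c : PowerSeries ℂ) (y : M) :
    seriesOp x hx (PowerSeries.X * c) y = x • seriesOp x hx c y := by
  obtain ⟨n, hn⟩ := hx y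
  rw [seriesOp_apply, seriesOp_apply, seriesAct_eq_sum (fun k => PowerSeries.coeff k c) hn,
    seriesAct_eq_sum (fun k => PowerSeries.coeff k (PowerSeries.X * c))
      (pow_smul_eq_zero_of_le hn (Nat.le_succ n)), Finset.sum_range_succ', Finset.smul_sum]
  simp only [PowerSeries.coeff_succ_X_mul, PowerSeries.coeff_zero_X_mul, zero_smul, add_zero]
  refine Finset.sum_congr rfl fun k _ => ?_
  rw [pow_succ', mul_smul, smul_comm]

theorem seriesOp_X_pow_mul (x : S) (hx : LocNil M x) (n : ℕ) (c : PowerSeries ℂ) (y : M) :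
    seriesOp x hx (PowerSeries.X ^ n * c) y = x ^ n • seriesOp x hx c y := by
  induction n with
  | zero => simp
  | succ n ih => rw [pow_succ', mul_assoc, seriesOp_X_mul, ih, smul_smul, pow_succ']

theorem seriesOp_polynomial_mul (x : S) (hx : LocNil M x) (p : Polynomial ℂ) (c : PowerSeries ℂ) :
    seriesOp x hx (p * c) = seriesOp x hx p * seriesOp x hx c := by
  induction p using Polynomial.induction_on' with
  | add p q hp hq => rw [Polynomial.coe_add, add_mul, seriesOp_add, hp, hq, seriesOp_add, add_mul]
  | monomial n a =>
    have h : ((Polynomial.monomial n a : Polynomial ℂ) : PowerSeries ℂ) =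
        PowerSeries.C a * (PowerSeries.X ^ n * 1) := by
      rw [← Polynomial.C_mul_X_pow_eq_monomial]
      simp
    have h' : ∀ e : PowerSeries ℂ, PowerSeries.C a * (PowerSeries.X ^ n * 1) * e =
      PowerSeries.C a * (PowerSeries.X ^ n * e) := fun e => by ring
    rw [h, h', seriesOp_C_mul, seriesOp_C_mul]
    ext y
    simp only [LinearMap.smul_apply, Module.End.mul_apply, seriesOp_X_pow_mul, seriesOp_one,
      Module.End.one_apply]

theorem seriesOp_mul (x : S) (hx : LocNil M x) (c c' : PowerSeries ℂ) :
    seriesOp x hx (c * c') = seriesOp x hx c * seriesOp x hx c' := by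
  ext y
  obtain ⟨n, hn⟩ := hx y
  -- On `y` only the truncation of `c` matters, as `x ^ n` kills `y` and its images; this reduces to
  -- polynomials.
  obtain ⟨e, he⟩ : PowerSeries.X ^ n ∣ c - (PowerSeries.trunc n c : PowerSeries ℂ) := by
    rw [PowerSeries.X_pow_dvd_iff]
    intro m hm
    simp [PowerSeries.coeff_trunc, hm]
  obtain ⟨p, rfl⟩ : ∃ p : Polynomial ℂ, c = (p : PowerSeries ℂ) + PowerSeries.X ^ n * e :=
    ⟨PowerSeries.trunc n c, by rw [← he, add_sub_cancel]⟩
  have h0 : ∀ (e : PowerSeries ℂ) (z : M), x ^ n • z = 0 →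
      seriesOp x hx (PowerSeries.X ^ n * e) z = 0 := by
    intro e z hz
    rw [seriesOp_X_pow_mul, ← map_smul, hz, map_zero]
  have h1 : x ^ n • seriesOp x hx c' y = 0 := by rw [← map_smul, hn, map_zero]
  rw [add_mul, seriesOp_add, seriesOp_add, add_mul, seriesOp_polynomial_mul, mul_assoc]
  simp only [LinearMap.add_apply, Module.End.mul_apply, h0 _ _ h1, h0 _ _ hn]

/-- Evaluation of power series at a locally nilpotent element. -/
def seriesEnd (x : S) (hx : LocNil M x) : PowerSeries ℂ →ₐ[ℂ] Module.End S M where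
  toFun := seriesOp x hx
  map_one' := seriesOp_one x hx
  map_mul' := seriesOp_mul x hx
  map_zero' := by
    have := seriesOp_C_mul x hx 0 0
    simpa using this
  map_add' := seriesOp_add x hx
  commutes' r := by
    have := seriesOp_C_mul x hx r 1
    rw [mul_one, seriesOp_one] at this
    exact this

theorem seriesEnd_apply (x : S) (hx : LocNil M x) (c : PowerSeries ℂ) (y : M) :
    seriesEnd x hx c y = seriesAct (fun k => PowerSeries.coeff k c) x y := rfl

theorem seriesEnd_mk_apply (x : S) (hx : LocNil M x) (c : ℕ → ℂ) (y : M) :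
    seriesEnd x hx (PowerSeries.mk c) y = seriesAct c x y := by
  rw [seriesEnd_apply]
  simp only [PowerSeries.coeff_mk]

theorem seriesEnd_X (x : S) (hx : LocNil M x) (y : M) :
    seriesEnd x hx PowerSeries.X y = x • y := by
  have := seriesOp_X_mul x hx 1 y
  rw [mul_one, seriesOp_one] at this
  exact this

omit [Algebra ℂ S] [IsScalarTower ℂ S M] in
/-- A vector killed by `x` is an eigenvector of the power series in `x`. -/
theorem seriesAct_of_smul_eq_zero (c : ℕ → ℂ) {x : S} {y : M} (h : x • y = 0) :
    seriesAct c x y = c 0 • y := by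
  rw [seriesAct_eq_sum c (n := 1) (by simpa using h)]
  simp

omit [Algebra ℂ S] [IsScalarTower ℂ S M] in
theorem seriesAct_neg (c : ℕ → ℂ) (x : S) (y : M) :
    seriesAct c (-x) y = seriesAct (fun k => (-1) ^ k * c k) x y := by
  refine finsum_congr fun k => ?_
  rcases Nat.even_or_odd k with h | h
  · simp [h.neg_pow]
  · simp [h.neg_pow]

/-! ### The exponential of a nilpotent element -/

section Nilpotent

variable {B : Type*} [CommRing B] [Algebra ℂ B]

omit [Algebra ℂ B] in
theorem locNil_of_isNilpotent {x : B} (hx : IsNilpotent x) : LocNil B x := fun y => by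
  obtain ⟨n, hn⟩ := hx
  exact ⟨n, by rw [hn, zero_smul]⟩

/-- The exponential of a nilpotent element. -/
def nilExp (x : B) : B := seriesAct expCoeff x (1 : B)

theorem nilExp_eq_sum {x : B} {n : ℕ} (hx : x ^ n = 0) :
    nilExp x = ∑ k ∈ Finset.range n, expCoeff k • x ^ k := by
  rw [nilExp, seriesAct_eq_sum (n := n) _ (by rw [hx, zero_smul])]
  simp

theorem nilExp_add {x y : B} (hx : IsNilpotent x) (hy : IsNilpotent y) :
    nilExp (x + y) = nilExp x * nilExp y := by
  -- Comparison with `IsNilpotent.exp`, defined over `ℚ`, supplies the addition formula.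
  let _ : Algebra ℚ B := ((algebraMap ℂ B).comp (algebraMap ℚ ℂ)).toAlgebra
  have key : ∀ z : B, IsNilpotent z → nilExp z = IsNilpotent.exp z := by
    rintro z ⟨n, hn⟩
    rw [nilExp_eq_sum hn, IsNilpotent.exp_eq_sum hn]
    refine Finset.sum_congr rfl fun k _ => ?_
    rw [Algebra.smul_def, Algebra.smul_def, RingHom.algebraMap_toAlgebra, RingHom.comp_apply]
    simp [expCoeff]
  rw [key _ ((Commute.all x y).isNilpotent_add hx hy), key _ hx, key _ hy,
    IsNilpotent.exp_add_of_commute (Commute.all x y) hx hy]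

theorem nilExp_zero : nilExp (0 : B) = 1 := by
  rw [nilExp_eq_sum (n := 1) (by simp)]
  simp [expCoeff]

theorem map_nilExp {B' : Type*} [CommRing B'] [Algebra ℂ B'] (F : B →ₐ[ℂ] B') {x : B}
    (hx : IsNilpotent x) : F (nilExp x) = nilExp (F x) := by
  obtain ⟨n, hn⟩ := hx
  have hn' : F x ^ n = 0 := by rw [← map_pow, hn, map_zero]
  rw [nilExp_eq_sum hn, nilExp_eq_sum hn', map_sum]
  simp

/-- A power series in a nilpotent element is congruent to its constant term. -/
theorem seriesAct_one_eq {x : B} (hx : IsNilpotent x) (c : ℕ → ℂ) :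
    seriesAct c x (1 : B) = algebraMap ℂ B (c 0) +
      x * seriesAct (fun k => c (k + 1)) x (1 : B) := by
  obtain ⟨n, hn⟩ := hx
  have h1 : x ^ n • (1 : B) = 0 := by rw [hn, zero_smul]
  rw [seriesAct_eq_sum (fun k => c (k + 1)) h1,
    seriesAct_eq_sum c (pow_smul_eq_zero_of_le h1 (Nat.le_succ n)),
    Finset.sum_range_succ', Finset.mul_sum, add_comm]
  congr 1
  · simp [Algebra.algebraMap_eq_smul_one]
  · refine Finset.sum_congr rfl fun k _ => ?_
    simp [pow_succ']

theorem nilExp_eq {x : B} (hx : IsNilpotent x) : ∃ w, nilExp x = 1 + x + x ^ 2 * w := by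
  rw [nilExp, seriesAct_one_eq hx, seriesAct_one_eq hx]
  refine ⟨seriesAct (fun k => expCoeff (k + 1 + 1)) x (1 : B), ?_⟩
  have h0 : expCoeff 0 = 1 := by simp [expCoeff]
  have h1 : expCoeff (0 + 1) = 1 := by simp [expCoeff]
  rw [h0, h1, map_one]
  ring

/-- With `z = x - y`, the relation `exp z = 1` reads `z * (1 + z * w) = 0`, and the second factor is
a unit. -/
theorem nilExp_injective {x y : B} (hx : IsNilpotent x) (hy : IsNilpotent y)
    (h : nilExp x = nilExp y) : x = y := by
  have hy' : IsNilpotent (-y) := hy.neg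
  have hxy : IsNilpotent (x + -y) := (Commute.all _ _).isNilpotent_add hx hy'
  have h1 : nilExp (x + -y) = 1 := by
    rw [nilExp_add hx hy', h, ← nilExp_add hy hy', add_neg_cancel, nilExp_zero]
  obtain ⟨w, hw⟩ := nilExp_eq hxy
  rw [h1] at hw
  have h2 : (x + -y) * (1 + (x + -y) * w) = 0 := by linear_combination -hw
  have h3 : IsUnit (1 + (x + -y) * w) :=
    ((Commute.all _ _).isNilpotent_mul_right hxy).isUnit_one_add
  rw [h3.mul_left_eq_zero] at h2
  linear_combination h2

/-- The logarithm is found by successive approximation: if `exp l` equals `1 + n` up to `n ^ k * r`,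
correcting `l` by `-(n ^ k * r)` leaves an error divisible by `n ^ (k + 1)`. -/
theorem exists_nilExp_eq {n : B} (hn : IsNilpotent n) :
    ∃ l : B, IsNilpotent l ∧ nilExp l = 1 + n := by
  have key : ∀ k : ℕ, 1 ≤ k → ∃ l r : B, IsNilpotent l ∧ nilExp l = 1 + n + n ^ k * r := by
    intro k hk
    induction k, hk using Nat.le_induction with
    | base => exact ⟨0, -1, IsNilpotent.zero, by rw [nilExp_zero]; ring⟩
    | succ k hk ih =>
      obtain ⟨l, r, hl, hlr⟩ := ih
      have hnk : IsNilpotent (-(n ^ k * r)) :=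
        ((Commute.all _ _).isNilpotent_mul_right (hn.pow_of_pos (by omega))).neg
      obtain ⟨w, hw⟩ := nilExp_eq hnk
      -- Since `k ≥ 1`, the quadratic error `n ^ (2 * k)` equals `n ^ (k + 1) * n ^ m`.
      obtain ⟨m, rfl⟩ : ∃ m, k = m + 1 := ⟨k - 1, by omega⟩
      refine ⟨l + -(n ^ (m + 1) * r), -r + n ^ m * (-r ^ 2 + r ^ 2 * w * (1 + n + n ^ (m + 1) * r)),
        (Commute.all _ _).isNilpotent_add hl hnk, ?_⟩
      rw [nilExp_add hl hnk, hlr, hw]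
      ring
  obtain ⟨N, hN⟩ := hn
  obtain ⟨l, r, hl, hlr⟩ := key (N + 1) (by omega)
  exact ⟨l, hl, by rw [hlr, pow_succ, hN]; ring⟩

end Nilpotent

/-! ### The exponential of a locally nilpotent element -/

theorem seriesAct_quotient_one (I : Ideal S) (c : ℕ → ℂ) (x : S) :
    seriesAct c x (1 : S ⧸ I) = seriesAct c (Ideal.Quotient.mk I x) (1 : S ⧸ I) := by
  refine finsum_congr fun k => ?_
  rw [← map_pow, smul_eq_mul, ← Ideal.Quotient.algebraMap_eq, Algebra.smul_def (x ^ k)]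

omit [Algebra ℂ S] in
theorem locNil_quotient {I : Ideal S} {x : S} (hx : IsNilpotent (Ideal.Quotient.mk I x)) :
    LocNil (S ⧸ I) x := fun y => by
  obtain ⟨n, hn⟩ := hx
  refine ⟨n, ?_⟩
  rw [Algebra.smul_def, Ideal.Quotient.algebraMap_eq, map_pow, hn, zero_mul]

theorem seriesAct_quotient {I : Ideal S} {x : S} (hx : IsNilpotent (Ideal.Quotient.mk I x))
    (c : ℕ → ℂ) (y : S ⧸ I) :
    seriesAct c x y = seriesAct c (Ideal.Quotient.mk I x) (1 : S ⧸ I) * y := by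
  have := map_seriesAct (LinearMap.mulRight S y) c (locNil_quotient hx) 1
  rw [LinearMap.mulRight_apply, LinearMap.mulRight_apply, one_mul] at this
  rw [← this, seriesAct_quotient_one]

/-- The identity concerns only the cyclic module generated by `z`, a quotient ring of `S` in which
`x` and `y` are nilpotent; there it is `nilExp_add`. -/
theorem seriesAct_expCoeff_add {x y : S} {z : M} (hx : ∃ n : ℕ, x ^ n • z = 0)
    (hy : ∃ n : ℕ, y ^ n • z = 0) :
    seriesAct expCoeff (x + y) z = seriesAct expCoeff x (seriesAct expCoeff y z) := by
  set I := Ideal.torsionOf S M z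
  have hnil : ∀ w : S, (∃ n : ℕ, w ^ n • z = 0) → IsNilpotent (Ideal.Quotient.mk I w) := by
    rintro w ⟨n, hn⟩
    exact ⟨n, by rw [← map_pow]; exact Ideal.Quotient.eq_zero_iff_mem.2 hn⟩
  let F : (S ⧸ I) →ₗ[S] M := Submodule.liftQ I (LinearMap.toSpanSingleton S M z) le_rfl
  have hF : F 1 = z := one_smul S z
  have hx' := hnil x hx
  have hy' := hnil y hy
  have hxy : IsNilpotent (Ideal.Quotient.mk I (x + y)) := by
    rw [map_add]
    exact (Commute.all _ _).isNilpotent_add hx' hy'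
  rw [← hF, ← map_seriesAct F _ (locNil_quotient hxy), ← map_seriesAct F _ (locNil_quotient hy'),
    ← map_seriesAct F _ (locNil_quotient hx'), seriesAct_quotient hxy, seriesAct_quotient hx',
    seriesAct_quotient hy', map_add, mul_one, mul_one]
  exact congrArg F (nilExp_add hx' hy')

/-- From `[D, x] = r` follows `[D, x ^ (k + 1)] = (k + 1) r x ^ k`, and dividing by `(k + 1)!` gives
`r` times the `k`-th term of the exponential. -/
theorem map_seriesAct_expCoeff_of_derivation (D : M →ₗ[ℂ] M) {x : S} (hx : LocNil M x) {r : ℂ}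
    (hD : ∀ y : M, D (x • y) = x • D y + r • y) (y : M) :
    D (seriesAct expCoeff x y) = seriesAct expCoeff x (D y) + r • seriesAct expCoeff x y := by
  obtain ⟨n, hn⟩ := hx y
  obtain ⟨m, hm⟩ := hx (D y)
  have hpow : ∀ k : ℕ, D (x ^ (k + 1) • y) = x ^ (k + 1) • D y + ((k + 1 : ℂ) * r) • x ^ k • y := by
    intro k
    induction k with
    | zero => simp [hD]
    | succ k ih =>
      rw [pow_succ' x (k + 1), mul_smul x, hD, ih, smul_add, add_assoc,
        smul_comm x ((k + 1 : ℂ) * r), smul_smul x (x ^ k), ← pow_succ', ← add_smul,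
        smul_smul x (x ^ (k + 1))]
      congr 2
      push_cast
      ring
  have h1 := pow_smul_eq_zero_of_le hn (le_max_left n m)
  have h2 := pow_smul_eq_zero_of_le hm (le_max_right n m)
  set N := max n m
  rw [seriesAct_eq_sum expCoeff (pow_smul_eq_zero_of_le h1 (Nat.le_succ N)),
    seriesAct_eq_sum expCoeff (pow_smul_eq_zero_of_le h2 (Nat.le_succ N)), map_sum,
    Finset.sum_range_succ', Finset.sum_range_succ' (fun k => expCoeff k • x ^ k • D y),
    Finset.sum_range_succ (fun k => expCoeff k • x ^ k • y), h1, smul_zero, add_zero,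
    Finset.smul_sum, add_right_comm, ← Finset.sum_add_distrib]
  congr 1
  · refine Finset.sum_congr rfl fun k _ => ?_
    rw [map_smul, hpow, smul_add, smul_smul (expCoeff (k + 1)), smul_smul r]
    congr 2
    have : (k + 1 : ℂ) ≠ 0 := by exact_mod_cast Nat.succ_ne_zero k
    simp only [expCoeff, Nat.factorial_succ]
    push_cast
    field_simp
  · simp

/-- `1 - exp (-x)` is divisible by `x`. -/
theorem sub_seriesAct_expCoeff_neg {x : S} (hx : LocNil M x) (y : M) :
    y - seriesAct expCoeff (-x) y = x • seriesAct toddInvCoeff x y := by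
  have h : PowerSeries.X * PowerSeries.mk toddInvCoeff =
      1 - PowerSeries.mk (fun k => (-1) ^ k * expCoeff k) := by
    ext k
    cases k with
    | zero => simp [expCoeff]
    | succ k =>
      rw [PowerSeries.coeff_succ_X_mul, map_sub, PowerSeries.coeff_mk, PowerSeries.coeff_mk,
        PowerSeries.coeff_one, if_neg (Nat.succ_ne_zero k)]
      simp only [toddInvCoeff, expCoeff]
      ring
  have h2 := DFunLike.congr_fun (congrArg (seriesEnd (M := M) x hx) h) y
  rw [map_mul, map_sub, map_one, Module.End.mul_apply, seriesEnd_X, LinearMap.sub_apply,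
    Module.End.one_apply, seriesEnd_mk_apply, seriesEnd_mk_apply] at h2
  rw [h2, seriesAct_neg]

end Series

/-! ### Lattices and extracted bases -/

section Lattice

variable {Λ : Type*} [AddCommGroup Λ]

theorem toVec_add (a b : Λ) : toVec (a + b) = toVec a + toVec b := TensorProduct.tmul_add _ _ _

theorem toVec_neg (a : Λ) : toVec (-a) = -toVec a := TensorProduct.tmul_neg _ _

theorem symVec_add (a b : Λ) : symVec (a + b) = symVec a + symVec b := by
  rw [symVec, toVec_add, map_add, symVec, symVec]

theorem symVec_neg (a : Λ) : symVec (-a) = -symVec a := by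
  rw [symVec, toVec_neg, map_neg, symVec]

theorem symVec_zero : symVec (0 : Λ) = 0 := by
  rw [symVec, toVec, TensorProduct.tmul_zero, map_zero]

/-- The `ℂ`-linear extension of an additive map on the lattice. -/
def vecLift {W : Type*} [AddCommGroup W] [Module ℂ W] (l : Λ →+ W) : Vec Λ →ₗ[ℂ] W :=
  LinearMap.liftBaseChange ℂ l.toIntLinearMap

theorem vecLift_toVec {W : Type*} [AddCommGroup W] [Module ℂ W] (l : Λ →+ W) (a : Λ) :
    vecLift l (toVec a) = l a := by
  simp [vecLift, toVec]

theorem span_range_toVec : Submodule.span ℂ (Set.range (toVec : Λ → Vec Λ)) = ⊤ := by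
  rw [eq_top_iff]
  rintro v -
  induction v using TensorProduct.induction_on with
  | zero => exact zero_mem _
  | tmul c a =>
    have : c ⊗ₜ[ℤ] a = c • toVec a := by simp [toVec, TensorProduct.smul_tmul']
    rw [this]
    exact Submodule.smul_mem _ _ (Submodule.subset_span ⟨a, rfl⟩)
  | add v w hv hw => exact add_mem hv hw

theorem toVec_ne_zero [Module.Free ℤ Λ] {a : Λ} (ha : a ≠ 0) : toVec a ≠ 0 := by
  intro h
  refine ha ((Module.forall_dual_apply_eq_zero_iff ℤ a).1 fun f => ?_)
  have := vecLift_toVec ((Int.castAddHom ℂ).comp f.toAddMonoidHom) a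
  rw [h, map_zero] at this
  simpa using this.symm

/-- Integral functionals on the free quotient of `Λ / L` by its torsion extend to `V` and vanish on
a spanning set, hence vanish. So every `a` is torsion modulo `L`. -/
theorem exists_nsmul_mem_closure [Module.Finite ℤ Λ] {s : Set Λ}
    (hs : Submodule.span ℂ (toVec '' s) = ⊤) (a : Λ) :
    ∃ n : ℕ, 0 < n ∧ n • a ∈ AddSubgroup.closure s := by
  let L : Submodule ℤ Λ := Submodule.span ℤ s
  let q : Λ →ₗ[ℤ] ((Λ ⧸ L) ⧸ Submodule.torsion ℤ (Λ ⧸ L)) :=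
    (Submodule.torsion ℤ (Λ ⧸ L)).mkQ ∘ₗ L.mkQ
  have : Module.Free ℤ ((Λ ⧸ L) ⧸ Submodule.torsion ℤ (Λ ⧸ L)) := inferInstance
  have hq : q a = 0 := by
    refine (Module.forall_dual_apply_eq_zero_iff ℤ (q a)).1 fun f => ?_
    let g : Λ →+ ℂ := (Int.castAddHom ℂ).comp (f ∘ₗ q).toAddMonoidHom
    have hg : vecLift g = 0 := by
      refine LinearMap.ext_on hs ?_
      rintro _ ⟨b, hb, rfl⟩
      have hb0 : L.mkQ b = 0 := by
        rw [Submodule.mkQ_apply, Submodule.Quotient.mk_eq_zero]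
        exact Submodule.subset_span hb
      rw [vecLift_toVec]
      simp only [g, q, AddMonoidHom.comp_apply, LinearMap.toAddMonoidHom_coe, LinearMap.comp_apply,
        hb0, map_zero, LinearMap.zero_apply]
    have := vecLift_toVec g a
    rw [hg, LinearMap.zero_apply] at this
    have h2 : ((f (q a) : ℤ) : ℂ) = 0 := this.symm
    exact_mod_cast h2
  have h1 : L.mkQ a ∈ Submodule.torsion ℤ (Λ ⧸ L) := (Submodule.Quotient.mk_eq_zero _).1 hq
  obtain ⟨⟨n, hn⟩, h2⟩ := (Submodule.mem_torsion_iff _).1 h1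
  have h3 : n • a ∈ L := by
    rw [← Submodule.Quotient.mk_eq_zero L]
    exact h2
  have hn0 : n ≠ 0 := nonZeroDivisors.ne_zero hn
  have h4 : n • a ∈ AddSubgroup.closure s := by
    have : L.toAddSubgroup = AddSubgroup.closure s := by
      rw [← Submodule.span_int_eq_addSubgroupClosure]
    rw [← this]
    exact h3
  refine ⟨n.natAbs, Int.natAbs_pos.2 hn0, ?_⟩
  rcases Int.natAbs_eq n with h | h
  · rw [← natCast_zsmul, ← h]
    exact h4
  · rw [← natCast_zsmul, ← neg_neg ((n.natAbs : ℤ)), ← h, neg_smul]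
    exact neg_mem h4

section Primes

variable {V : Type*} [AddCommGroup V] [Module ℂ V] {A : Type*} [CommRing A]
variable {ι : Type*}

/-- The equations in a prime ideal over a cocircuit ideal belong to a spanning set of vectors. -/
theorem span_eq_top_of_cocircuitIdeal_le [Fintype ι] {d : ι → A} {v : ι → V} {n : ℕ} {p : Ideal A}
    [p.IsPrime] (hp : cocircuitIdeal (fun i => d i ^ n) v ≤ p) :
    Submodule.span ℂ (v '' {i | d i ∈ p}) = ⊤ := by
  classical
  by_contra h
  have hY : IsCocircuit v ({i | d i ∉ p} : Finset ι) := by simpa [IsCocircuit] using h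
  have := hp (Ideal.subset_span ⟨_, hY, rfl⟩)
  obtain ⟨i, hi, hip⟩ := (Ideal.IsPrime.prod_mem_iff (p := p)).1 this
  rw [Finset.mem_filter_univ] at hi
  exact hi (Ideal.IsPrime.mem_of_pow_mem inferInstance _ hip)

theorem exists_extractedBasis {v : ι → V} {s : Set ι} (hs : Submodule.span ℂ (v '' s) = ⊤) :
    ∃ b ⊆ s, IsExtractedBasis v b := by
  obtain ⟨b, hbs, -, hb, hb'⟩ := exists_linearIndepOn_extension (K := ℂ) (v := v)
    (s := ∅) (t := s) (linearIndepOn_empty _ _) (Set.empty_subset _)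
  exact ⟨b, hbs, hb', top_le_iff.1 (hs.symm.le.trans (Submodule.span_le.2 hb))⟩

theorem exists_mem_of_isCocircuit {v : ι → V} {b : Set ι} {Y : Finset ι}
    (hb : Submodule.span ℂ (v '' b) = ⊤) (hY : IsCocircuit v Y) : ∃ i ∈ Y, i ∈ b := by
  by_contra! h
  refine hY (top_le_iff.1 (hb.symm.le.trans (Submodule.span_mono (Set.image_mono ?_))))
  exact fun i hi hiY => h i hiY hi

end Primes

/-! ### Nilpotency of the vectors -/

variable {ι : Type*}

/-- The cocircuit ideal of order `n` in `S[V]`. -/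
abbrev linIdeal (X : ι → Λ) (n : ℕ) : Ideal (SymV Λ) :=
  cocircuitIdeal (fun i => linEq X i ^ n) (vecs X)

/-- The cocircuit ideal of order `n` in `ℂ[Λ]`. -/
abbrev torIdeal (X : ι → Λ) (n : ℕ) : Ideal (GrpAlg Λ) :=
  cocircuitIdeal (fun i => torEq X i ^ n) (vecs X)

theorem linIdeal_one (X : ι → Λ) : linIdeal X 1 = IIdeal X := by
  simp [linIdeal, IIdeal]

theorem torIdeal_one (X : ι → Λ) : torIdeal X 1 = JIdeal X := by
  simp [torIdeal, JIdeal]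

/-- A prime over the ideal contains a spanning set of vectors, hence all of `V`. -/
theorem isNilpotent_mk_linIdeal [Fintype ι] {X : ι → Λ} (n : ℕ) (v : Vec Λ) :
    IsNilpotent (Ideal.Quotient.mk (linIdeal X n) (SymmetricAlgebra.ι ℂ _ v)) := by
  rw [nilpotent_iff_mem_prime]
  intro p hp
  set p' := p.comap (Ideal.Quotient.mk (linIdeal X n)) with hp'
  have hle : linIdeal X n ≤ p' := fun x hx => by
    rw [hp', Ideal.mem_comap, Ideal.Quotient.eq_zero_iff_mem.2 hx]
    exact zero_mem _
  have h1 := span_eq_top_of_cocircuitIdeal_le hle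
  have h2 : (⊤ : Submodule ℂ (Vec Λ)) ≤
      (p'.restrictScalars ℂ).comap (SymmetricAlgebra.ι ℂ (Vec Λ)) := by
    rw [← h1, Submodule.span_le]
    rintro _ ⟨i, hi, rfl⟩
    exact hi
  exact h2 (Submodule.mem_top (x := v))

theorem isNilpotent_mk_symVec [Fintype ι] (X : ι → Λ) (n : ℕ) (a : Λ) :
    IsNilpotent (Ideal.Quotient.mk (linIdeal X n) (symVec a)) :=
  isNilpotent_mk_linIdeal n _

/-! ### The exponential homomorphisms -/

theorem eexp_add (a b : Λ) : eexp (a + b) = eexp a * eexp b := by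
  simp [eexp, AddMonoidAlgebra.single_mul_single]

theorem eexp_zero : eexp (0 : Λ) = 1 := rfl

theorem grpAlg_algHom_ext {B : Type*} [Semiring B] [Algebra ℂ B] {F G : GrpAlg Λ →ₐ[ℂ] B}
    (h : ∀ a, F (eexp a) = G (eexp a)) : F = G := by
  apply (AddMonoidAlgebra.lift ℂ _ Λ).symm.injective
  apply MonoidHom.ext
  intro a
  exact h a.toAdd

variable {B : Type*} [CommRing B] [Algebra ℂ B]

/-- `e^a ↦ φ(a) exp(l a)`. -/
def charExp (φ : AddChar Λ ℂ) (l : Λ →+ B) (hl : ∀ a, IsNilpotent (l a)) : GrpAlg Λ →ₐ[ℂ] B :=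
  AddMonoidAlgebra.lift ℂ _ Λ
    { toFun := fun a => φ a.toAdd • nilExp (l a.toAdd)
      map_one' := by simp [nilExp_zero]
      map_mul' := by
        intro a b
        rw [toAdd_mul, map_add l, nilExp_add (hl _) (hl _), AddChar.map_add_eq_mul,
          smul_mul_smul_comm] }

theorem charExp_eexp (φ : AddChar Λ ℂ) (l : Λ →+ B) (hl : ∀ a, IsNilpotent (l a)) (a : Λ) :
    charExp φ l hl (eexp a) = φ a • nilExp (l a) := by
  simp [charExp, eexp]

theorem addChar_ne_zero (φ : AddChar Λ ℂ) (a : Λ) : φ a ≠ 0 := (φ.val_isUnit a).ne_zero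

theorem addChar_neg_eq_one {φ : AddChar Λ ℂ} {a : Λ} : φ (-a) = 1 ↔ φ a = 1 := by
  rw [AddChar.map_neg_eq_inv, inv_eq_one]

theorem charExp_torEq_of_eq_one {φ : AddChar Λ ℂ} {l : Λ →+ B} (hl : ∀ a, IsNilpotent (l a))
    {X : ι → Λ} {i : ι} (hi : φ (X i) = 1) :
    charExp φ l hl (torEq X i) = l (X i) * seriesAct toddInvCoeff (l (X i)) (1 : B) := by
  rw [torEq, map_sub, map_one, charExp_eexp, addChar_neg_eq_one.2 hi, one_smul, map_neg]
  exact sub_seriesAct_expCoeff_neg (locNil_of_isNilpotent (hl _)) (1 : B)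

theorem isUnit_toddInv {x : B} (hx : IsNilpotent x) :
    IsUnit (seriesAct toddInvCoeff x (1 : B)) := by
  rw [seriesAct_one_eq hx]
  simp only [toddInvCoeff, zero_add, pow_zero, Nat.factorial_one, Nat.cast_one, inv_one, mul_one,
    map_one]
  exact ((Commute.all _ _).isNilpotent_mul_right hx).isUnit_one_add

/-- The image is the non-zero constant `1 - φ(-a)` plus a nilpotent. -/
theorem isUnit_charExp_torEq {φ : AddChar Λ ℂ} {l : Λ →+ B} (hl : ∀ a, IsNilpotent (l a))
    {X : ι → Λ} {i : ι} (hi : φ (X i) ≠ 1) : IsUnit (charExp φ l hl (torEq X i)) := by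
  obtain ⟨w, hw⟩ := nilExp_eq (hl (-X i))
  have h1 : charExp φ l hl (torEq X i) = algebraMap ℂ B (1 - φ (-X i)) +
      l (-X i) * (-(φ (-X i) • (1 + l (-X i) * w))) := by
    rw [torEq, map_sub, map_one, charExp_eexp, hw, map_sub, map_one, Algebra.smul_def,
      Algebra.smul_def]
    ring
  rw [h1]
  refine IsNilpotent.isUnit_add_left_of_commute
    ((Commute.all _ _).isNilpotent_mul_right (hl _)) (IsUnit.map _ ?_) (Commute.all _ _)
  rw [isUnit_iff_ne_zero, sub_ne_zero]
  exact fun h => hi (addChar_neg_eq_one.1 h.symm)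

/-- The symmetric algebra modulo a cocircuit ideal, as the target of the exponential at `φ`. -/
def symQuotHom (X : ι → Λ) (n : ℕ) : Λ →+ SymV Λ ⧸ linIdeal X n where
  toFun a := Ideal.Quotient.mk _ (symVec a)
  map_zero' := by rw [symVec_zero, map_zero]
  map_add' a b := by rw [symVec_add, map_add]

theorem isNilpotent_symQuotHom [Fintype ι] (X : ι → Λ) (n : ℕ) (a : Λ) :
    IsNilpotent (symQuotHom X n a) :=
  isNilpotent_mk_symVec X n a

/-- The homomorphism `e^a ↦ φ(a) exp(a)` to the local algebra of order `n` at `φ`. -/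
def topHom [Fintype ι] (X : ι → Λ) (φ : AddChar Λ ℂ) (n : ℕ) :
    GrpAlg Λ →ₐ[ℂ] SymV Λ ⧸ linIdeal (locList X φ) n :=
  charExp φ (symQuotHom (locList X φ) n) (isNilpotent_symQuotHom _ n)

theorem topHom_eexp [Fintype ι] (X : ι → Λ) (φ : AddChar Λ ℂ) (n : ℕ) (a : Λ) :
    topHom X φ n (eexp a) = φ a • nilExp (Ideal.Quotient.mk _ (symVec a)) :=
  charExp_eexp _ _ _ _

/-- A cocircuit of `X` restricts to one of `X_φ`, and for indices in `X_φ` the toric equation maps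
to a multiple of the linear one. -/
theorem topHom_eq_zero [Fintype ι] {X : ι → Λ} {φ : AddChar Λ ℂ} {n : ℕ} {f : GrpAlg Λ}
    (hf : f ∈ torIdeal X n) : topHom X φ n f = 0 := by
  classical
  suffices h : torIdeal X n ≤ RingHom.ker (topHom X φ n) from h hf
  refine Ideal.span_le.2 ?_
  rintro _ ⟨Y, hY, rfl⟩
  rw [SetLike.mem_coe, RingHom.mem_ker, map_prod]
  let Y' : Finset (LocIdx X φ) := Finset.univ.filter fun i => i.1 ∈ Y
  have hY' : IsCocircuit (vecs (locList X φ)) Y' := by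
    refine fun h => hY (top_le_iff.1 (h.symm.le.trans (Submodule.span_mono ?_)))
    rintro _ ⟨i, hi, rfl⟩
    exact ⟨i.1, by simpa [Y'] using hi, rfl⟩
  have h0 : Ideal.Quotient.mk (linIdeal (locList X φ) n)
      (∏ i ∈ Y', linEq (locList X φ) i ^ n) = 0 :=
    Ideal.Quotient.eq_zero_iff_mem.2 (Ideal.subset_span ⟨Y', hY', rfl⟩)
  rw [← zero_dvd_iff, ← h0, map_prod]
  have h1 : ∏ i ∈ Y', Ideal.Quotient.mk (linIdeal (locList X φ) n) (linEq (locList X φ) i ^ n) ∣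
      ∏ i ∈ Y', topHom X φ n (torEq X i.1 ^ n) := by
    refine Finset.prod_dvd_prod_of_dvd _ _ fun i _ => ?_
    rw [map_pow, map_pow]
    refine pow_dvd_pow_of_dvd ?_ n
    rw [topHom, charExp_torEq_of_eq_one _ i.2]
    exact Dvd.intro _ rfl
  refine h1.trans ?_
  have h2 : ∏ i ∈ Y', topHom X φ n (torEq X i.1 ^ n) =
      ∏ i ∈ Y'.map (Function.Embedding.subtype _), topHom X φ n (torEq X i ^ n) := by
    rw [Finset.prod_map]
    rfl
  rw [h2]
  refine Finset.prod_dvd_prod_of_subset _ _ _ fun i hi => ?_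
  obtain ⟨k, hk, rfl⟩ := Finset.mem_map.1 hi
  simpa [Y'] using hk

theorem adjoin_symVec : Algebra.adjoin ℂ (Set.range (symVec : Λ → SymV Λ)) = ⊤ := by
  rw [eq_top_iff]
  rintro x -
  induction x using SymmetricAlgebra.induction with
  | algebraMap r => exact Subalgebra.algebraMap_mem _ r
  | ι v =>
    have h : (⊤ : Submodule ℂ (Vec Λ)) ≤ (Subalgebra.toSubmodule (Algebra.adjoin ℂ
        (Set.range (symVec : Λ → SymV Λ)))).comap (SymmetricAlgebra.ι ℂ (Vec Λ)) := by
      rw [← span_range_toVec, Submodule.span_le]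
      rintro _ ⟨a, rfl⟩
      exact Algebra.subset_adjoin ⟨a, rfl⟩
    exact h (Submodule.mem_top (x := v))
  | mul x y hx hy => exact mul_mem hx hy
  | add x y hx hy => exact add_mem hx hy

/-- The range is a subalgebra containing `exp(a)`. The logarithm can be taken inside the range, and
by injectivity of the exponential it is `a`. -/
theorem topHom_surjective [Fintype ι] (X : ι → Λ) (φ : AddChar Λ ℂ) (n : ℕ) :
    Function.Surjective (topHom X φ n) := by
  have hmem : ∀ a : Λ, Ideal.Quotient.mk (linIdeal (locList X φ) n) (symVec a) ∈
      (topHom X φ n).range := by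
    intro a
    set x := Ideal.Quotient.mk (linIdeal (locList X φ) n) (symVec a) with hx
    have hxn : IsNilpotent x := isNilpotent_mk_symVec _ n a
    have h1 : nilExp x ∈ (topHom X φ n).range := by
      refine ⟨(φ a)⁻¹ • eexp a, ?_⟩
      change topHom X φ n _ = _
      rw [map_smul, topHom_eexp, inv_smul_smul₀ (addChar_ne_zero φ a)]
    have h2 : IsNilpotent (nilExp x - 1) := by
      obtain ⟨w, hw⟩ := nilExp_eq hxn
      have : nilExp x - 1 = x * (1 + x * w) := by rw [hw]; ring
      rw [this]
      exact (Commute.all _ _).isNilpotent_mul_right hxn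
    let e : (topHom X φ n).range := ⟨nilExp x - 1, sub_mem h1 (one_mem _)⟩
    have he : IsNilpotent e := by
      obtain ⟨k, hk⟩ := h2
      exact ⟨k, Subtype.ext hk⟩
    obtain ⟨l, hl, hle⟩ := exists_nilExp_eq he
    have h3 : nilExp (l : SymV Λ ⧸ linIdeal (locList X φ) n) = nilExp x := by
      have := map_nilExp (topHom X φ n).range.val hl
      rw [hle] at this
      rw [Subalgebra.coe_val] at this
      rw [← this]
      change (1 : SymV Λ ⧸ linIdeal (locList X φ) n) + (nilExp x - 1) = nilExp x
      ring
    have h4 : IsNilpotent (l : SymV Λ ⧸ linIdeal (locList X φ) n) :=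
      hl.map (topHom X φ n).range.val
    rw [← nilExp_injective h4 hxn h3]
    exact l.2
  intro y
  obtain ⟨g, rfl⟩ := Ideal.Quotient.mk_surjective y
  have : Algebra.adjoin ℂ (Set.range (symVec : Λ → SymV Λ)) ≤
      (topHom X φ n).range.comap (Ideal.Quotient.mkₐ ℂ (linIdeal (locList X φ) n)) := by
    refine Algebra.adjoin_le ?_
    rintro _ ⟨a, rfl⟩
    exact hmem a
  rw [adjoin_symVec] at this
  exact this (Algebra.mem_top (x := g))

end Lattice

/-! ### The points of the arrangement -/

section Points

variable {Λ : Type*} [AddCommGroup Λ] {ι : Type*}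

/-- Evaluation at a character. -/
def evChar (φ : AddChar Λ ℂ) : GrpAlg Λ →ₐ[ℂ] ℂ := AddMonoidAlgebra.lift ℂ _ Λ φ.toMonoidHom

theorem evChar_eexp (φ : AddChar Λ ℂ) (a : Λ) : evChar φ (eexp a) = φ a := by
  rw [evChar, eexp, AddMonoidAlgebra.lift_single, one_smul]
  rfl

theorem evChar_torEq (φ : AddChar Λ ℂ) (X : ι → Λ) (i : ι) :
    evChar φ (torEq X i) = 0 ↔ φ (X i) = 1 := by
  rw [torEq, map_sub, map_one, evChar_eexp, sub_eq_zero, eq_comm, addChar_neg_eq_one]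

instance ker_evChar_isMaximal (φ : AddChar Λ ℂ) : (RingHom.ker (evChar φ)).IsMaximal :=
  RingHom.ker_isMaximal_of_surjective _ fun c => ⟨algebraMap ℂ _ c, (evChar φ).commutes c⟩

theorem ker_evChar_injective :
    Function.Injective fun φ : AddChar Λ ℂ => RingHom.ker (evChar φ) := by
  intro φ ψ h
  ext a
  have h1 : eexp a - algebraMap ℂ (GrpAlg Λ) (φ a) ∈ RingHom.ker (evChar φ) := by
    rw [RingHom.mem_ker, map_sub, evChar_eexp, AlgHom.commutes]
    simp
  simp only at h
  rw [h, RingHom.mem_ker, map_sub, evChar_eexp, AlgHom.commutes, sub_eq_zero] at h1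
  exact h1.symm

theorem exists_eq_evChar (χ : GrpAlg Λ →ₐ[ℂ] ℂ) : ∃ φ : AddChar Λ ℂ, χ = evChar φ := by
  let φ : AddChar Λ ℂ :=
    { toFun := fun a => χ (eexp a)
      map_zero_eq_one' := by rw [eexp_zero, map_one]
      map_add_eq_mul' := fun a b => by rw [eexp_add, map_mul] }
  exact ⟨φ, grpAlg_algHom_ext fun a => (evChar_eexp φ a).symm⟩

theorem torIdeal_le_ker_evChar {X : ι → Λ} {φ : AddChar Λ ℂ} (hφ : φ ∈ arrPoints X) :
    torIdeal X 1 ≤ RingHom.ker (evChar φ) := by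
  obtain ⟨b, hb, hbφ⟩ := hφ
  refine Ideal.span_le.2 ?_
  rintro _ ⟨Y, hY, rfl⟩
  obtain ⟨i, hiY, hib⟩ := exists_mem_of_isCocircuit hb.2 hY
  refine Ideal.mem_of_dvd _ (Finset.dvd_prod_of_mem _ hiY) ?_
  rw [pow_one, RingHom.mem_ker, evChar_torEq]
  exact hbφ i hib

variable [Fintype ι]

/-- Modulo `p` we have `e^{X i} = 1` for a spanning set of indices, and each `a` has a positive
multiple in the lattice they generate. So `e^a` is a root of unity, the quotient is integral over
`ℂ`, and it equals `ℂ`. -/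
theorem exists_eq_ker_evChar [Module.Finite ℤ Λ] {X : ι → Λ} {n : ℕ} {p : Ideal (GrpAlg Λ)}
    [p.IsPrime] (hp : torIdeal X n ≤ p) : ∃ φ ∈ arrPoints X, p = RingHom.ker (evChar φ) := by
  have hs := span_eq_top_of_cocircuitIdeal_le hp
  have hs' : Submodule.span ℂ (toVec '' (X '' {i | torEq X i ∈ p})) = ⊤ := by
    rw [Set.image_image]
    exact hs
  let N : AddSubgroup Λ :=
    { carrier := {a | eexp a - 1 ∈ p}
      zero_mem' := by simp [eexp_zero]
      add_mem' := by
        intro a b ha hb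
        have : eexp (a + b) - 1 = eexp a * (eexp b - 1) + (eexp a - 1) := by
          rw [eexp_add]
          ring
        change _ ∈ p
        rw [this]
        exact add_mem (Ideal.mul_mem_left _ _ hb) ha
      neg_mem' := by
        intro a ha
        have : eexp (-a) - 1 = -eexp (-a) * (eexp a - 1) := by
          rw [mul_sub, neg_mul, ← eexp_add, neg_add_cancel, eexp_zero]
          ring
        change _ ∈ p
        rw [this]
        exact Ideal.mul_mem_left _ _ ha }
  have hN : AddSubgroup.closure (X '' {i | torEq X i ∈ p}) ≤ N := by
    rw [AddSubgroup.closure_le]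
    rintro _ ⟨i, hi, rfl⟩
    rw [SetLike.mem_coe, ← neg_mem_iff]
    change _ ∈ p
    have : eexp (-X i) - 1 = -torEq X i := by rw [torEq]; ring
    rw [this]
    exact neg_mem hi
  have hint : ∀ a : Λ, IsIntegral ℂ (Ideal.Quotient.mk p (eexp a)) := by
    intro a
    obtain ⟨k, hk, hka⟩ := exists_nsmul_mem_closure hs' a
    refine IsIntegral.of_pow hk ?_
    have h1 : eexp (k • a) = eexp a ^ k := by
      simp [eexp, AddMonoidAlgebra.single_pow]
    have h2 : Ideal.Quotient.mk p (eexp (k • a)) = 1 := by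
      rw [← map_one (Ideal.Quotient.mk p), Ideal.Quotient.eq]
      exact hN hka
    rw [← map_pow, ← h1, h2]
    exact isIntegral_one
  have : Algebra.IsIntegral ℂ (GrpAlg Λ ⧸ p) := by
    refine ⟨fun y => ?_⟩
    obtain ⟨f, rfl⟩ := Ideal.Quotient.mk_surjective y
    induction f using AddMonoidAlgebra.induction_linear with
    | zero => rw [map_zero]; exact isIntegral_zero
    | add f g hf hg => rw [map_add]; exact hf.add hg
    | single a c =>
      have : (AddMonoidAlgebra.single a c : GrpAlg Λ) = c • eexp a := by simp [eexp]
      rw [this]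
      exact (hint a).smul c
  have hbij : Function.Bijective (Algebra.ofId ℂ (GrpAlg Λ ⧸ p)) :=
    IsAlgClosed.algebraMap_bijective_of_isIntegral
  let e : ℂ ≃ₐ[ℂ] GrpAlg Λ ⧸ p := AlgEquiv.ofBijective _ hbij
  obtain ⟨φ, hφ⟩ := exists_eq_evChar ((e.symm : (GrpAlg Λ ⧸ p) →ₐ[ℂ] ℂ).comp
    (Ideal.Quotient.mkₐ ℂ p))
  have hker : p = RingHom.ker (evChar φ) := by
    ext x
    rw [← hφ, RingHom.mem_ker, AlgHom.comp_apply, AlgEquiv.coe_toAlgHom,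
      EmbeddingLike.map_eq_zero_iff, Ideal.Quotient.mkₐ_eq_mk, Ideal.Quotient.eq_zero_iff_mem]
  refine ⟨φ, ?_, hker⟩
  obtain ⟨b, hb, hb'⟩ := exists_extractedBasis hs
  refine ⟨b, hb', fun i hi => ?_⟩
  have h1 : torEq X i ∈ p := hb hi
  rw [hker, RingHom.mem_ker, evChar_torEq] at h1
  exact h1

/-- All primes over the cocircuit ideal are maximal, so the points give distinct minimal primes,
finite in number in a noetherian ring. -/
theorem arrPoints_finite [Module.Finite ℤ Λ] (X : ι → Λ) : (arrPoints X).Finite := by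
  have : AddMonoid.FG Λ := AddGroup.fg_iff_addMonoid_fg.1 (Module.Finite.iff_addGroup_fg.1 ‹_›)
  have : IsNoetherianRing (GrpAlg Λ) := Algebra.FiniteType.isNoetherianRing ℂ _
  refine Set.Finite.of_finite_image (f := fun φ => RingHom.ker (evChar φ))
    (((torIdeal X 1).finite_minimalPrimes_of_isNoetherianRing _).subset ?_)
    ker_evChar_injective.injOn
  rintro _ ⟨φ, hφ, rfl⟩
  refine ⟨⟨inferInstance, torIdeal_le_ker_evChar hφ⟩, ?_⟩
  rintro q ⟨hq, hq'⟩ hle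
  obtain ⟨ψ, -, rfl⟩ := exists_eq_ker_evChar hq'
  exact ((ker_evChar_isMaximal ψ).eq_of_le (Ideal.IsPrime.ne_top inferInstance) hle).ge

/-! ### The decomposition of `ℂ[Λ]` modulo a cocircuit ideal -/

/-- A homomorphism from `ℂ[Λ]` that is unipotent at `φ` and kills the cocircuit ideal factors
through the local algebra at `φ`. -/
theorem exists_comp_topHom_eq {B : Type*} [CommRing B] [Algebra ℂ B] {X : ι → Λ} {n : ℕ}
    {φ : AddChar Λ ℂ} (m : GrpAlg Λ →ₐ[ℂ] B) (hm : ∀ f ∈ torIdeal X n, m f = 0)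
    (hnil : ∀ a, IsNilpotent ((φ a)⁻¹ • m (eexp a) - 1)) :
    ∃ G : (SymV Λ ⧸ linIdeal (locList X φ) n) →ₐ[ℂ] B, G.comp (topHom X φ n) = m := by
  classical
  have hlog : ∀ a, ∃ l : B, IsNilpotent l ∧ nilExp l = (φ a)⁻¹ • m (eexp a) := by
    intro a
    obtain ⟨l, hl, h⟩ := exists_nilExp_eq (hnil a)
    exact ⟨l, hl, by rw [h, add_sub_cancel]⟩
  choose l₀ hl₀ hexp using hlog
  -- The chosen logarithms are additive because the exponential is injective on nilpotents.
  let l : Λ →+ B := AddMonoidHom.mk' l₀ fun a b => by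
    refine nilExp_injective (hl₀ _) ((Commute.all _ _).isNilpotent_add (hl₀ a) (hl₀ b)) ?_
    rw [nilExp_add (hl₀ a) (hl₀ b), hexp, hexp, hexp, eexp_add, map_mul, AddChar.map_add_eq_mul,
      mul_inv, smul_mul_smul_comm]
  have hl : ∀ a, IsNilpotent (l a) := hl₀
  have hml : charExp φ l hl = m := by
    refine grpAlg_algHom_ext fun a => ?_
    rw [charExp_eexp]
    change φ a • nilExp (l₀ a) = _
    rw [hexp, smul_inv_smul₀ (addChar_ne_zero φ a)]
  let G₀ : SymV Λ →ₐ[ℂ] B := SymmetricAlgebra.lift (vecLift l)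
  have hG₀ : ∀ a, G₀ (symVec a) = l a := by
    intro a
    rw [symVec, SymmetricAlgebra.lift_ι_apply, vecLift_toVec]
  have hker : ∀ g ∈ linIdeal (locList X φ) n, G₀ g = 0 := by
    suffices h : linIdeal (locList X φ) n ≤ RingHom.ker G₀ from fun g hg => h hg
    refine Ideal.span_le.2 ?_
    rintro _ ⟨Y, hY, rfl⟩
    rw [SetLike.mem_coe, RingHom.mem_ker, map_prod]
    let Y₁ : Finset ι := Y.map (Function.Embedding.subtype _)
    let Y₂ : Finset ι := Finset.univ.filter fun i => φ (X i) ≠ 1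
    have hdisj : Disjoint Y₁ Y₂ := by
      rw [Finset.disjoint_left]
      intro i hi
      obtain ⟨k, -, rfl⟩ := Finset.mem_map.1 hi
      simpa [Y₂] using k.2
    -- A cocircuit of `X_φ` becomes one of `X` after adding all indices outside `X_φ`; their factors
    -- are units at `φ` and are then discarded.
    have hY' : IsCocircuit (vecs X) (Y₁ ∪ Y₂) := by
      refine fun h => hY (top_le_iff.1 (h.symm.le.trans (Submodule.span_mono ?_)))
      rintro _ ⟨i, hi, rfl⟩
      have hi' : i ∉ Y₁ ∧ i ∉ Y₂ := by simpa using hi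
      have hφi : φ (X i) = 1 := by simpa [Y₂] using hi'.2
      refine ⟨⟨i, hφi⟩, fun h => hi'.1 ?_, rfl⟩
      exact Finset.mem_map.2 ⟨_, h, rfl⟩
    have h0 := hm _ (Ideal.subset_span ⟨_, hY', rfl⟩)
    rw [map_prod, Finset.prod_union hdisj, Finset.prod_map] at h0
    have hu2 : IsUnit (∏ i ∈ Y₂, m (torEq X i ^ n)) := by
      refine IsUnit.prod_iff.2 fun i hi => ?_
      rw [map_pow, ← hml]
      exact (isUnit_charExp_torEq hl (by simpa [Y₂] using hi)).pow n
    rw [hu2.mul_left_eq_zero] at h0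
    have h1 : ∏ i ∈ Y, m (torEq X i.1 ^ n) = (∏ i ∈ Y, G₀ (linEq (locList X φ) i ^ n)) *
        ∏ i ∈ Y, seriesAct toddInvCoeff (l (X i.1)) (1 : B) ^ n := by
      rw [← Finset.prod_mul_distrib]
      refine Finset.prod_congr rfl fun i _ => ?_
      rw [map_pow, map_pow, ← mul_pow, ← hml, charExp_torEq_of_eq_one hl i.2]
      congr 2
      exact (hG₀ _).symm
    have h2 : (∏ i ∈ Y, m (torEq X i.1 ^ n)) = 0 := h0
    rw [h1] at h2
    exact (IsUnit.mul_left_eq_zero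
      (IsUnit.prod_iff.2 fun i _ => (isUnit_toddInv (hl _)).pow n)).1 h2
  refine ⟨Ideal.Quotient.liftₐ _ G₀ hker, grpAlg_algHom_ext fun a => ?_⟩
  rw [AlgHom.comp_apply, topHom_eexp, map_smul, map_nilExp _ (isNilpotent_mk_symVec _ n a),
    ← hml, charExp_eexp, ← hG₀]
  rfl

/-- The hypothesis `hu` says that `B` is local over `φ`: every prime of `B` contracts to the kernel
of evaluation at `φ`. So elements vanishing at `φ` become nilpotent and `exists_comp_topHom_eq`
applies. -/
theorem map_eq_zero_of_topHom_eq_zero [Module.Finite ℤ Λ] {B : Type*} [CommRing B] [Algebra ℂ B]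
    {X : ι → Λ} {n : ℕ} {φ : AddChar Λ ℂ} (m : GrpAlg Λ →ₐ[ℂ] B)
    (hm : ∀ f ∈ torIdeal X n, m f = 0) (hu : ∀ f, evChar φ f ≠ 0 → IsUnit (m f)) {f : GrpAlg Λ}
    (hf : topHom X φ n f = 0) : m f = 0 := by
  have hmnil : ∀ x, evChar φ x = 0 → IsNilpotent (m x) := by
    intro x hx
    rw [nilpotent_iff_mem_prime]
    intro q hq
    have h1 : torIdeal X n ≤ q.comap m := fun y hy => by
      rw [Ideal.mem_comap, hm y hy]
      exact zero_mem _
    have h2 : q.comap m ≤ RingHom.ker (evChar φ) := by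
      intro y hy
      by_contra hyp
      exact hq.ne_top (Ideal.eq_top_of_isUnit_mem _ hy (hu y hyp))
    have hq' : (q.comap m).IsPrime := Ideal.IsPrime.comap m
    obtain ⟨ψ, -, hψ⟩ := exists_eq_ker_evChar h1
    have h3 : (q.comap m).IsMaximal := by
      rw [hψ]
      infer_instance
    have h4 : x ∈ q.comap m := by
      rw [h3.eq_of_le (Ideal.IsPrime.ne_top inferInstance) h2]
      exact hx
    exact h4
  obtain ⟨G, hG⟩ := exists_comp_topHom_eq (φ := φ) m hm fun a => by
    have h1 : (φ a)⁻¹ • m (eexp a) - 1 = m ((φ a)⁻¹ • eexp a - 1) := by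
      rw [map_sub, map_smul, map_one]
    rw [h1]
    refine hmnil _ ?_
    rw [map_sub, map_smul, evChar_eexp, map_one, smul_eq_mul,
      inv_mul_cancel₀ (addChar_ne_zero φ a), sub_self]
  rw [← hG, AlgHom.comp_apply, hf, map_zero]

/-- Membership in an ideal is local. If it failed, the ideal of multipliers `K` would lie in a
maximal ideal, which is a point `φ`; localizing there contradicts the vanishing of the component at
`φ`. -/
theorem mem_torIdeal_of_topHom_eq_zero [Module.Finite ℤ Λ] {X : ι → Λ} {n : ℕ} {f : GrpAlg Λ}
    (hf : ∀ φ ∈ arrPoints X, topHom X φ n f = 0) : f ∈ torIdeal X n := by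
  by_contra hfJ
  let K : Ideal (GrpAlg Λ) :=
    Submodule.comap (LinearMap.mulRight (GrpAlg Λ) f) (torIdeal X n)
  have hK : ∀ g, g ∈ K ↔ g * f ∈ torIdeal X n := fun g => Iff.rfl
  have hKtop : K ≠ ⊤ := by
    rw [Ideal.ne_top_iff_one, hK, one_mul]
    exact hfJ
  obtain ⟨p, hp, hKp⟩ := Ideal.exists_le_maximal K hKtop
  have hJp : torIdeal X n ≤ p := fun x hx => hKp ((hK x).2 (Ideal.mul_mem_right _ _ hx))
  obtain ⟨φ, hφ, hpφ⟩ := exists_eq_ker_evChar hJp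
  let L := Localization.AtPrime p
  let JL : Ideal L := (torIdeal X n).map (algebraMap (GrpAlg Λ) L)
  let m : GrpAlg Λ →ₐ[ℂ] L ⧸ JL :=
    (Ideal.Quotient.mkₐ ℂ JL).comp (IsScalarTower.toAlgHom ℂ (GrpAlg Λ) L)
  have hm : ∀ x, m x = Ideal.Quotient.mk JL (algebraMap (GrpAlg Λ) L x) := fun x => rfl
  have hmf : m f = 0 := by
    refine map_eq_zero_of_topHom_eq_zero (B := L ⧸ JL) (X := X) (n := n) m (fun x hx => ?_)
      (fun y hy => ?_) (hf φ hφ)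
    · exact Ideal.Quotient.eq_zero_iff_mem.2 (Ideal.mem_map_of_mem _ hx)
    · have hy' : y ∉ p := by
        rw [hpφ]
        exact hy
      exact (IsLocalization.map_units L (⟨y, hy'⟩ : p.primeCompl)).map (Ideal.Quotient.mk JL)
  rw [hm, Ideal.Quotient.eq_zero_iff_mem, IsLocalization.mem_map_algebraMap_iff p.primeCompl] at hmf
  obtain ⟨⟨⟨y, hy⟩, s⟩, hs⟩ := hmf
  simp only at hs
  rw [← map_mul] at hs
  obtain ⟨t, ht⟩ := (IsLocalization.eq_iff_exists p.primeCompl L).1 hs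
  have h5 : (t * s : GrpAlg Λ) ∈ p := by
    refine hKp ((hK _).2 ?_)
    have : (t * s : GrpAlg Λ) * f = t * y := by rw [← ht]; ring
    rw [this]
    exact Ideal.mul_mem_left _ _ hy
  exact (t * s).2 h5

/-- The kernel at `φ` contains a power of `e^a - φ(a)`. Two points differ at some `a`, so their
kernels are coprime. -/
theorem exists_topHom_eq [Module.Finite ℤ Λ] (X : ι → Λ) (n : ℕ)
    (y : ∀ φ : arrPoints X, SymV Λ ⧸ linIdeal (locList X φ) n) :
    ∃ f : GrpAlg Λ, ∀ φ : arrPoints X, topHom X φ n f = y φ := by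
  have : Finite (arrPoints X) := (arrPoints_finite X).to_subtype
  choose g hg using fun φ : arrPoints X => topHom_surjective X φ.1 n (y φ)
  have hcop : Pairwise (Function.onFun IsCoprime
      fun φ : arrPoints X => RingHom.ker (topHom X φ.1 n)) := by
    intro φ ψ hne
    obtain ⟨a, ha⟩ : ∃ a, φ.1 a ≠ ψ.1 a := by
      by_contra! h
      exact hne (Subtype.ext (DFunLike.ext _ _ h))
    have hpow : ∀ χ : AddChar Λ ℂ, ∃ k : ℕ,
        (eexp a - algebraMap ℂ (GrpAlg Λ) (χ a)) ^ k ∈ RingHom.ker (topHom X χ n) := by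
      intro χ
      have hx := isNilpotent_mk_symVec (locList X χ) n a
      obtain ⟨w, hw⟩ := nilExp_eq hx
      have h1 : IsNilpotent (topHom X χ n (eexp a - algebraMap ℂ (GrpAlg Λ) (χ a))) := by
        have h2 : topHom X χ n (eexp a - algebraMap ℂ (GrpAlg Λ) (χ a)) =
            Ideal.Quotient.mk _ (symVec a) *
              (χ a • (1 + Ideal.Quotient.mk _ (symVec a) * w)) := by
          rw [map_sub, topHom_eexp, AlgHom.commutes, hw, Algebra.smul_def, Algebra.smul_def]
          ring
        rw [h2]
        exact (Commute.all _ _).isNilpotent_mul_right hx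
      obtain ⟨k, hk⟩ := h1
      exact ⟨k, by rw [RingHom.mem_ker, map_pow, hk]⟩
    obtain ⟨k, hk⟩ := hpow φ
    obtain ⟨k', hk'⟩ := hpow ψ
    have hc : IsCoprime (eexp a - algebraMap ℂ (GrpAlg Λ) (φ.1 a))
        (eexp a - algebraMap ℂ (GrpAlg Λ) (ψ.1 a)) := by
      refine ⟨algebraMap ℂ _ (ψ.1 a - φ.1 a)⁻¹, -algebraMap ℂ _ (ψ.1 a - φ.1 a)⁻¹, ?_⟩
      have h0 : ψ.1 a - φ.1 a ≠ 0 := sub_ne_zero.2 ha.symm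
      have h1 : algebraMap ℂ (GrpAlg Λ) (ψ.1 a - φ.1 a)⁻¹ *
          (algebraMap ℂ (GrpAlg Λ) (ψ.1 a) - algebraMap ℂ (GrpAlg Λ) (φ.1 a)) = 1 := by
        rw [← map_sub, ← map_mul, inv_mul_cancel₀ h0, map_one]
      linear_combination h1
    obtain ⟨u, v, huv⟩ := hc.pow (m := k) (n := k')
    exact Ideal.isCoprime_iff_exists.2
      ⟨_, Ideal.mul_mem_left _ u hk, _, Ideal.mul_mem_left _ v hk', huv⟩
  obtain ⟨f, hf⟩ := Ideal.exists_forall_sub_mem_ideal hcop g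
  refine ⟨f, fun φ => ?_⟩
  have := hf φ
  rw [RingHom.mem_ker, map_sub, sub_eq_zero] at this
  rw [this, hg]

end Points

/-! ### The exponential operators on a locally nilpotent module -/

section Operators

variable {Λ : Type*} [AddCommGroup Λ] {ι : Type*}
variable (M : Type*) [AddCommGroup M] [Module (SymV Λ) M] [Module ℂ M] [IsScalarTower ℂ (SymV Λ) M]

variable (Λ) in
/-- The central `S[V]`-linear operators on `M`; they contain the power series in the vectors. -/
def Cen : Type _ := Subalgebra.center ℂ (Module.End (SymV Λ) M)

instance instCommRingCen : CommRing (Cen Λ M) :=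
  inferInstanceAs (CommRing (Subalgebra.center ℂ (Module.End (SymV Λ) M)))

instance instAlgebraCen : Algebra ℂ (Cen Λ M) :=
  inferInstanceAs (Algebra ℂ (Subalgebra.center ℂ (Module.End (SymV Λ) M)))

instance instModuleCen : Module (Cen Λ M) M :=
  inferInstanceAs (Module (Subalgebra.center ℂ (Module.End (SymV Λ) M)) M)

instance instIsScalarTowerCen : IsScalarTower ℂ (Cen Λ M) M :=
  inferInstanceAs (IsScalarTower ℂ (Subalgebra.center ℂ (Module.End (SymV Λ) M)) M)

variable {M}

/-- A central operator as an `S[V]`-linear map. -/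
def Cen.toEnd (c : Cen Λ M) : Module.End (SymV Λ) M := c.1

theorem cen_smul_comm (c : Cen Λ M) (s : SymV Λ) (y : M) : c • s • y = s • c • y :=
  map_smul c.toEnd s y

theorem cen_apply_comm (c : Cen Λ M) (T : Module.End (SymV Λ) M) (y : M) :
    c • T y = T (c • y) :=
  (DFunLike.congr_fun (Subalgebra.mem_center_iff.1 c.2 T) y).symm

theorem cen_smul_complex (c : Cen Λ M) (r : ℂ) (y : M) : c • r • y = r • c • y :=
  LinearMap.map_smul_of_tower c.toEnd r y

variable (M) in
/-- Multiplication by an element of `S[V]`. -/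
def mulC : SymV Λ →+* Cen Λ M where
  toFun s := ⟨algebraMap _ _ s, Subalgebra.mem_center_iff.2 fun b => (Algebra.commutes s b).symm⟩
  map_one' := Subtype.ext (map_one _)
  map_mul' _ _ := Subtype.ext (map_mul _ _ _)
  map_zero' := Subtype.ext (map_zero _)
  map_add' _ _ := Subtype.ext (map_add _ _ _)

theorem mulC_smul (s : SymV Λ) (y : M) : mulC M s • y = s • y := rfl

theorem cen_ext {c c' : Cen Λ M} (h : ∀ y : M, c • y = c' • y) : c = c' :=
  Subtype.ext (LinearMap.ext h)

/-- Power series in a locally nilpotent element, as central operators. -/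
def seriesC (x : SymV Λ) (hx : LocNil M x) : PowerSeries ℂ →ₐ[ℂ] Cen Λ M :=
  AlgHom.codRestrict (seriesEnd x hx) (Subalgebra.center ℂ (Module.End (SymV Λ) M)) fun c =>
    Subalgebra.mem_center_iff.2 fun T => (seriesOp_comm x hx c T).symm

theorem seriesC_mk_smul (x : SymV Λ) (hx : LocNil M x) (c : ℕ → ℂ) (y : M) :
    seriesC x hx (PowerSeries.mk c) • y = seriesAct c x y :=
  seriesEnd_mk_apply x hx c y

theorem isUnit_seriesC (x : SymV Λ) (hx : LocNil M x) {c : PowerSeries ℂ}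
    (hc : PowerSeries.constantCoeff c ≠ 0) : IsUnit (seriesC x hx c) :=
  (PowerSeries.isUnit_iff_constantCoeff.2 (isUnit_iff_ne_zero.2 hc)).map _

variable (hM : ∀ a : Λ, LocNil M (symVec a))

/-- The operator `exp(a)`. -/
def expC (a : Λ) : Cen Λ M := seriesC (symVec a) (hM a) (PowerSeries.mk expCoeff)

theorem expC_smul (a : Λ) (y : M) : expC hM a • y = seriesAct expCoeff (symVec a) y :=
  seriesC_mk_smul _ _ _ _

theorem expC_add (a b : Λ) : expC hM (a + b) = expC hM a * expC hM b := by
  refine cen_ext fun y => ?_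
  rw [mul_smul, expC_smul, expC_smul, expC_smul, symVec_add]
  exact seriesAct_expCoeff_add (hM a y) (hM b y)

theorem expC_zero : expC hM (0 : Λ) = 1 := by
  refine cen_ext fun y => ?_
  rw [expC_smul, seriesAct_of_smul_eq_zero _ (by rw [symVec_zero, zero_smul])]
  simp [expCoeff]

/-- The action of `ℂ[Λ]` in which `e^a` is `φ(a) exp(a)`. -/
def torC (φ : AddChar Λ ℂ) : GrpAlg Λ →ₐ[ℂ] Cen Λ M :=
  AddMonoidAlgebra.lift ℂ _ Λ
    { toFun := fun a => φ a.toAdd • expC hM a.toAdd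
      map_one' := by
        rw [toAdd_one, expC_zero, AddChar.map_zero_eq_one, one_smul]
      map_mul' := by
        intro a b
        rw [toAdd_mul, expC_add, AddChar.map_add_eq_mul, smul_mul_smul_comm] }

theorem torC_eexp (φ : AddChar Λ ℂ) (a : Λ) : torC hM φ (eexp a) = φ a • expC hM a := by
  rw [torC, eexp, AddMonoidAlgebra.lift_single, one_smul]
  rfl

theorem torC_eexp_smul (φ : AddChar Λ ℂ) (a : Λ) (y : M) :
    torC hM φ (eexp a) • y = φ a • seriesAct expCoeff (symVec a) y := by
  rw [torC_eexp, smul_assoc, expC_smul]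

/-- Induction over `ℂ[Λ]` for additive statements. -/
theorem grpAlg_induction {P : GrpAlg Λ → Prop} (f : GrpAlg Λ) (h0 : P 0)
    (hadd : ∀ f g, P f → P g → P (f + g)) (hsmul : ∀ (c : ℂ) (f), P f → P (c • f))
    (hexp : ∀ a, P (eexp a)) : P f := by
  induction f using AddMonoidAlgebra.induction_linear with
  | zero => exact h0
  | add f g hf hg => exact hadd f g hf hg
  | single a c =>
    have : (AddMonoidAlgebra.single a c : GrpAlg Λ) = c • eexp a := by simp [eexp]
    rw [this]
    exact hsmul c _ (hexp a)

/-- On a vector killed by `V`, the action is evaluation at `φ`. -/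
theorem torC_smul_of_killed (φ : AddChar Λ ℂ) {y : M} (hy : ∀ a : Λ, symVec a • y = 0)
    (f : GrpAlg Λ) : torC hM φ f • y = evChar φ f • y := by
  induction f using grpAlg_induction with
  | h0 => rw [map_zero, map_zero, zero_smul, zero_smul]
  | hadd f g hf hg => rw [map_add, map_add, add_smul, add_smul, hf, hg]
  | hsmul c f hf => rw [map_smul, map_smul, smul_assoc, smul_assoc, hf]
  | hexp a =>
    rw [torC_eexp_smul, evChar_eexp, seriesAct_of_smul_eq_zero _ (hy a)]
    simp [expCoeff]

open scoped Classical in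
/-- The factor `(1 - exp(-a)) / a` or `1 - φ(-a) exp(-a)`, as an operator. -/
def toddFactor (X : ι → Λ) (φ : AddChar Λ ℂ) (i : ι) : Cen Λ M :=
  if φ (X i) = 1 then seriesC (symVec (X i)) (hM _) (PowerSeries.mk toddInvCoeff)
    else torC hM φ (torEq X i)

open scoped Classical in
/-- The equation `a` if `φ(a) = 1`, and `1` otherwise. -/
def linFactor (X : ι → Λ) (φ : AddChar Λ ℂ) (i : ι) : SymV Λ :=
  if φ (X i) = 1 then symVec (X i) else 1

/-- This factorization, linear equation times invertible operator, is what makes toric fractions act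
as linear ones. -/
theorem torC_torEq (X : ι → Λ) (φ : AddChar Λ ℂ) (i : ι) :
    torC hM φ (torEq X i) = mulC M (linFactor X φ i) * toddFactor hM X φ i := by
  by_cases hi : φ (X i) = 1
  · rw [linFactor, toddFactor, if_pos hi, if_pos hi]
    refine cen_ext fun y => ?_
    rw [mul_smul, mulC_smul, seriesC_mk_smul, torEq, map_sub, map_one, sub_smul, one_smul,
      torC_eexp_smul, addChar_neg_eq_one.2 hi, one_smul, symVec_neg]
    exact sub_seriesAct_expCoeff_neg (hM _) y
  · rw [linFactor, toddFactor, if_neg hi, if_neg hi, map_one, one_mul]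

theorem isUnit_toddFactor (X : ι → Λ) (φ : AddChar Λ ℂ) (i : ι) :
    IsUnit (toddFactor hM X φ i) := by
  by_cases hi : φ (X i) = 1
  · rw [toddFactor, if_pos hi]
    refine isUnit_seriesC _ _ ?_
    rw [← PowerSeries.coeff_zero_eq_constantCoeff_apply, PowerSeries.coeff_mk]
    simp [toddInvCoeff]
  · rw [toddFactor, if_neg hi]
    have h : torC hM φ (torEq X i) = seriesC (symVec (-X i)) (hM _)
        (1 - φ (-X i) • PowerSeries.mk expCoeff) := by
      rw [torEq, map_sub, map_one, torC_eexp, map_sub, map_one, map_smul]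
      rfl
    rw [h]
    refine isUnit_seriesC _ _ ?_
    rw [← PowerSeries.coeff_zero_eq_constantCoeff_apply, map_sub, map_smul, PowerSeries.coeff_mk,
      PowerSeries.coeff_one, if_pos rfl]
    have : expCoeff 0 = 1 := by simp [expCoeff]
    rw [this, smul_eq_mul, mul_one, sub_ne_zero]
    exact fun h => hi (addChar_neg_eq_one.1 h.symm)

/-- The inverse Todd operator. -/
def toddC [Fintype ι] (X : ι → Λ) (φ : AddChar Λ ℂ) : Cen Λ M := ∏ i, toddFactor hM X φ i

theorem isUnit_toddC [Fintype ι] (X : ι → Λ) (φ : AddChar Λ ℂ) : IsUnit (toddC hM X φ) :=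
  IsUnit.prod_iff.2 fun i _ => isUnit_toddFactor hM X φ i

/-- The Todd operator. -/
def tdC [Fintype ι] (X : ι → Λ) (φ : AddChar Λ ℂ) : Cen Λ M :=
  ((isUnit_toddC hM X φ).unit⁻¹ : (Cen Λ M)ˣ)

theorem tdC_mul_toddC [Fintype ι] (X : ι → Λ) (φ : AddChar Λ ℂ) : tdC hM X φ * toddC hM X φ = 1 :=
  (isUnit_toddC hM X φ).val_inv_mul

theorem prod_linFactor [Fintype ι] (X : ι → Λ) (φ : AddChar Λ ℂ) (p : ι → Prop) [DecidablePred p] :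
    ∏ i with p i, linFactor X φ i = ∏ i : LocIdx X φ with p i.1, linEq (locList X φ) i := by
  classical
  rw [Finset.prod_filter, Finset.prod_filter]
  have h1 : ∀ i : ι, (if p i then linFactor X φ i else 1) =
      if φ (X i) = 1 then (if p i then symVec (X i) else 1) else 1 := by
    intro i
    unfold linFactor
    split_ifs <;> rfl
  simp_rw [h1]
  rw [← Finset.prod_filter]
  exact Finset.prod_subtype (p := fun i => φ (X i) = 1) _ (by simp)
    (fun i => if p i then symVec (X i) else 1)

theorem torC_prod_torEq [Fintype ι] (X : ι → Λ) (φ : AddChar Λ ℂ) :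
    torC hM φ (∏ i, torEq X i) =
      mulC M (∏ i, linEq (locList X φ) i) * toddC hM X φ := by
  have := prod_linFactor X φ (fun _ => True)
  simp only [Finset.filter_true] at this
  rw [← this, map_prod, map_prod, toddC, ← Finset.prod_mul_distrib]
  exact Finset.prod_congr rfl fun i _ => torC_torEq hM X φ i

theorem tdC_mul_torC [Fintype ι] (X : ι → Λ) (φ : AddChar Λ ℂ) :
    tdC hM X φ * torC hM φ (∏ i, torEq X i) = mulC M (∏ i, linEq (locList X φ) i) := by
  rw [torC_prod_torEq, mul_left_comm, tdC_mul_toddC, mul_one]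

/-! ### Compatibility with derivations -/

section Derivation

variable {u : Vec Λ →ₗ[ℂ] ℂ} {D : M →ₗ[ℂ] M}

theorem derivation_torC_smul
    (hD : ∀ (s : SymV Λ) (y : M), D (s • y) = s • D y + symDerivation u s • y) (φ : AddChar Λ ℂ)
    (f : GrpAlg Λ) (y : M) :
    D (torC hM φ f • y) = torC hM φ f • D y + torC hM φ (torusDerivation u f) • y := by
  induction f using grpAlg_induction with
  | h0 => simp
  | hadd f g hf hg =>
    simp only [map_add, add_smul, hf, hg]
    abel
  | hsmul c f hf =>
    rw [map_smul (torC hM φ), Derivation.map_smul, map_smul (torC hM φ), smul_assoc, smul_assoc,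
      smul_assoc, D.map_smul, hf, smul_add]
  | hexp a =>
    have hD' : ∀ y : M, D (symVec a • y) = symVec a • D y + u (toVec a) • y := by
      intro y
      rw [hD, symVec, symDerivation_ι, algebraMap_smul]
    rw [torC_eexp_smul, torC_eexp_smul, torusDerivation_eexp, map_smul, map_smul, smul_assoc,
      torC_eexp_smul, map_seriesAct_expCoeff_of_derivation D (hM a) hD', smul_add,
      smul_comm (φ a) (u (toVec a))]

/-- The commutator of a derivation with a central operator is `S[V]`-linear. -/
theorem exists_commutator
    (hD : ∀ (s : SymV Λ) (y : M), D (s • y) = s • D y + symDerivation u s • y)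
    (c : Cen Λ M) : ∃ K : Module.End (SymV Λ) M, ∀ y, D (c • y) = c • D y + K y := by
  refine ⟨{ toFun := fun y => D (c • y) - c • D y
            map_add' := fun y z => ?_
            map_smul' := fun s y => ?_ }, fun y => ?_⟩
  · simp only [smul_add, map_add]
    abel
  · simp only [cen_smul_comm, hD, smul_add, RingHom.id_apply, smul_sub]
    abel
  · simp

/-- The commutator `K` is `S[V]`-linear, so it commutes with the central `c` and the usual power
rule holds. -/
theorem derivation_pow_smul {c : Cen Λ M} {K : Module.End (SymV Λ) M}
    (hK : ∀ y, D (c • y) = c • D y + K y) (n : ℕ) (y : M) :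
    D (c ^ (n + 1) • y) = c ^ (n + 1) • D y + (n + 1) • c ^ n • K y := by
  induction n with
  | zero => simp [hK]
  | succ n ih =>
    have h1 : c • c ^ n • K y = c ^ (n + 1) • K y := by rw [smul_smul, ← pow_succ']
    have h2 : c • c ^ (n + 1) • D y = c ^ (n + 1 + 1) • D y := by rw [smul_smul, ← pow_succ']
    rw [pow_succ' c (n + 1), mul_smul, hK, ih, smul_add, ← cen_apply_comm, smul_comm c (n + 1), h1,
      h2, ← pow_succ', succ_nsmul (c ^ (n + 1) • K y) (n + 1), add_assoc]

end Derivation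

end Operators

section LinearSide

variable {Λ : Type*} [AddCommGroup Λ] [Module.Finite ℤ Λ] {ι : Type*} [Fintype ι]

/-! ### The linear polar parts -/

/-- The class of `∏ a⁻ⁿ`. -/
def polarPow (Z : ι → Λ) (n : ℕ) : LinPolar Z := polarClass _ _ (frac (linEq Z) 1 fun _ => n)

omit [Module.Finite ℤ Λ] in
theorem smul_polarPow (Z : ι → Λ) (n : ℕ) (g : SymV Λ) :
    g • polarPow Z n = polarClass _ _ (frac (linEq Z) g fun _ => n) := by
  have : g • polarPow Z n = polarClass (linEq Z) (vecs Z) (g • frac (linEq Z) 1 fun _ => n) := rfl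
  rw [this, smul_frac, mul_one]

omit [Module.Finite ℤ Λ] in
theorem exists_eq_smul_polarPow (Z : ι → Λ) (y : LinPolar Z) :
    ∃ (g : SymV Λ) (n : ℕ), y = g • polarPow Z n := by
  obtain ⟨x, rfl⟩ := Submodule.Quotient.mk_surjective _ y
  obtain ⟨g, n, rfl⟩ := exists_eq_frac _ x
  exact ⟨g, n, (smul_polarPow Z n g).symm⟩

omit [Module.Finite ℤ Λ] in
theorem pow_smul_polarPow (Z : ι → Λ) (n m : ℕ) :
    (∏ i, linEq Z i) ^ m • polarPow Z (n + m) = polarPow Z n := by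
  rw [smul_polarPow, polarPow, frac_eq_frac_const_add _ 1 n m, one_mul]

theorem smul_polarPow_eq_zero {Z : ι → Λ} {n : ℕ} {g : SymV Λ} (hg : g ∈ linIdeal Z n) :
    g • polarPow Z n = 0 :=
  smul_polarClass_frac_eq_zero hg 1

/-- Cancellation of equations enters here; freeness of the lattice keeps the vectors non-zero in
`V`. -/
theorem mem_linIdeal_of_smul_polarPow [Module.Free ℤ Λ] {Z : ι → Λ} (hZ : ∀ i, Z i ≠ 0) {n : ℕ}
    {g : SymV Λ} (hg : g • polarPow Z n = 0) : g ∈ linIdeal Z n := by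
  rw [smul_polarPow, polarClass_eq_zero_iff] at hg
  obtain ⟨m, hm⟩ := exists_pow_mul_mem_cocircuitIdeal hg
  exact mem_cocircuitIdeal_of_pow_mul_mem (a := vecs Z) (fun i => toVec_ne_zero (hZ i)) hm

theorem locNil_linPolar (Z : ι → Λ) (a : Λ) : LocNil (LinPolar Z) (symVec a) := by
  intro y
  obtain ⟨g, n, rfl⟩ := exists_eq_smul_polarPow Z y
  obtain ⟨k, hk⟩ := isNilpotent_mk_symVec Z n a
  refine ⟨k, ?_⟩
  rw [← map_pow, Ideal.Quotient.eq_zero_iff_mem] at hk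
  rw [smul_comm, smul_polarPow_eq_zero hk, smul_zero]

/-- The `S[V]`-linear map sending `1` to the class of `∏ a⁻ⁿ`. -/
def quotToPolar (Z : ι → Λ) (n : ℕ) : (SymV Λ ⧸ linIdeal Z n) →ₗ[SymV Λ] LinPolar Z :=
  Submodule.liftQ _ (LinearMap.toSpanSingleton _ _ (polarPow Z n))
    fun _ hg => smul_polarPow_eq_zero hg

theorem quotToPolar_mk (Z : ι → Λ) (n : ℕ) (g : SymV Λ) :
    quotToPolar Z n (Ideal.Quotient.mk _ g) = g • polarPow Z n := rfl

theorem quotToPolar_one (Z : ι → Λ) (n : ℕ) : quotToPolar Z n 1 = polarPow Z n := by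
  rw [← map_one (Ideal.Quotient.mk (linIdeal Z n)), quotToPolar_mk, one_smul]

theorem quotToPolar_injective [Module.Free ℤ Λ] {Z : ι → Λ} (hZ : ∀ i, Z i ≠ 0) (n : ℕ) :
    Function.Injective (quotToPolar Z n) := by
  rw [injective_iff_map_eq_zero]
  intro y hy
  obtain ⟨g, rfl⟩ := Ideal.Quotient.mk_surjective y
  rw [quotToPolar_mk] at hy
  exact Ideal.Quotient.eq_zero_iff_mem.2 (mem_linIdeal_of_smul_polarPow hZ hy)

omit [Module.Finite ℤ Λ] in
theorem polarDerivation_polarPow (Z : ι → Λ) (u : Vec Λ →ₗ[ℂ] ℂ) (n : ℕ) :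
    polarDerivation (linEq Z) (vecs Z) (symDerivation u) (polarPow Z n) =
      -(n • symDerivation u (∏ i, linEq Z i) • polarPow Z (n + 1)) := by
  rw [polarPow, polarDerivation_polarClass, locDerivation_frac_const, Derivation.map_one_eq_zero,
    zero_mul, zero_sub, one_mul, ← smul_polarPow, neg_smul, smul_assoc]

end LinearSide

/-! ### The local component of a toric polar part -/

section LocalMap

variable {Λ : Type*} [AddCommGroup Λ] [Module.Finite ℤ Λ] {ι : Type*} [Fintype ι]
variable (X : ι → Λ) (φ : AddChar Λ ℂ)

/-- The action of `ℂ[Λ]` on the linear polar parts at `φ`. -/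
abbrev locTor : GrpAlg Λ →ₐ[ℂ] Cen Λ (LinPolar (locList X φ)) :=
  torC (locNil_linPolar (locList X φ)) φ

/-- The Todd operator at `φ`. -/
abbrev locTd : Cen Λ (LinPolar (locList X φ)) := tdC (locNil_linPolar (locList X φ)) X φ

/-- The inverse Todd operator at `φ`. -/
abbrev locTodd : Cen Λ (LinPolar (locList X φ)) := toddC (locNil_linPolar (locList X φ)) X φ

/-- The two realizations of `φ(a) exp(a)`, as an operator on polar parts and as an element of the
quotient algebra, agree. -/
theorem locTor_smul_quotToPolar (n : ℕ) (f : GrpAlg Λ)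
    (z : SymV Λ ⧸ linIdeal (locList X φ) n) :
    locTor X φ f • quotToPolar _ n z = quotToPolar _ n (topHom X φ n f * z) := by
  induction f using grpAlg_induction with
  | h0 => rw [map_zero, map_zero, zero_smul, zero_mul, map_zero]
  | hadd f g hf hg => rw [map_add, map_add, add_smul, add_mul, map_add, hf, hg]
  | hsmul c f hf =>
    rw [map_smul, map_smul, smul_assoc, smul_mul_assoc, hf, LinearMap.map_smul_of_tower]
  | hexp a =>
    have hx := isNilpotent_mk_symVec (locList X φ) n a
    rw [torC_eexp_smul, topHom_eexp, smul_mul_assoc, LinearMap.map_smul_of_tower,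
      ← map_seriesAct _ _ (locNil_quotient hx), seriesAct_quotient hx]
    rfl

/-- The numerator of the local component of `f / ∏ (1 - e^{-a})ⁿ`. -/
def locRaw (f : GrpAlg Λ) (n : ℕ) : LinPolar (locList X φ) :=
  (locTd X φ ^ n * locTor X φ f) • polarPow (locList X φ) n

/-- The Todd operator turns the product of the toric equations into that of the linear ones, which
lowers the exponent of the denominator. -/
theorem locRaw_pow_mul (f : GrpAlg Λ) (n m : ℕ) :
    locRaw X φ ((∏ i, torEq X i) ^ m * f) (n + m) = locRaw X φ f n := by
  have h : locTd X φ ^ (n + m) * locTor X φ ((∏ i, torEq X i) ^ m * f) =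
      locTd X φ ^ n * locTor X φ f * mulC _ ((∏ i, linEq (locList X φ) i) ^ m) := by
    rw [map_mul, map_pow, map_pow, ← tdC_mul_torC (locNil_linPolar (locList X φ)) X φ, mul_pow,
      pow_add]
    ring
  rw [locRaw, h, mul_smul, mulC_smul, pow_smul_polarPow, locRaw]

theorem locRaw_eq_zero {f : GrpAlg Λ} {n : ℕ} (hf : f ∈ torIdeal X n) : locRaw X φ f n = 0 := by
  rw [locRaw, mul_smul, ← quotToPolar_one, locTor_smul_quotToPolar, topHom_eq_zero hf, zero_mul,
    map_zero, smul_zero]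

theorem locRaw_add (f g : GrpAlg Λ) (n : ℕ) :
    locRaw X φ (f + g) n = locRaw X φ f n + locRaw X φ g n := by
  rw [locRaw, map_add, mul_add, add_smul, locRaw, locRaw]

theorem locRaw_sub (f g : GrpAlg Λ) (n : ℕ) :
    locRaw X φ (f - g) n = locRaw X φ f n - locRaw X φ g n := by
  rw [locRaw, map_sub, mul_sub, sub_smul, locRaw, locRaw]

theorem locRaw_mul (g f : GrpAlg Λ) (n : ℕ) :
    locRaw X φ (g * f) n = locTor X φ g • locRaw X φ f n := by
  rw [locRaw, map_mul, mul_left_comm, mul_smul, locRaw]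

theorem locRaw_smul (c : ℂ) (f : GrpAlg Λ) (n : ℕ) :
    locRaw X φ (c • f) n = c • locRaw X φ f n := by
  rw [locRaw, map_smul, mul_smul_comm, smul_assoc, locRaw]

/-- The class of `f / ∏ (1 - e^{-a})ⁿ`. -/
def torClass (f : GrpAlg Λ) (n : ℕ) : TorPolar X := polarClass _ _ (frac (torEq X) f fun _ => n)

omit [Module.Finite ℤ Λ] in
theorem exists_eq_torClass (x : TorPolar X) : ∃ (f : GrpAlg Λ) (n : ℕ), x = torClass X f n := by
  obtain ⟨y, rfl⟩ := Submodule.Quotient.mk_surjective _ x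
  obtain ⟨g, n, rfl⟩ := exists_eq_frac _ y
  exact ⟨g, n, rfl⟩

omit [Module.Finite ℤ Λ] in
theorem torClass_eq_pow_mul (f : GrpAlg Λ) (n m : ℕ) :
    torClass X f n = torClass X ((∏ i, torEq X i) ^ m * f) (n + m) := by
  rw [torClass, frac_eq_frac_const_add _ f n m, mul_comm, torClass]

omit [Module.Finite ℤ Λ] in
theorem torClass_add (f g : GrpAlg Λ) (n : ℕ) :
    torClass X (f + g) n = torClass X f n + torClass X g n := by
  rw [torClass, ← frac_add_frac]
  rfl

omit [Module.Finite ℤ Λ] in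
theorem smul_torClass (g f : GrpAlg Λ) (n : ℕ) :
    g • torClass X f n = torClass X (g * f) n := by
  rw [torClass, torClass, ← smul_frac]
  rfl

omit [Module.Finite ℤ Λ] in
theorem complex_smul_torClass (c : ℂ) (f : GrpAlg Λ) (n : ℕ) :
    c • torClass X f n = torClass X (c • f) n := by
  rw [← algebraMap_smul (GrpAlg Λ) c (torClass X f n), smul_torClass, ← Algebra.smul_def]

/-- Well-definedness of the local component: the difference, over a common denominator and after a
further power, has its numerator in a cocircuit ideal, which acts by zero. -/
theorem locRaw_eq_of_torClass_eq {f g : GrpAlg Λ} {n m : ℕ}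
    (h : torClass X f n = torClass X g m) : locRaw X φ f n = locRaw X φ g m := by
  have h1 : torClass X ((∏ i, torEq X i) ^ m * f - (∏ i, torEq X i) ^ n * g) (n + m) = 0 := by
    rw [sub_eq_add_neg, ← neg_one_mul ((∏ i, torEq X i) ^ n * g), torClass_add,
      ← torClass_eq_pow_mul, ← smul_torClass X (-1), add_comm n m, ← torClass_eq_pow_mul, h,
      neg_one_smul, add_neg_cancel]
  rw [torClass, polarClass_eq_zero_iff] at h1
  obtain ⟨k, hk⟩ := exists_pow_mul_mem_cocircuitIdeal h1
  have h2 := locRaw_eq_zero X φ hk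
  rw [locRaw_pow_mul, locRaw_sub, locRaw_pow_mul, add_comm n m, locRaw_pow_mul, sub_eq_zero] at h2
  exact h2

/-- The component at `φ` of a toric polar part. -/
def locMap : TorPolar X →ₗ[ℂ] LinPolar (locList X φ) where
  toFun x := locRaw X φ (exists_eq_torClass X x).choose (exists_eq_torClass X x).choose_spec.choose
  map_add' x y := by
    obtain ⟨f, n, hf⟩ := exists_eq_torClass X x
    obtain ⟨g, m, hg⟩ := exists_eq_torClass X y
    have hz : x + y =
        torClass X ((∏ i, torEq X i) ^ m * f + (∏ i, torEq X i) ^ n * g) (n + m) := by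
      rw [torClass_add, ← torClass_eq_pow_mul, add_comm n m, ← torClass_eq_pow_mul, hf, hg]
    rw [locRaw_eq_of_torClass_eq X φ
        ((exists_eq_torClass X (x + y)).choose_spec.choose_spec.symm.trans hz),
      locRaw_eq_of_torClass_eq X φ ((exists_eq_torClass X x).choose_spec.choose_spec.symm.trans hf),
      locRaw_eq_of_torClass_eq X φ ((exists_eq_torClass X y).choose_spec.choose_spec.symm.trans hg),
      locRaw_add, locRaw_pow_mul, add_comm n m, locRaw_pow_mul]
  map_smul' c x := by
    obtain ⟨f, n, hf⟩ := exists_eq_torClass X x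
    have hz : c • x = torClass X (c • f) n := by rw [hf, complex_smul_torClass]
    rw [locRaw_eq_of_torClass_eq X φ
        ((exists_eq_torClass X (c • x)).choose_spec.choose_spec.symm.trans hz),
      locRaw_eq_of_torClass_eq X φ ((exists_eq_torClass X x).choose_spec.choose_spec.symm.trans hf),
      locRaw_smul, RingHom.id_apply]

theorem locMap_torClass (f : GrpAlg Λ) (n : ℕ) : locMap X φ (torClass X f n) = locRaw X φ f n :=
  locRaw_eq_of_torClass_eq X φ (exists_eq_torClass X _).choose_spec.choose_spec.symm

theorem locMap_smul (g : GrpAlg Λ) (x : TorPolar X) :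
    locMap X φ (g • x) = locTor X φ g • locMap X φ x := by
  obtain ⟨f, n, rfl⟩ := exists_eq_torClass X x
  rw [smul_torClass, locMap_torClass, locMap_torClass, locRaw_mul]

open scoped Classical in
/-- The inverse Todd class of order `n` at `φ`. -/
def toddQuot (n : ℕ) : SymV Λ ⧸ linIdeal (locList X φ) n :=
  ∏ i : ι, if φ (X i) = 1
    then seriesAct toddInvCoeff (symVec (X i)) (1 : SymV Λ ⧸ linIdeal (locList X φ) n)
    else topHom X φ n (torEq X i)

theorem locTodd_smul_quotToPolar (n : ℕ) (z : SymV Λ ⧸ linIdeal (locList X φ) n) :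
    locTodd X φ • quotToPolar _ n z = quotToPolar _ n (toddQuot X φ n * z) := by
  classical
  rw [locTodd, toddC, toddQuot]
  induction (Finset.univ : Finset ι) using Finset.induction_on generalizing z with
  | empty => simp
  | insert i s hi ih =>
    rw [Finset.prod_insert hi, Finset.prod_insert hi, mul_smul, ih, mul_assoc]
    by_cases h : φ (X i) = 1
    · have hx := isNilpotent_mk_symVec (locList X φ) n (X i)
      rw [toddFactor, if_pos h, if_pos h, seriesC_mk_smul, ← map_seriesAct _ _ (locNil_quotient hx),
        seriesAct_quotient hx, seriesAct_quotient_one]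
    · rw [toddFactor, if_neg h, if_neg h, locTor_smul_quotToPolar]

theorem locTodd_mul_locTd : locTodd X φ * locTd X φ = 1 := by
  rw [mul_comm, tdC_mul_toddC]

theorem locTodd_pow_smul_locRaw (f : GrpAlg Λ) (n : ℕ) :
    locTodd X φ ^ n • locRaw X φ f n = quotToPolar _ n (topHom X φ n f) := by
  rw [locRaw, smul_smul, ← mul_assoc, ← mul_pow, locTodd_mul_locTd, one_pow, one_mul,
    ← quotToPolar_one, locTor_smul_quotToPolar, mul_one]

theorem locTodd_pow_smul_quotToPolar (n k : ℕ) (z : SymV Λ ⧸ linIdeal (locList X φ) n) :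
    locTodd X φ ^ k • quotToPolar _ n z = quotToPolar _ n (toddQuot X φ n ^ k * z) := by
  induction k generalizing z with
  | zero => simp
  | succ k ih => rw [pow_succ, mul_smul, locTodd_smul_quotToPolar, ih, ← mul_assoc, pow_succ]

theorem locTodd_pow_smul_injective (n : ℕ) {y z : LinPolar (locList X φ)}
    (h : locTodd X φ ^ n • y = locTodd X φ ^ n • z) : y = z := by
  have := congrArg (locTd X φ ^ n • ·) h
  simpa only [smul_smul, ← mul_pow, tdC_mul_toddC, one_pow, one_smul] using this

end LocalMap

/-! ### The quotient rule and the Todd factors on a locally nilpotent module. -/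

section Generic

variable {Λ : Type*} [AddCommGroup Λ] {ι : Type*}
variable {M : Type*} [AddCommGroup M] [Module (SymV Λ) M] [Module ℂ M] [IsScalarTower ℂ (SymV Λ) M]
variable (hM : ∀ a : Λ, LocNil M (symVec a))

/-- The quotient rule for the operator version of `f / dⁿ`, `t` being the quotient of the linear
equation `δ` by the toric equation `d`. -/
theorem derivation_pow_mul_torC_smul {u : Vec Λ →ₗ[ℂ] ℂ} {D : M →ₗ[ℂ] M}
    (hD : ∀ (s : SymV Λ) (y : M), D (s • y) = s • D y + symDerivation u s • y) (φ : AddChar Λ ℂ)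
    {t : Cen Λ M} {d : GrpAlg Λ} {δ : SymV Λ} (ht : t * torC hM φ d = mulC M δ) {n : ℕ} {w : M}
    (hw : δ • D w = -((n + 1) • symDerivation u δ • w)) (f : GrpAlg Λ) :
    D ((t ^ n * torC hM φ f) • δ • w) =
      (t ^ (n + 1) * torC hM φ (torusDerivation u f * d - n • (f * torusDerivation u d))) • w := by
  have hT := derivation_torC_smul hM hD φ
  obtain ⟨K, hK⟩ := exists_commutator hD t
  have hδs : ∀ y : M, t • torC hM φ d • y = δ • y := by
    intro y
    rw [smul_smul, ht, mulC_smul]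
  -- The commutator with the Todd operator is never computed: differentiating `t * d = δ` determines
  -- it on multiples of `d`, the only place where it is used.
  have hKd : ∀ y, K (torC hM φ d • y) =
      symDerivation u δ • y - t • torC hM φ (torusDerivation u d) • y := by
    intro y
    have h1 := hK (torC hM φ d • y)
    rw [hδs, hD, hT, smul_add, hδs, add_assoc, add_right_inj] at h1
    rw [h1]
    abel
  have hbase : D (t ^ n • δ • w) =
      -(n • t ^ (n + 1) • torC hM φ (torusDerivation u d) • w) := by
    have e1 : t ^ n • δ • w = t ^ (n + 1) • torC hM φ d • w := by
      rw [← hδs, smul_smul (t ^ n) t, ← pow_succ]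
    have e2 : t ^ (n + 1) • torC hM φ d • D w = -((n + 1) • t ^ n • symDerivation u δ • w) := by
      rw [pow_succ, mul_smul, hδs, hw, smul_neg, smul_comm (t ^ n) (n + 1)]
    have e3 : t ^ n • t • torC hM φ (torusDerivation u d) • w =
        t ^ (n + 1) • torC hM φ (torusDerivation u d) • w := by
      rw [smul_smul (t ^ n) t, ← pow_succ]
    rw [e1, derivation_pow_smul hK, hT, smul_add, e2, hKd, smul_sub, e3, smul_sub, add_smul n 1,
      one_smul, add_smul n 1, one_smul]
    abel
  have e4 : torC hM φ (torusDerivation u f) • t ^ n • δ • w =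
      (t ^ (n + 1) * torC hM φ (torusDerivation u f * d)) • w := by
    rw [← mulC_smul, ← ht, smul_smul, smul_smul, map_mul]
    congr 1
    ring
  have e5 : torC hM φ f • t ^ (n + 1) • torC hM φ (torusDerivation u d) • w =
      (t ^ (n + 1) * torC hM φ (f * torusDerivation u d)) • w := by
    rw [smul_smul, smul_smul, map_mul]
    congr 1
    ring
  rw [mul_comm (t ^ n), mul_smul, hT, hbase, e4, smul_neg, smul_comm (torC hM φ f) n, e5, map_sub,
    mul_sub, sub_smul, map_nsmul, mul_smul_comm, smul_assoc]
  abel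

/-- Multiplying by the factors of `b` avoids inverting them separately; those outside `b` cancel
against the toric equations. -/
theorem prod_toddFactor_mul_tdC_mul [Fintype ι] (X : ι → Λ) (φ : AddChar Λ ℂ) (b : Set ι)
    [DecidablePred (· ∈ b)] :
    (∏ i with i ∈ b, toddFactor hM X φ i) *
        (tdC hM X φ * torC hM φ (∏ i with i ∉ b, torEq X i)) =
      mulC M (∏ i with i ∉ b, linFactor X φ i) := by
  have h1 : torC hM φ (∏ i with i ∉ b, torEq X i) =
      mulC M (∏ i with i ∉ b, linFactor X φ i) * ∏ i with i ∉ b, toddFactor hM X φ i := by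
    rw [map_prod, map_prod, ← Finset.prod_mul_distrib]
    exact Finset.prod_congr rfl fun i _ => torC_torEq hM X φ i
  have h2 := tdC_mul_toddC hM X φ
  rw [toddC, ← Finset.prod_filter_mul_prod_filter_not Finset.univ (· ∈ b)] at h2
  rw [h1]
  linear_combination mulC M (∏ i with i ∉ b, linFactor X φ i) * h2

/-- On a vector killed by `V`, the factors at which `φ` is trivial act as the identity. -/
theorem prod_toddFactor_smul_of_killed (X : ι → Λ) (φ : AddChar Λ ℂ) {y : M}
    (hy : ∀ a : Λ, symVec a • y = 0) (s : Finset ι) (hs : ∀ i ∈ s, φ (X i) = 1) :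
    (∏ i ∈ s, toddFactor hM X φ i) • y = y := by
  classical
  induction s using Finset.induction_on with
  | empty => rw [Finset.prod_empty, one_smul]
  | insert i s hi ih =>
    rw [Finset.prod_insert hi, mul_smul, ih fun j hj => hs j (Finset.mem_insert_of_mem hj),
      toddFactor, if_pos (hs i (Finset.mem_insert_self i s)), seriesC_mk_smul,
      seriesAct_of_smul_eq_zero _ (hy _)]
    simp [toddInvCoeff]

end Generic

section Bijective

variable {Λ : Type*} [AddCommGroup Λ] [Module.Finite ℤ Λ] {ι : Type*} [Fintype ι]

/-! ### Compatibility of the local components with derivations -/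

theorem polarDerivation_locRaw (X : ι → Λ) (φ : AddChar Λ ℂ) (u : Vec Λ →ₗ[ℂ] ℂ)
    (f : GrpAlg Λ) (n : ℕ) :
    polarDerivation (linEq (locList X φ)) (vecs (locList X φ)) (symDerivation u)
        (locRaw X φ f n) =
      locRaw X φ (torusDerivation u f * (∏ i, torEq X i) -
        n • (f * torusDerivation u (∏ i, torEq X i))) (n + 1) := by
  have h1 := pow_smul_polarPow (locList X φ) n 1
  have h2 := pow_smul_polarPow (locList X φ) (n + 1) 1
  rw [pow_one] at h1 h2
  -- The class of order `n` is written as `δ • w` with `w` of order `n + 1`, the form required by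
  -- the operator quotient rule.
  rw [locRaw, ← h1]
  refine derivation_pow_mul_torC_smul (locNil_linPolar (locList X φ))
    (polarDerivation_smul _ _ _) φ (tdC_mul_torC _ X φ) ?_ f
  rw [polarDerivation_polarPow, smul_neg, smul_comm _ (n + 1), smul_comm _ (symDerivation u _), h2]

theorem locMap_derivation (X : ι → Λ) (φ : AddChar Λ ℂ) (u : Vec Λ →ₗ[ℂ] ℂ)
    (x : Loc (torEq X)) :
    locMap X φ (polarClass _ _ (locDerivation (torEq X) (torusDerivation u) x)) =
      polarDerivation (linEq (locList X φ)) (vecs (locList X φ)) (symDerivation u)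
        (locMap X φ (polarClass _ _ x)) := by
  obtain ⟨f, n, rfl⟩ := exists_eq_frac _ x
  rw [locDerivation_frac_const]
  have h1 := locMap_torClass X φ f n
  have h2 := locMap_torClass X φ (torusDerivation u f * (∏ i, torEq X i) -
    n • (f * torusDerivation u (∏ i, torEq X i))) (n + 1)
  rw [torClass] at h1 h2
  rw [h1, h2, polarDerivation_locRaw]

/-! ### Bijectivity -/

/-- All the local components of a toric polar part. -/
def locPi (X : ι → Λ) : TorPolar X →ₗ[ℂ] (∀ φ : arrPoints X, LinPolar (locList X φ)) :=
  LinearMap.pi fun φ => locMap X φ.1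

theorem locPi_apply (X : ι → Λ) (x : TorPolar X) (φ : arrPoints X) :
    locPi X x φ = locMap X φ x := rfl

theorem torClass_eq_zero {X : ι → Λ} {f : GrpAlg Λ} {n : ℕ} (hf : f ∈ torIdeal X n) :
    torClass X f n = 0 := by
  rw [torClass, polarClass_eq_zero_iff]
  exact frac_mem_of_mem_cocircuitIdeal hf

/-- A vanishing local component forces `topHom` to kill the numerator, by the exact linear
annihilator; if all vanish, the numerator is in the toric cocircuit ideal. -/
theorem locPi_injective [Module.Free ℤ Λ] {X : ι → Λ} (hX : ∀ i, X i ≠ 0) :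
    Function.Injective (locPi X) := by
  rw [injective_iff_map_eq_zero]
  intro x hx
  obtain ⟨f, n, rfl⟩ := exists_eq_torClass X x
  refine torClass_eq_zero (mem_torIdeal_of_topHom_eq_zero fun φ hφ => ?_)
  have h1 : locMap X φ (torClass X f n) = 0 := congrFun hx ⟨φ, hφ⟩
  rw [locMap_torClass] at h1
  have h2 := locTodd_pow_smul_locRaw X φ f n
  rw [h1, smul_zero] at h2
  exact (injective_iff_map_eq_zero _).1
    (quotToPolar_injective (Z := locList X φ) (fun i => hX i.1) n) _ h2.symm

theorem locPi_surjective (X : ι → Λ) : Function.Surjective (locPi X) := by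
  intro y
  have : Finite (arrPoints X) := (arrPoints_finite X).to_subtype
  have := Fintype.ofFinite (arrPoints X)
  choose g n hgn using fun φ : arrPoints X => exists_eq_smul_polarPow (locList X φ.1) (y φ)
  obtain ⟨N, hN⟩ : ∃ N, ∀ φ, n φ ≤ N :=
    ⟨∑ φ, n φ, fun φ => Finset.single_le_sum (fun _ _ => Nat.zero_le _) (Finset.mem_univ φ)⟩
  have hy : ∀ φ : arrPoints X, ∃ z : SymV Λ ⧸ linIdeal (locList X φ.1) N,
      y φ = quotToPolar _ N z := by
    intro φ
    obtain ⟨k, hk⟩ := Nat.exists_eq_add_of_le (hN φ)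
    refine ⟨Ideal.Quotient.mk _ (g φ * (∏ i, linEq (locList X φ.1) i) ^ k), ?_⟩
    rw [quotToPolar_mk, mul_smul, hk, pow_smul_polarPow]
    exact hgn φ
  choose z hz using hy
  -- All components are now over the common exponent `N`; the power of the inverse Todd class
  -- compensates the Todd operator in `locRaw`.
  obtain ⟨f, hf⟩ := exists_topHom_eq X N fun φ => toddQuot X φ.1 N ^ N * z φ
  refine ⟨torClass X f N, funext fun φ => ?_⟩
  rw [locPi_apply, locMap_torClass]
  refine locTodd_pow_smul_injective X φ.1 N ?_
  rw [locTodd_pow_smul_locRaw, hf, ← locTodd_pow_smul_quotToPolar, ← hz]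

/-- The identification of the toric polar parts with the sum of the local linear ones. -/
def locEquiv [Module.Free ℤ Λ] {X : ι → Λ} (hX : ∀ i, X i ≠ 0) :
    TorPolar X ≃ₗ[ℂ] (∀ φ : arrPoints X, LinPolar (locList X φ)) :=
  LinearEquiv.ofBijective (locPi X) ⟨locPi_injective hX, locPi_surjective X⟩

theorem locEquiv_apply [Module.Free ℤ Λ] {X : ι → Λ} (hX : ∀ i, X i ≠ 0) (x : TorPolar X)
    (φ : arrPoints X) : locEquiv hX x φ = locMap X φ x := rfl

/-! ### The classes of the extracted bases -/

omit [Module.Finite ℤ Λ] [Fintype ι] in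
-- Orthogonality of characters: `ψ φ⁻¹` is trivial on `Λ_b`, so it descends to the finite group `Λ /
-- Λ_b`, over which its average is computed.
theorem evChar_charIdem {X : ι → Λ} {φ ψ : AddChar Λ ℂ} {b : Set ι} {R : Finset Λ}
    (hR : IsRepresentatives X b R) (hφ : ∀ i ∈ b, φ (X i) = 1) (hψ : ∀ i ∈ b, ψ (X i) = 1) :
    evChar ψ (charIdem φ R) = if ψ = φ then 1 else 0 := by
  classical
  set N := AddSubgroup.closure (X '' b) with hN
  let e : R ≃ Λ ⧸ N := Equiv.ofBijective _ hR
  have : Fintype (Λ ⧸ N) := Fintype.ofEquiv _ e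
  have hRne : (R.card : ℂ) ≠ 0 := by
    have : 0 < Fintype.card R := Fintype.card_pos_iff.2 ⟨e.symm 0⟩
    rw [Fintype.card_coe] at this
    exact_mod_cast this.ne'
  let χ : AddChar Λ ℂ := ψ * φ⁻¹
  have hχ : ∀ a, χ a = φ (-a) * ψ a := fun a => by
    rw [AddChar.mul_apply, AddChar.inv_apply, mul_comm]
  have hχN : ∀ a ∈ N, χ a = 1 := by
    intro a ha
    induction ha using AddSubgroup.closure_induction with
    | mem a ha =>
      obtain ⟨i, hi, rfl⟩ := ha
      rw [hχ, addChar_neg_eq_one.2 (hφ i hi), hψ i hi, one_mul]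
    | zero => exact AddChar.map_zero_eq_one χ
    | add a b _ _ ha hb => rw [AddChar.map_add_eq_mul, ha, hb, one_mul]
    | neg a _ ha => rw [addChar_neg_eq_one, ha]
  let χ' : AddChar (Λ ⧸ N) ℂ :=
    { toFun := Quotient.lift (s := QuotientAddGroup.leftRel N) χ fun a c h => by
        rw [← Quotient.eq_iff_equiv] at h
        have h' : (a : Λ ⧸ N) = c := h
        rw [QuotientAddGroup.eq] at h'
        have h1 := hχN _ h'
        have h2 : c = a + (-a + c) := by abel
        rw [h2, AddChar.map_add_eq_mul, h1, mul_one]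
      map_zero_eq_one' := AddChar.map_zero_eq_one χ
      map_add_eq_mul' := by
        rintro ⟨a⟩ ⟨c⟩
        exact AddChar.map_add_eq_mul χ a c }
  have hχ' : ∀ a : Λ, χ' (a : Λ ⧸ N) = χ a := fun a => rfl
  have hsum : evChar ψ (charIdem φ R) = (R.card : ℂ)⁻¹ * ∑ q : Λ ⧸ N, χ' q := by
    rw [charIdem, map_smul, map_sum, smul_eq_mul]
    congr 1
    rw [← Equiv.sum_comp e, ← Finset.sum_coe_sort R]
    refine Finset.sum_congr rfl fun l _ => ?_
    rw [map_smul, evChar_eexp, smul_eq_mul, ← hχ]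
    rfl
  rw [hsum, AddChar.sum_eq_ite]
  have hiff : χ' = 0 ↔ ψ = φ := by
    constructor
    · intro h
      ext a
      have h1 : χ a = 1 := by
        rw [← hχ', h]
        rfl
      rw [hχ, AddChar.map_neg_eq_inv, inv_mul_eq_one₀ (addChar_ne_zero φ a)] at h1
      exact h1.symm
    · rintro rfl
      ext ⟨a⟩
      change χ a = 1
      rw [hχ, ← AddChar.map_add_eq_mul, neg_add_cancel, AddChar.map_zero_eq_one]
  simp only [hiff]
  split_ifs
  · rw [← Fintype.card_congr e, Fintype.card_coe, inv_mul_cancel₀ hRne]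
  · rw [mul_zero]

omit [Module.Finite ℤ Λ] in
theorem uClass_eq (X : ι → Λ) (b : Set ι) [DecidablePred (· ∈ b)] (φ : AddChar Λ ℂ) :
    uClass X b φ = (∏ i with i ∉ b, linFactor X φ i) • polarPow (locList X φ) 1 := by
  classical
  rw [prod_linFactor, smul_polarPow, uClass]
  have h1 : (fun i : LocIdx X φ => b.indicator 1 i.1) =
      ({i | i.1 ∈ b} : Set (LocIdx X φ)).indicator (1 : LocIdx X φ → ℕ) := by
    ext i
    by_cases hi : i.1 ∈ b <;> simp [hi]
  rw [h1, frac_eq_frac_const_one, one_mul]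
  rfl

/-- The index `i` is missing from `X_φ`, so the denominator retains only part of an independent set
and its vectors do not span. -/
theorem uClass_eq_zero {X : ι → Λ} {b : Set ι} {φ : AddChar Λ ℂ}
    (hb : LinearIndepOn ℂ (vecs X) b) {i : ι} (hib : i ∈ b) (hi : φ (X i) ≠ 1) :
    uClass X b φ = 0 := by
  rw [uClass, polarClass_eq_zero_iff]
  refine frac_mem_polarFiltration (fun h => LinearIndepOn.notMem_span hb hib ?_) _
  refine Submodule.span_mono ?_ (h ▸ Submodule.mem_top : vecs X i ∈ Submodule.span ℂ _)
  rintro _ ⟨k, hk, rfl⟩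
  refine ⟨k.1, ⟨?_, ?_⟩, rfl⟩
  · by_contra hkb
    simp [hkb] at hk
  · rintro rfl
    exact hi k.2

/-- Multiplication by a vector of `b` removes it from the denominator, which then no longer spans;
the vectors of `b` span `V`. -/
theorem symVec_smul_uClass {X : ι → Λ} {b : Set ι} {φ : AddChar Λ ℂ}
    (hb : IsExtractedBasis (vecs X) b) (hφ : ∀ i ∈ b, φ (X i) = 1) (a : Λ) :
    symVec a • uClass X b φ = 0 := by
  classical
  let T : Vec Λ →ₗ[ℂ] LinPolar (locList X φ) :=
    { toFun := fun v => SymmetricAlgebra.ι ℂ (Vec Λ) v • uClass X b φ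
      map_add' := fun v w => by rw [map_add, add_smul]
      map_smul' := fun c v => by rw [map_smul, smul_assoc, RingHom.id_apply] }
  have hT : (⊤ : Submodule ℂ (Vec Λ)) ≤ LinearMap.ker T := by
    rw [← hb.2, Submodule.span_le]
    rintro _ ⟨i, hi, rfl⟩
    change linEq (locList X φ) ⟨i, hφ i hi⟩ • uClass X b φ = 0
    set k : LocIdx X φ := ⟨i, hφ i hi⟩
    have h1 : (fun j : LocIdx X φ => b.indicator (1 : ι → ℕ) j.1) =
        (fun j => (b \ {i}).indicator (1 : ι → ℕ) j.1) + Pi.single k 1 := by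
      ext j
      rcases eq_or_ne j k with rfl | hj
      · simp [k, hi]
      · have hj' : j.1 ≠ i := fun h => hj (Subtype.ext h)
        by_cases hjb : j.1 ∈ b <;> simp [hj, hj', hjb]
    have h2 : linEq (locList X φ) k • uClass X b φ =
        polarClass _ _ (frac (linEq (locList X φ)) 1
          fun j => (b \ {i}).indicator (1 : ι → ℕ) j.1) := by
      have h3 : ∏ j, linEq (locList X φ) j ^ (Pi.single k 1 : LocIdx X φ → ℕ) j =
          linEq (locList X φ) k := by
        rw [Finset.prod_eq_single k (fun j _ hj => by rw [Pi.single_eq_of_ne hj, pow_zero])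
          (fun h => absurd (Finset.mem_univ k) h), Pi.single_eq_same, pow_one]
      have h4 := smul_frac (linEq (locList X φ)) (linEq (locList X φ) k) 1
        fun j : LocIdx X φ => b.indicator (1 : ι → ℕ) j.1
      rw [mul_one] at h4
      rw [frac_eq_frac_add _ 1 _ (Pi.single k 1), ← h1, one_mul, h3, ← h4]
      rfl
    rw [h2, polarClass_eq_zero_iff]
    refine frac_mem_polarFiltration (fun h => LinearIndepOn.notMem_span hb.1 hi ?_) _
    refine Submodule.span_mono ?_ (h ▸ Submodule.mem_top : vecs X i ∈ Submodule.span ℂ _)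
    rintro _ ⟨j, hj, rfl⟩
    refine ⟨j.1, ?_, rfl⟩
    by_contra hjb
    simp [Set.indicator_of_notMem hjb] at hj
  exact hT (Submodule.mem_top (x := toVec a))

theorem locMap_omegaClass (X : ι → Λ) (b : Set ι) [DecidablePred (· ∈ b)] (φ ψ : AddChar Λ ℂ)
    (R : Finset Λ) :
    (∏ i with i ∈ b, toddFactor (locNil_linPolar (locList X ψ)) X ψ i) •
        locMap X ψ (omegaClass X b φ R) =
      locTor X ψ (charIdem φ R) • uClass X b ψ := by
  have h1 : omegaClass X b φ R = torClass X (charIdem φ R * ∏ i with i ∉ b, torEq X i) 1 := by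
    rw [omegaClass, torClass, frac_eq_frac_const_one]
  have h2 := prod_toddFactor_mul_tdC_mul (locNil_linPolar (locList X ψ)) X ψ b
  rw [h1, locMap_torClass, locRaw_mul, locRaw, uClass_eq, pow_one, smul_smul, mul_comm, mul_smul]
  congr 1
  rw [smul_smul, h2, mulC_smul]

/-- After multiplication by the invertible factors of `b`, the component is `charIdem φ R` acting on
`uClass X b ψ`. If `ψ` is trivial on `b`, this class is killed by `V` and the action is evaluation
at `ψ`; otherwise it is zero. -/
theorem locMap_omegaClass_eq {X : ι → Λ} {b : Set ι} {φ ψ : AddChar Λ ℂ} {R : Finset Λ}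
    (hb : IsExtractedBasis (vecs X) b) (hφ : ∀ i ∈ b, φ (X i) = 1) (hR : IsRepresentatives X b R)
    [Decidable (ψ = φ)] :
    locMap X ψ (omegaClass X b φ R) = (if ψ = φ then (1 : ℂ) else 0) • uClass X b ψ := by
  classical
  have hu : IsUnit (∏ i with i ∈ b, toddFactor (locNil_linPolar (locList X ψ)) X ψ i) :=
    IsUnit.prod_iff.2 fun i _ => isUnit_toddFactor _ X ψ i
  refine hu.smul_left_cancel.1 ?_
  rw [locMap_omegaClass]
  by_cases hψ : ∀ i ∈ b, ψ (X i) = 1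
  · have hk := symVec_smul_uClass hb hψ
    rw [torC_smul_of_killed _ ψ hk, evChar_charIdem hR hφ hψ, cen_smul_complex,
      prod_toddFactor_smul_of_killed _ X ψ hk _ fun i hi => hψ i (Finset.mem_filter.1 hi).2]
    congr
  · push Not at hψ
    obtain ⟨i, hib, hi⟩ := hψ
    rw [uClass_eq_zero hb.1 hib hi, smul_zero, smul_zero, smul_zero]

theorem isLocalIdentification_locEquiv [Module.Free ℤ Λ] {X : ι → Λ} (hX : ∀ i, X i ≠ 0) :
    IsLocalIdentification X (locEquiv hX) where
  nilpotent a φ y := locNil_linPolar _ a y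
  map_eexp a x φ := by
    rw [locEquiv_apply, locEquiv_apply, locMap_smul, torC_eexp_smul]
  map_deriv u φ x y h := by
    rw [locEquiv_apply] at h ⊢
    rw [locMap_derivation, h, polarDerivation_polarClass]
  map_omega φ b R hb hφ hR := by
    classical
    refine ⟨?_, fun ψ hψ => ?_⟩
    · rw [locEquiv_apply, locMap_omegaClass_eq hb hφ hR, if_pos rfl, one_smul]
    · rw [locEquiv_apply, locMap_omegaClass_eq hb hφ hR, if_neg fun h => hψ (Subtype.ext h),
        zero_smul]

end Bijective

/-! ### Annihilators and the commutative square. -/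

section Diagram

variable {Λ : Type*} [AddCommGroup Λ] [Module.Finite ℤ Λ] {ι : Type*} [Fintype ι]

theorem exists_quotEquivSpanSingleton {A M : Type*} [CommRing A] [AddCommGroup M] [Module A M]
    {m : M} {I : Ideal A} (h : Ideal.torsionOf A M m = I) :
    ∃ e : (A ⧸ I) ≃ₗ[A] Submodule.span A {m},
      ∀ f : A, (e (Ideal.Quotient.mk I f) : M) = f • m := by
  subst h
  exact ⟨Ideal.quotTorsionOfEquivSpanSingleton A M m, fun f => rfl⟩

theorem torsionOf_uGen [Module.Free ℤ Λ] {Z : ι → Λ} (hZ : ∀ i, Z i ≠ 0) :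
    Ideal.torsionOf (SymV Λ) (LinPolar Z) (uGen Z) = linIdeal Z 1 := by
  ext g
  rw [Ideal.mem_torsionOf_iff]
  exact ⟨fun h => mem_linIdeal_of_smul_polarPow hZ h, fun h => smul_polarPow_eq_zero h⟩

omit [Module.Finite ℤ Λ] in
theorem smul_vGen (X : ι → Λ) (f : GrpAlg Λ) : f • vGen X = torClass X f 1 := by
  rw [← mul_one f, ← smul_torClass, mul_one]
  rfl

theorem locTodd_smul_locMap_smul_vGen (X : ι → Λ) (φ : AddChar Λ ℂ) (f : GrpAlg Λ) :
    locTodd X φ • locMap X φ (f • vGen X) = quotToPolar _ 1 (topHom X φ 1 f) := by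
  have h := locTodd_pow_smul_locRaw X φ f 1
  rwa [pow_one, ← locMap_torClass, ← smul_vGen] at h

/-- If `f` kills `v_X`, each local component gives `topHom X φ 1 f = 0` by injectivity of
`quotToPolar`. No cancellation of toric equations is needed. -/
theorem torsionOf_vGen [Module.Free ℤ Λ] {X : ι → Λ} (hX : ∀ i, X i ≠ 0) :
    Ideal.torsionOf (GrpAlg Λ) (TorPolar X) (vGen X) = torIdeal X 1 := by
  ext f
  rw [Ideal.mem_torsionOf_iff]
  refine ⟨fun h => mem_torIdeal_of_topHom_eq_zero fun φ _ => ?_, fun h => ?_⟩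
  · have h1 := locTodd_smul_locMap_smul_vGen X φ f
    rw [h, map_zero, smul_zero] at h1
    exact (injective_iff_map_eq_zero _).1
      (quotToPolar_injective (Z := locList X φ) (fun i => hX i.1) 1) _ h1.symm
  · rw [smul_vGen, torClass_eq_zero h]

/-- The logarithm isomorphism. -/
def topEquiv (X : ι → Λ) (n : ℕ) : (GrpAlg Λ ⧸ torIdeal X n) ≃ₐ[ℂ]
    (∀ φ : arrPoints X, SymV Λ ⧸ linIdeal (locList X φ) n) :=
  AlgEquiv.ofBijective
    (Ideal.Quotient.liftₐ (torIdeal X n) (AlgHom.pi fun φ : arrPoints X => topHom X φ.1 n)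
      fun _ hf => funext fun _ => topHom_eq_zero hf)
    ⟨by
      rw [injective_iff_map_eq_zero]
      intro y hy
      obtain ⟨f, rfl⟩ := Ideal.Quotient.mk_surjective y
      exact Ideal.Quotient.eq_zero_iff_mem.2
        (mem_torIdeal_of_topHom_eq_zero fun φ hφ => congrFun hy ⟨φ, hφ⟩), by
      intro y
      obtain ⟨f, hf⟩ := exists_topHom_eq X n y
      exact ⟨Ideal.Quotient.mk _ f, funext hf⟩⟩

omit [Module.Finite ℤ Λ] in
theorem isUnit_toddQuot (X : ι → Λ) (φ : AddChar Λ ℂ) (n : ℕ) : IsUnit (toddQuot X φ n) := by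
  classical
  refine IsUnit.prod_iff.2 fun i _ => ?_
  split_ifs with h
  · rw [seriesAct_quotient_one]
    exact isUnit_toddInv (isNilpotent_mk_symVec (locList X φ) n (X i))
  · exact isUnit_charExp_torEq _ h

omit [Module.Finite ℤ Λ] in
theorem topHom_eexp_eq (X : ι → Λ) (φ : AddChar Λ ℂ) (n : ℕ) (a : Λ) :
    topHom X φ n (eexp a) =
      φ a • seriesAct expCoeff (symVec a) (1 : SymV Λ ⧸ linIdeal (locList X φ) n) := by
  rw [topHom_eexp, nilExp, seriesAct_quotient_one]

omit [Module.Finite ℤ Λ] in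
open scoped Classical in
theorem toddQuot_eq (X : ι → Λ) (φ : AddChar Λ ℂ) (n : ℕ) :
    toddQuot X φ n = ∏ i : ι, if φ (X i) = 1
      then seriesAct toddInvCoeff (symVec (X i)) (1 : SymV Λ ⧸ linIdeal (locList X φ) n)
      else 1 - φ (-X i) •
        seriesAct expCoeff (symVec (-X i)) (1 : SymV Λ ⧸ linIdeal (locList X φ) n) := by
  refine Finset.prod_congr rfl fun i _ => ?_
  rw [torEq, map_sub, map_one, topHom_eexp_eq]

theorem exists_completion_of_square {A N α : Type*} {B Q : α → Type*} [CommRing A] [Algebra ℂ A]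
    [AddCommGroup N] [Module ℂ N] [∀ i, CommRing (B i)] [∀ i, Algebra ℂ (B i)]
    [∀ i, AddCommGroup (Q i)] [∀ i, Module ℂ (Q i)] (left : A ≃ₗ[ℂ] N) (top : A ≃ₐ[ℂ] ∀ i, B i)
    (κ : ∀ i, B i ≃ₗ[ℂ] Q i) (td : ∀ i, (B i)ˣ) :
    ∃ bottom : N ≃ₗ[ℂ] ∀ i, Q i, ∀ x i, bottom (left x) i = κ i (td i * top x i) := by
  refine ⟨left.symm ≪≫ₗ top.toLinearEquiv ≪≫ₗ LinearEquiv.piCongrRight fun i =>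
    (LinearEquiv.smulOfUnit (td i)).restrictScalars ℂ ≪≫ₗ κ i, fun x i => ?_⟩
  change κ i (td i * top (left.symm (left x)) i) = _
  rw [left.symm_apply_apply]

/-- The two routes from the cyclic toric module to the local linear modules agree. -/
theorem locMap_smul_vGen {X : ι → Λ} {φ : AddChar Λ ℂ} {t : SymV Λ ⧸ linIdeal (locList X φ) 1}
    (ht : toddQuot X φ 1 * t = 1) (f : GrpAlg Λ) :
    locMap X φ (f • vGen X) = quotToPolar _ 1 (t * topHom X φ 1 f) := by
  refine locTodd_pow_smul_injective X φ 1 ?_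
  rw [pow_one, locTodd_smul_quotToPolar, ← mul_assoc, ht, one_mul, locTodd_smul_locMap_smul_vGen]

open scoped Classical in
-- The ideals are variables because the order-one ideals are written with `d i ^ 1`; the equalities
-- `hJ` and `hI` let the result be used with `JIdeal` and `IIdeal`. The bottom map is defined by
-- completing the square and only then compared with `locMap`.
theorem exists_diagram [Module.Free ℤ Λ] {X : ι → Λ} (hX : ∀ i, X i ≠ 0) {J : Ideal (GrpAlg Λ)}
    (hJ : J = torIdeal X 1) {I : arrPoints X → Ideal (SymV Λ)}
    (hI : I = fun φ => linIdeal (locList X φ.1) 1) :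
    ∃ (left : (GrpAlg Λ ⧸ J) ≃ₗ[GrpAlg Λ] TorQ X)
      (top : (GrpAlg Λ ⧸ J) ≃ₐ[ℂ] (∀ φ : arrPoints X, SymV Λ ⧸ I φ))
      (bottom : TorQ X ≃ₗ[ℂ] (∀ φ : arrPoints X, LinQ (locList X φ)))
      (κ : ∀ φ : arrPoints X, (SymV Λ ⧸ I φ) ≃ₗ[SymV Λ] LinQ (locList X φ))
      (td : ∀ φ : arrPoints X, (SymV Λ ⧸ I φ)ˣ),
      (∀ f : GrpAlg Λ, (left (Ideal.Quotient.mk J f) : TorPolar X) = f • vGen X) ∧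
      (∀ (a : Λ) (φ : arrPoints X), top (Ideal.Quotient.mk J (eexp a)) φ =
        φ.1 a • seriesAct expCoeff (symVec a) (1 : SymV Λ ⧸ I φ)) ∧
      (∀ (x : TorQ X) (φ : arrPoints X),
        (bottom x φ : LinPolar (locList X φ)) = locMap X φ (x : TorPolar X)) ∧
      (∀ (φ : arrPoints X) (g : SymV Λ),
        (κ φ (Ideal.Quotient.mk (I φ) g) : LinPolar (locList X φ)) = g • uGen (locList X φ)) ∧
      (∀ φ : arrPoints X, (((td φ)⁻¹ : (SymV Λ ⧸ I φ)ˣ) : SymV Λ ⧸ I φ) =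
        ∏ i : ι, if φ.1 (X i) = 1
          then seriesAct toddInvCoeff (symVec (X i)) (1 : SymV Λ ⧸ I φ)
          else 1 - φ.1 (-X i) • seriesAct expCoeff (symVec (-X i)) (1 : SymV Λ ⧸ I φ)) ∧
      (∀ (x : GrpAlg Λ ⧸ J) (φ : arrPoints X), bottom (left x) φ = κ φ (td φ * top x φ)) := by
  subst hJ hI
  have hv := torsionOf_vGen hX
  obtain ⟨left, hleft⟩ := exists_quotEquivSpanSingleton hv
  have hu : ∀ φ : arrPoints X, _ := fun φ =>
    torsionOf_uGen (Z := locList X φ.1) fun i => hX i.1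
  choose κ hκ using fun φ => exists_quotEquivSpanSingleton (hu φ)
  let td : ∀ φ : arrPoints X, (SymV Λ ⧸ linIdeal (locList X φ.1) 1)ˣ :=
    fun φ => (isUnit_toddQuot X φ.1 1).unit⁻¹
  obtain ⟨bottom, hbottom⟩ := exists_completion_of_square (left.restrictScalars ℂ) (topEquiv X 1)
    (fun φ => (κ φ).restrictScalars ℂ) td
  refine ⟨left, topEquiv X 1, bottom, κ, td, hleft, fun a φ => topHom_eexp_eq X φ.1 1 a,
    fun x φ => ?_, hκ, fun φ => toddQuot_eq X φ.1 1, hbottom⟩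
  obtain ⟨y, rfl⟩ := left.surjective x
  obtain ⟨f, rfl⟩ := Ideal.Quotient.mk_surjective y
  obtain ⟨g, hg⟩ := Ideal.Quotient.mk_surjective
    ((td φ : SymV Λ ⧸ linIdeal (locList X φ.1) 1) * topHom X φ.1 1 f)
  rw [hleft, locMap_smul_vGen (isUnit_toddQuot X φ.1 1).mul_val_inv f]
  refine (congrArg Subtype.val (hbottom _ φ)).trans ?_
  change (κ φ ((td φ).1 * topHom X φ.1 1 f)).1 = quotToPolar _ 1 ((td φ).1 * topHom X φ.1 1 f)
  rw [← hg, hκ, quotToPolar_mk]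
  rfl

end Diagram

end ToricPolar

end

theorem mainTheorem7 {Λ : Type*} [AddCommGroup Λ] [Module.Free ℤ Λ] [Module.Finite ℤ Λ]
    {ι : Type*} [Fintype ι] (X : ι → Λ) (hX : ∀ i, X i ≠ 0)
    (hspan : Submodule.span ℂ (Set.range (vecs X)) = ⊤) :
    Ideal.torsionOf (GrpAlg Λ) (TorPolar X) (vGen X) = JIdeal X ∧
    (arrPoints X).Finite ∧
    ∃ (left : (GrpAlg Λ ⧸ JIdeal X) ≃ₗ[GrpAlg Λ] TorQ X)
      (top : (GrpAlg Λ ⧸ JIdeal X) ≃ₐ[ℂ] (∀ φ : arrPoints X, AAlg (locList X φ)))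
      (j : TorPolar X ≃ₗ[ℂ] (∀ φ : arrPoints X, LinPolar (locList X φ)))
      (bottom : TorQ X ≃ₗ[ℂ] (∀ φ : arrPoints X, LinQ (locList X φ)))
      (κ : ∀ φ : arrPoints X, AAlg (locList X φ) ≃ₗ[SymV Λ] LinQ (locList X φ))
      (td : ∀ φ : arrPoints X, (AAlg (locList X φ))ˣ),
      (∀ f : GrpAlg Λ, (left (Ideal.Quotient.mk (JIdeal X) f) : TorPolar X) = f • vGen X) ∧
      (∀ (a : Λ) (φ : arrPoints X),
        top (Ideal.Quotient.mk (JIdeal X) (eexp a)) φ = locExp X φ a) ∧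
      IsLocalIdentification X j ∧
      (∀ (x : TorQ X) (φ : arrPoints X),
        (bottom x φ : LinPolar (locList X φ)) = j (x : TorPolar X) φ) ∧
      (∀ (φ : arrPoints X) (g : SymV Λ),
        (κ φ (Ideal.Quotient.mk (IIdeal (locList X φ)) g) : LinPolar (locList X φ)) =
          g • uGen (locList X φ)) ∧
      (∀ φ : arrPoints X, (((td φ)⁻¹ : (AAlg (locList X φ))ˣ) : AAlg (locList X φ)) =
        toddInv X φ) ∧
      (∀ (x : GrpAlg Λ ⧸ JIdeal X) (φ : arrPoints X),
        bottom (left x) φ = κ φ (td φ * top x φ)) := by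
  obtain ⟨left, top, bottom, κ, td, h1, h2, h3, h4, h5, h6⟩ :=
    exists_diagram hX (torIdeal_one X).symm
      (I := fun φ => IIdeal (locList X φ)) (funext fun φ => (linIdeal_one _).symm)
  exact ⟨(torsionOf_vGen hX).trans (torIdeal_one X), arrPoints_finite X, left, top, locEquiv hX,
    bottom, κ, td, h1, h2, isLocalIdentification_locEquiv hX, h3, h4, h5, h6⟩
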